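/- Let $M$ be a finite monoid with set of idempotents $E(M)$. For $e\in E(M)$ let $G_e$ be the group of units of $eMe$ (a maximal subgroup of $M$) and let $R_e$, $L_e$ be the $\mathscr R$- and $\mathscr L$-classes of $e$. Write $m\mathrel{\widetilde{\mathscr L}}n$ if, for every $a\in E(M)$, $ma=m$ if and only if $na=n$; let $\widetilde L_e$ be the $\widetilde{\mathscr L}$-class of $e$. Assume that $M$ is right Fountain, i.e. every $\widetilde{\mathscr L}$-class contains an idempotent. Let $\Bbbk$ be a field. The space $\Bbbk\widetilde L_e$ is a $\Bbbk M$-$\Bbbk G_e$-bimodule: $m\in M$ sends $x\in\widetilde L_e$ to $mx$ if $mx\in\widetilde L_e$ and to $0$ otherwise, and $G_e$ acts by right multiplication. For a $\Bbbk G_e$-module $V$ let $\mathrm{Coind}_{G_e}(V)$ be the left $\Bbbk M$-module of $G_e$-equivariant maps $\varphi\colon R_e\to V$, where $(m\varphi)(r)=\varphi(rm)$ if $rm\in R_e$ and $(m\varphi)(r)=0$ otherwise. If $V$ is simple, let $V^\sharp=\Bbbk M e\,\mathrm{Coind}_{G_e}(V)$ be the corresponding simple $\Bbbk M$-module. Suppose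 that: (1) the characteristic of $\Bbbk$ divides the order of no maximal subgroup of $M$; (2) $\Bbbk$ is a splitting field for each maximal subgroup $G$ of $M$, i.e. $\Bbbk G/\mathrm{rad}(\Bbbk G)$ is a direct product of matrix algebras over $\Bbbk$; (3) for a complete set $e_1,\dots,e_n$ of idempotent representatives of the regular $\mathscr J$-classes of $M$, one of the following three (equivalent) conditions holds: (a) for each $i$, a sandwich matrix of the $\mathscr J$-class of $e_i$ is right invertible over $\Bbbk G_{e_i}$; (b) for each $i$ and each simple $\Bbbk G_{e_i}$-module $U$, the module $\mathrm{Coind}_{G_{e_i}}(U)$ is simple; (c) for each $i$ and each simple $\Bbbk G_{e_i}$-module $U$, the projective cover of $U^\sharp$ is $\Bbbk\widetilde L_{e_i}\otimes_{\Bbbk G_{e_i}}U$. Here a sandwich matrix of the $\mathscr J$-class $J$ of $e$ is the matrix $P$ with rows indexed by the $\mathscr L$-classes $b$ in $J$, columns indexed by the $\mathscr R$-classes $a$ in $J$, and entries $P(b,a)=\lambda_b\rho_a$ if $\lambda_b\rho_a\in G_e$ and $P(b,a)=0$ otherwise, where $\lambda_b\in R_e\cap b$ and $\rho_a\in L_e\cap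 a$ are chosen representatives. Let $e,f\in E(M)$, let $W$ be a simple $\Bbbk G_f$-module and $V$ a simple $\Bbbk G_e$-module. Then $\mathrm{Coind}_{G_e}(V)$ and $\mathrm{Coind}_{G_f}(W)$ are simple $\Bbbk M$-modules, and the number of arrows in the quiver of $\Bbbk M$ from the isomorphism class of $\mathrm{Coind}_{G_e}(V)$ to that of $\mathrm{Coind}_{G_f}(W)$, that is, $\dim_\Bbbk\mathrm{Ext}^1_{\Bbbk M}(\mathrm{Coind}_{G_e}(V),\mathrm{Coind}_{G_f}(W))$ (which is finite), is the multiplicity of $W\otimes D(V)$ as an irreducible constituent (composition factor) of the $\Bbbk[G_f\times G_e]$-module $$f\,\mathrm{rad}(\Bbbk\widetilde L_e)\,/\,f I(f)\,\mathrm{rad}(\Bbbk\widetilde L_e).$$ Here $\mathrm{rad}(\Bbbk\widetilde L_e)$ is the radical of the left $\Bbbk M$-module $\Bbbk\widetilde L_e$, $I(f)=\{m\in M\mid f\notin MmM\}$, $I(f)U$ is the span of all $mu$ with $m\in I(f)$ and $u\in U$, the pair $(g,h)\in G_f\times G_e$ sends the class of $x$ to the class of $gxh^{-1}$, and $D(V)$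 is the vector space dual of $V$, so that $(g,h)(w\otimes\varphi)=gw\otimes(\varphi\circ h^{-1})$. -/

import Mathlib

universe u v w

open scoped TensorProduct

namespace FountainMonoid

/-! ### Green's relations, idempotents and maximal subgroups -/

section Green

variable {M : Type*} [Monoid M]

/-- The principal left ideal `Mm`. -/
def leftIdeal (m : M) : Set M := {x | ∃ a, x = a * m}

/-- The principal right ideal `mM`. -/
def rightIdeal (m : M) : Set M := {x | ∃ a, x = m * a}

/-- The principal two-sided ideal `MmM`. -/
def twoSidedIdeal (m : M) : Set M := {x | ∃ a b, x = a * m * b}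

/-- Green's relation `𝓛`. -/
def LRel (m n : M) : Prop := leftIdeal m = leftIdeal n

/-- Green's relation `𝓡`. -/
def RRel (m n : M) : Prop := rightIdeal m = rightIdeal n

/-- Green's relation `𝓙`. -/
def JRel (m n : M) : Prop := twoSidedIdeal m = twoSidedIdeal n

variable (M) in
/-- The set `E(M)` of idempotents of `M`. -/
abbrev Idem : Type _ := {e : M // IsIdempotentElem e}

/-- The local monoid `eMe`, whose identity is `e`. -/
def LocalMonoid (e : Idem M) : Type _ := {m : M // e.1 * m = m ∧ m * e.1 = m}

instance (e : Idem M) : Monoid (LocalMonoid e) where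
  mul a b := ⟨a.1 * b.1, by rw [← mul_assoc, a.2.1], by rw [mul_assoc, b.2.2]⟩
  one := ⟨e.1, e.2, e.2⟩
  mul_assoc a b c := Subtype.ext (mul_assoc a.1 b.1 c.1)
  one_mul a := Subtype.ext a.2.1
  mul_one a := Subtype.ext a.2.2

/-- The maximal subgroup `G_e` of `M` at `e`: the group of units of `eMe`. -/
abbrev MaxSubgroup (e : Idem M) : Type _ := (LocalMonoid e)ˣ

/-- An element of `G_e`, seen in `M`. -/
def MaxSubgroup.toM {e : Idem M} (g : MaxSubgroup e) : M := g.val.1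

namespace MaxSubgroup

variable {e : Idem M}

lemma toM_mul (g h : MaxSubgroup e) : (g * h).toM = g.toM * h.toM := rfl

lemma toM_one : (1 : MaxSubgroup e).toM = e.1 := rfl

lemma e_mul (g : MaxSubgroup e) : e.1 * g.toM = g.toM := g.val.2.1

lemma mul_e (g : MaxSubgroup e) : g.toM * e.1 = g.toM := g.val.2.2

lemma toM_mul_inv (g : MaxSubgroup e) : g.toM * (g⁻¹).toM = e.1 := by
  rw [← toM_mul, mul_inv_cancel, toM_one]

lemma toM_inv_mul (g : MaxSubgroup e) : (g⁻¹).toM * g.toM = e.1 := by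
  rw [← toM_mul, inv_mul_cancel, toM_one]

end MaxSubgroup

/-- `ε 1, …, ε n` is a complete set of idempotent representatives of the regular `𝓙`-classes:
no two of them are `𝓙`-equivalent, and each regular element is `𝓙`-equivalent to one of them. -/
structure IsRegularRepresentatives {n : ℕ} (ε : Fin n → Idem M) : Prop where
  eq_of_jRel : ∀ i j, JRel (ε i).1 (ε j).1 → i = j
  exists_jRel : ∀ m : M, (∃ x, m = m * x * m) → ∃ i, JRel m (ε i).1

/-- The set `I(f)` of all `m` with `f ∉ MmM`. -/
def nonDivisors (f : Idem M) : Set M := {m | f.1 ∉ twoSidedIdeal m}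

lemma mul_mem_nonDivisors {f : Idem M} (a : M) {m : M} (hm : m ∈ nonDivisors f) :
    a * m ∈ nonDivisors f := by
  rintro ⟨x, y, h⟩
  exact hm ⟨x * a, y, by rw [h]; simp only [mul_assoc]⟩

/-! ### The relation `𝓛̃` and right Fountain monoids -/

/-- `m 𝓛̃ n` when `m` and `n` have the same right identities among the idempotents. -/
def LTildeRel (m n : M) : Prop := ∀ a : M, IsIdempotentElem a → (m * a = m ↔ n * a = n)

variable (M) in
/-- A monoid is right Fountain if each `𝓛̃`-class contains an idempotent. -/
class RightFountain : Prop where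
  exists_idem : ∀ m : M, ∃ e : Idem M, LTildeRel m e.1

/-- The `𝓛̃`-class `L̃_e` of `e`. -/
abbrev LTilde (e : Idem M) : Type _ := {m : M // LTildeRel m e.1}

lemma mul_e_of_lTildeRel {e : Idem M} {m : M} (hm : LTildeRel m e.1) : m * e.1 = m :=
  (hm e.1 e.2).2 e.2

/-- If `yx ∈ L̃_e` and `x ∈ Me`, then `x ∈ L̃_e`: the complement of `L̃_e` in `Me` is a left
ideal. -/
lemma lTildeRel_of_mul {e : Idem M} {x y : M} (hx : x * e.1 = x) (h : LTildeRel (y * x) e.1) :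
    LTildeRel x e.1 := fun a ha =>
  ⟨fun hxa => (h a ha).1 (by rw [mul_assoc, hxa]), fun hea => by rw [← hx, mul_assoc, hea]⟩

/-- Every element of a finite monoid has an idempotent positive power. -/
lemma exists_idempotent_pow [Finite M] (x : M) : ∃ n : ℕ, 0 < n ∧ IsIdempotentElem (x ^ n) := by
  obtain ⟨i, j, hne, hij⟩ := Finite.exists_ne_map_eq_of_infinite (fun n : ℕ => x ^ (n + 1))
  wlog hlt : i < j generalizing i j
  · exact this j i hne.symm hij.symm (by omega)
  obtain ⟨d, rfl⟩ : ∃ d, j = i + d := ⟨j - i, by omega⟩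
  have hd : 0 < d := by omega
  have step : ∀ a, i + 1 ≤ a → x ^ (a + d) = x ^ a := fun a ha => by
    obtain ⟨c, rfl⟩ := Nat.exists_eq_add_of_le ha
    rw [show i + 1 + c + d = (i + d + 1) + c by ring, pow_add, ← hij, ← pow_add]
  have iter : ∀ t a, i + 1 ≤ a → x ^ (a + t * d) = x ^ a := by
    intro t
    induction t with
    | zero => intro a _; simp
    | succ t ih =>
      intro a ha
      rw [show a + (t + 1) * d = (a + t * d) + d by ring, step _ (by omega), ih a ha]
  refine ⟨(i + 1) * d, by positivity, ?_⟩
  change x ^ ((i + 1) * d) * x ^ ((i + 1) * d) = _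
  rw [← pow_add]
  exact iter (i + 1) _ (Nat.le_mul_of_pos_right _ hd)

/-- In a finite right Fountain monoid, `G_e` acts on the right of `L̃_e`. -/
lemma lTildeRel_mul_maxSubgroup [Finite M] [RightFountain M] {e : Idem M} (g : MaxSubgroup e)
    {m : M} (hm : LTildeRel m e.1) : LTildeRel (m * g.toM) e.1 := by
  obtain ⟨a, hma⟩ := RightFountain.exists_idem (m * g.toM)
  have hmga : m * g.toM * a.1 = m * g.toM := (hma a.1 a.2).2 a.2
  have hae : a.1 * e.1 = a.1 := (hma e.1 e.2).1 (by rw [mul_assoc, g.mul_e])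
  have hme := mul_e_of_lTildeRel hm
  set y := g.toM * a.1 * (g⁻¹).toM with hy
  have hmy : m * y = m := by
    rw [hy, ← mul_assoc, ← mul_assoc, hmga, mul_assoc, g.toM_mul_inv, hme]
  obtain ⟨n, hn, hyn⟩ := exists_idempotent_pow y
  have hpow : ∀ n : ℕ, m * y ^ n = m := by
    intro n
    induction n with
    | zero => simp
    | succ n ih => rw [pow_succ', ← mul_assoc, hmy, ih]
  have hey : e.1 * y ^ n = e.1 := (hm _ hyn).1 (hpow n)
  -- the idempotent `ea` satisfies `g⁻¹ y = ea g⁻¹`, hence `e` lies in `eaM`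
  have hyg : (g⁻¹).toM * y = e.1 * a.1 * (g⁻¹).toM := by
    rw [hy, ← mul_assoc, ← mul_assoc, g.toM_inv_mul]
  have hidem : e.1 * a.1 * (e.1 * a.1) = e.1 * a.1 := by
    rw [← mul_assoc, mul_assoc e.1 a.1 e.1, hae, mul_assoc, a.2]
  have hfix : e.1 * a.1 * e.1 = e.1 := by
    obtain ⟨n, rfl⟩ := Nat.exists_eq_succ_of_ne_zero hn.ne'
    have h1 : e.1 = e.1 * a.1 * ((g⁻¹).toM * y ^ n * g.toM) := by
      calc e.1 = (g⁻¹).toM * (e.1 * y ^ (n + 1)) * g.toM := by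
            rw [hey, (g⁻¹).mul_e, g.toM_inv_mul]
        _ = (g⁻¹).toM * y * y ^ n * g.toM := by
            rw [pow_succ', ← mul_assoc, (g⁻¹).mul_e, ← mul_assoc]
        _ = _ := by rw [hyg]; simp only [mul_assoc]
    calc e.1 * a.1 * e.1 = e.1 * a.1 * (e.1 * a.1 * ((g⁻¹).toM * y ^ n * g.toM)) := by rw [← h1]
      _ = e.1 * a.1 * ((g⁻¹).toM * y ^ n * g.toM) := by rw [← mul_assoc, hidem]
      _ = e.1 := h1.symm
  have hea : e.1 * a.1 = e.1 := by rwa [mul_assoc, hae] at hfix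

  intro b hb
  refine ⟨fun h => ?_, fun h => ?_⟩
  · have hab : a.1 * b = a.1 := (hma b hb).1 h
    rw [← hea, mul_assoc, hab]
  · rw [← g.mul_e, mul_assoc m, mul_assoc g.toM, h]

/-! ### The `𝓡`-class of an idempotent -/

/-- The `𝓡`-class `R_e`. -/
abbrev RClass (e : Idem M) : Type _ := {r : M // RRel r e.1}

lemma mem_rightIdeal_self (m : M) : m ∈ rightIdeal m := ⟨1, by simp⟩

lemma rightIdeal_subset {m n : M} (h : m ∈ rightIdeal n) : rightIdeal m ⊆ rightIdeal n := by
  rintro _ ⟨a, rfl⟩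
  obtain ⟨b, rfl⟩ := h
  exact ⟨b * a, by rw [mul_assoc]⟩

lemma e_mul_of_rRel {e : Idem M} {r : M} (hr : RRel r e.1) : e.1 * r = r := by
  have h : r ∈ rightIdeal e.1 := hr ▸ mem_rightIdeal_self r
  obtain ⟨a, rfl⟩ := h
  rw [← mul_assoc, e.2]

lemma rRel_maxSubgroup_mul {e : Idem M} (g : MaxSubgroup e) {r : M} (hr : RRel r e.1) :
    RRel (g.toM * r) e.1 := by
  apply Set.Subset.antisymm
  · exact rightIdeal_subset ⟨g.toM * r, by rw [← mul_assoc, g.e_mul]⟩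
  · have h : (g⁻¹).toM ∈ rightIdeal r := by
      rw [hr]; exact ⟨(g⁻¹).toM, ((g⁻¹).e_mul).symm⟩
    obtain ⟨a, ha⟩ := h
    exact rightIdeal_subset ⟨a, by rw [mul_assoc, ← ha, g.toM_mul_inv]⟩

lemma rRel_of_mul {e : Idem M} {r m n : M} (hr : RRel r e.1) (h : RRel (r * m * n) e.1) :
    RRel (r * m) e.1 := by
  apply Set.Subset.antisymm
  · rw [← hr]; exact rightIdeal_subset ⟨m, rfl⟩
  · rw [← h]; exact rightIdeal_subset ⟨n, rfl⟩

/-- The left action of `G_e` on `R_e`. -/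
def RClass.smul {e : Idem M} (g : MaxSubgroup e) (r : RClass e) : RClass e :=
  ⟨g.toM * r.1, rRel_maxSubgroup_mul g r.2⟩

lemma rRel_maxSubgroup_mul_iff {e : Idem M} (g : MaxSubgroup e) (r : RClass e) (m : M) :
    RRel (g.toM * r.1 * m) e.1 ↔ RRel (r.1 * m) e.1 := by
  refine ⟨fun h => ?_, fun h => by rw [mul_assoc]; exact rRel_maxSubgroup_mul g h⟩
  have h' := rRel_maxSubgroup_mul g⁻¹ h
  rwa [← mul_assoc, ← mul_assoc, g.toM_inv_mul, e_mul_of_rRel r.2] at h'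

end Green

/-! ### Sandwich matrices -/

section Sandwich

variable {M : Type*} [Monoid M]

/-- The set of `𝓡`-classes contained in the `𝓙`-class of `e`. -/
def RClassesIn (e : Idem M) : Type _ := {c : Set M // ∃ x, JRel x e.1 ∧ c = {y | RRel y x}}

/-- The set of `𝓛`-classes contained in the `𝓙`-class of `e`. -/
def LClassesIn (e : Idem M) : Type _ := {c : Set M // ∃ x, JRel x e.1 ∧ c = {y | LRel y x}}

instance [Finite M] (e : Idem M) : Finite (RClassesIn e) :=
  inferInstanceAs (Finite {c : Set M // ∃ x, JRel x e.1 ∧ c = {y | RRel y x}})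

/-- A choice of representatives `ρ_a ∈ L_e ∩ a` of the `𝓡`-classes `a` and `lam_b ∈ R_e ∩ b` of the
`𝓛`-classes `b` of the `𝓙`-class of `e`. -/
structure SandwichData (e : Idem M) where
  rho : RClassesIn e → M
  rho_mem : ∀ a, rho a ∈ a.1
  rho_lRel : ∀ a, LRel (rho a) e.1
  lam : LClassesIn e → M
  lam_mem : ∀ b, lam b ∈ b.1
  lam_rRel : ∀ b, RRel (lam b) e.1

open Classical in
/-- The sandwich matrix: `P(b,a) = lam_b ρ_a` if this lies in `G_e`, and `0` otherwise; with entries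
viewed in the group algebra of `G_e`. -/
noncomputable def SandwichData.matrix (k : Type*) [Field k] {e : Idem M} (s : SandwichData e) :
    Matrix (LClassesIn e) (RClassesIn e) (MonoidAlgebra k (MaxSubgroup e)) :=
  fun b a => if h : ∃ g : MaxSubgroup e, g.toM = s.lam b * s.rho a
    then MonoidAlgebra.of k (MaxSubgroup e) h.choose else 0

open Classical in
/-- The `𝓙`-class of `e` has a sandwich matrix (at `e`) that is right invertible over `k G_e`. -/
def SandwichRightInvertible (k : Type*) [Field k] [Finite M] (e : Idem M) : Prop :=
  letI : Fintype (RClassesIn e) := Fintype.ofFinite _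
  ∃ s : SandwichData e,
    ∃ Q : Matrix (RClassesIn e) (LClassesIn e) (MonoidAlgebra k (MaxSubgroup e)),
      s.matrix k * Q = 1

end Sandwich

/-! ### General notions for modules -/

/-- The `kM`-module defined by a representation `ρ` of `M`: a copy of the space `X`, on which
`m ∈ M` acts by `ρ m`. -/
def RepModule {k M X : Type*} [Field k] [Monoid M] [AddCommGroup X] [Module k X]
    (_ : Representation k M X) : Type _ := X

namespace RepModule

variable {k M X : Type*} [Field k] [Monoid M] [AddCommGroup X] [Module k X]
  (ρ : Representation k M X)

instance : AddCommGroup (RepModule ρ) := inferInstanceAs (AddCommGroup X)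

instance : Module k (RepModule ρ) := inferInstanceAs (Module k X)

/-- The identity map between `RepModule ρ` and the space on which `ρ` acts. -/
def equiv : RepModule ρ ≃ₗ[k] X := LinearEquiv.refl k X

noncomputable instance : Module (MonoidAlgebra k M) (RepModule ρ) :=
  Module.compHom X ρ.asAlgebraHom.toRingHom

lemma smul_def (a : MonoidAlgebra k M) (x : RepModule ρ) :
    a • x = (equiv ρ).symm (ρ.asAlgebraHom a (equiv ρ x)) := rfl

lemma of_smul (m : M) (x : RepModule ρ) :
    MonoidAlgebra.of k M m • x = (equiv ρ).symm (ρ m (equiv ρ x)) := by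
  rw [smul_def, ρ.asAlgebraHom_of]

instance : IsScalarTower k (MonoidAlgebra k M) (RepModule ρ) where
  smul_assoc c a x := by
    rw [smul_def, smul_def, map_smul, LinearMap.smul_apply, map_smul]

/-- An endomorphism of `X` that commutes with `M` is `kM`-linear. -/
noncomputable def endo (T : X →ₗ[k] X) (hT : ∀ m x, ρ m (T x) = T (ρ m x)) :
    RepModule ρ →ₗ[MonoidAlgebra k M] RepModule ρ where
  toFun x := (equiv ρ).symm (T (equiv ρ x))
  map_add' x y := by simp
  map_smul' a x := by
    simp only [smul_def, LinearEquiv.apply_symm_apply, RingHom.id_apply]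
    congr 1
    suffices h : T ∘ₗ ρ.asAlgebraHom a = ρ.asAlgebraHom a ∘ₗ T from LinearMap.congr_fun h _
    induction a using MonoidAlgebra.induction_on with
    | of m => ext x; simp [hT]
    | add f g hf hg => rw [map_add, LinearMap.comp_add, LinearMap.add_comp, hf, hg]
    | smul c f hf => rw [map_smul, LinearMap.comp_smul, LinearMap.smul_comp, hf]

end RepModule

/-- A finite dimensional algebra `A` over `k` is split if `A / rad A` is isomorphic to a finite
product of matrix algebras over `k`. -/
def IsSplitAlgebra (k A : Type*) [Field k] [Ring A] [Algebra k A] : Prop :=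
  ∃ (r : ℕ) (d : Fin r → ℕ) (φ : A →ₐ[k] (∀ i, Matrix (Fin (d i)) (Fin (d i)) k)),
    Function.Surjective φ ∧ RingHom.ker φ = Ring.jacobson A

/-- `P` is a projective cover of `S`. -/
def IsProjectiveCover (A P S : Type*) [Ring A] [AddCommGroup P] [Module A P] [AddCommGroup S]
    [Module A S] : Prop :=
  Module.Projective A P ∧
    ∃ ψ : P →ₗ[A] S, Function.Surjective ψ ∧ LinearMap.ker ψ ≤ Module.jacobson A P

/-- The number of factors of the composition series `s` of submodules that are isomorphic to
`S`. -/
noncomputable def factorCount {A X : Type*} [Ring A] [AddCommGroup X] [Module A X]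
    (s : CompositionSeries (Submodule A X)) (S : Type*) [AddCommGroup S] [Module A S] : ℕ :=
  Nat.card {i : Fin s.length //
    Nonempty ((↥(s i.succ) ⧸ (s i.castSucc).submoduleOf (s i.succ)) ≃ₗ[A] S)}

/-- `S` occurs exactly `n` times as a composition factor of the finite length module `X`. -/
def IsConstituentMultiplicity (A X S : Type*) [Ring A] [AddCommGroup X] [Module A X]
    [AddCommGroup S] [Module A S] (n : ℕ) : Prop :=
  (∃ s : CompositionSeries (Submodule A X), s.head = ⊥ ∧ s.last = ⊤) ∧
    ∀ s : CompositionSeries (Submodule A X), s.head = ⊥ → s.last = ⊤ → factorCount s S = n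

/-- The space `Ext¹_A(S, T)` over `k`; its dimension is the number of arrows from `[S]` to `[T]` in
the quiver of the split algebra `A`. -/
abbrev ArrowSpace (A : Type w) [Ring A] (S T : Type w)
    [AddCommGroup S] [Module A S] [AddCommGroup T] [Module A T] : Type w :=
  CategoryTheory.Abelian.Ext (ModuleCat.of A S) (ModuleCat.of A T) 1

/-- The number of arrows from `[S]` to `[T]` in the quiver of the split `k`-algebra `A`, where `S`
and `T` are simple `A`-modules. -/
noncomputable def quiverArrows (k : Type u) [Field k] (A : Type w) [Ring A] [Algebra k A]
    (S T : Type w) [AddCommGroup S] [Module A S] [AddCommGroup T] [Module A T] : ℕ :=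
  Module.finrank k (ArrowSpace A S T)

/-! ### Coinduced modules -/

section Coind

variable {k M : Type*} [Field k] [Monoid M] {e : Idem M} {V : Type*} [AddCommGroup V] [Module k V]

/-- `Coind_{G_e}(V) = Hom_{kG_e}(kR_e, V)`, realized as the space `Hom_{G_e}(R_e, V)` of
`G_e`-equivariant maps from `R_e` to `V`. -/
def coindSpace (σ : Representation k (MaxSubgroup e) V) : Submodule k (RClass e → V) where
  carrier := {φ | ∀ g r, φ (RClass.smul g r) = σ g (φ r)}
  add_mem' ha hb g r := by simp [ha g r, hb g r]
  zero_mem' g r := by simp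
  smul_mem' c φ h g r := by simp [h g r]

open Classical in
/-- The action of `M` on `Coind_{G_e}(V)`: `(mφ)(r) = φ(rm)` if `rm ∈ R_e`, and `0` otherwise. -/
noncomputable def coindRep (σ : Representation k (MaxSubgroup e) V) :
    Representation k M (coindSpace σ) where
  toFun m :=
    { toFun := fun φ => ⟨fun r => if h : RRel (r.1 * m) e.1 then φ.1 ⟨r.1 * m, h⟩ else 0, by
        intro g r
        have hiff := rRel_maxSubgroup_mul_iff g r m
        by_cases h : RRel (r.1 * m) e.1
        · have h' : RRel ((RClass.smul g r).1 * m) e.1 := hiff.2 h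
          simp only
          rw [dif_pos h', dif_pos h, ← φ.2 g ⟨r.1 * m, h⟩]
          exact congrArg φ.1 (Subtype.ext (mul_assoc _ _ _))
        · have h' : ¬ RRel ((RClass.smul g r).1 * m) e.1 := fun h' => h (hiff.1 h')
          simp only
          rw [dif_neg h', dif_neg h, map_zero]⟩
      map_add' := fun φ ψ => by
        ext r
        by_cases h : RRel (r.1 * m) e.1 <;> simp [h]
      map_smul' := fun c φ => by
        ext r
        by_cases h : RRel (r.1 * m) e.1 <;> simp [h] }
  map_one' := by
    ext φ r
    have h : RRel (r.1 * 1) e.1 := by rw [mul_one]; exact r.2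
    have h2 : (⟨r.1 * 1, h⟩ : RClass e) = r := Subtype.ext (mul_one _)
    simp only [LinearMap.coe_mk, AddHom.coe_mk, dif_pos h, h2]
    rfl
  map_mul' m n := by
    ext φ r
    simp only [LinearMap.coe_mk, AddHom.coe_mk, Module.End.mul_apply]
    by_cases h : RRel (r.1 * m) e.1
    · rw [dif_pos h]
      by_cases h2 : RRel (r.1 * m * n) e.1
      · have h3 : RRel (r.1 * (m * n)) e.1 := by rwa [← mul_assoc]
        rw [dif_pos h2, dif_pos h3]
        exact congrArg φ.1 (Subtype.ext (mul_assoc _ _ _).symm)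
      · have h3 : ¬ RRel (r.1 * (m * n)) e.1 := by rwa [← mul_assoc]
        rw [dif_neg h2, dif_neg h3]
    · have h3 : ¬ RRel (r.1 * (m * n)) e.1 := by
        rw [← mul_assoc]; exact fun h3 => h (rRel_of_mul r.2 h3)
      rw [dif_neg h, dif_neg h3]

/-- The submodule `V^♯ = kM e Coind_{G_e}(V)` of `Coind_{G_e}(V)`. For simple `V` it is the socle
of `Coind_{G_e}(V)` and it is the simple `kM`-module that corresponds to `V`. -/
noncomputable def sharp (σ : Representation k (MaxSubgroup e) V) :
    Submodule (MonoidAlgebra k M) (RepModule (coindRep σ)) :=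
  Submodule.span (MonoidAlgebra k M)
    (Set.range fun φ : RepModule (coindRep σ) => MonoidAlgebra.of k M e.1 • φ)

end Coind

/-! ### The bimodule `k L̃_e` -/

section Tilde

/-- `k L̃_e`: the `k`-vector space with basis `L̃_e`. -/
def TildeModule (k : Type*) {M : Type*} [Field k] [Monoid M] (e : Idem M) : Type _ :=
  LTilde e →₀ k

noncomputable instance (k : Type*) {M : Type*} [Field k] [Monoid M] (e : Idem M) :
    AddCommGroup (TildeModule k e) :=
  inferInstanceAs (AddCommGroup (LTilde e →₀ k))

noncomputable instance (k : Type*) {M : Type*} [Field k] [Monoid M] (e : Idem M) :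
    Module k (TildeModule k e) :=
  inferInstanceAs (Module k (LTilde e →₀ k))

variable (k : Type*) {M : Type*} [Field k] [Monoid M] (e : Idem M)

/-- The basis `L̃_e` of `k L̃_e`. -/
noncomputable def tildeBasis : Module.Basis (LTilde e) k (TildeModule k e) :=
  Module.Basis.ofRepr (LinearEquiv.refl k (LTilde e →₀ k))

open Classical in
/-- The action of `m ∈ M` on the left of `L̃_e`, with values in `k L̃_e`: `m · x = mx` if
`mx ∈ L̃_e`, and `0` otherwise. -/
noncomputable def tildeSmul (m : M) (x : LTilde e) : TildeModule k e :=
  if h : LTildeRel (m * x.1) e.1 then tildeBasis k e ⟨m * x.1, h⟩ else 0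

variable {e} in
lemma tildeSmul_of_mem {m : M} {x y : LTilde e} (h : m * x.1 = y.1) :
    tildeSmul k e m x = tildeBasis k e y := by
  have h' : LTildeRel (m * x.1) e.1 := h ▸ y.2
  rw [tildeSmul, dif_pos h']
  congr 1
  exact Subtype.ext h

variable {e} in
lemma tildeSmul_of_not_mem {m : M} {x : LTilde e} (h : ¬ LTildeRel (m * x.1) e.1) :
    tildeSmul k e m x = 0 := dif_neg h

/-- The left `kM`-module `k L̃_e`. -/
noncomputable def lTildeRep : Representation k M (TildeModule k e) where
  toFun m := (tildeBasis k e).constr k (tildeSmul k e m)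
  map_one' := by
    refine (tildeBasis k e).ext fun x => ?_
    rw [Module.Basis.constr_basis]
    exact tildeSmul_of_mem k (one_mul _)
  map_mul' m n := by
    refine (tildeBasis k e).ext fun x => ?_
    rw [Module.End.mul_apply, Module.Basis.constr_basis, Module.Basis.constr_basis]
    by_cases h : LTildeRel (n * x.1) e.1
    · rw [tildeSmul_of_mem k (y := ⟨n * x.1, h⟩) rfl, Module.Basis.constr_basis]
      by_cases h2 : LTildeRel (m * (n * x.1)) e.1
      · rw [tildeSmul_of_mem k (x := ⟨n * x.1, h⟩) (y := ⟨m * (n * x.1), h2⟩) rfl,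
          tildeSmul_of_mem k (x := x) (y := ⟨m * (n * x.1), h2⟩) (mul_assoc _ _ _)]
      · rw [tildeSmul_of_not_mem k (x := ⟨n * x.1, h⟩) h2, tildeSmul_of_not_mem]
        rwa [mul_assoc]
    · rw [tildeSmul_of_not_mem k h, map_zero, tildeSmul_of_not_mem]
      rw [mul_assoc]
      exact fun h3 => h (lTildeRel_of_mul (by rw [mul_assoc, mul_e_of_lTildeRel x.2]) h3)

lemma lTildeRep_basis (m : M) (x : LTilde e) :
    lTildeRep k e m (tildeBasis k e x) = tildeSmul k e m x :=
  Module.Basis.constr_basis _ _ _ _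

variable {e}

lemma lTildeRep_lTildeRep (m n : M) (z : TildeModule k e) :
    lTildeRep k e m (lTildeRep k e n z) = lTildeRep k e (m * n) z := by
  rw [map_mul, Module.End.mul_apply]

/-- Right multiplication by `g ∈ G_e` on `L̃_e`. -/
def LTilde.mulRight [Finite M] [RightFountain M] (g : MaxSubgroup e) (x : LTilde e) : LTilde e :=
  ⟨x.1 * g.toM, lTildeRel_mul_maxSubgroup g x.2⟩

/-- Right multiplication by `g ∈ G_e` on `k L̃_e`. -/
noncomputable def lTildeRight [Finite M] [RightFountain M] (g : MaxSubgroup e) :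
    TildeModule k e →ₗ[k] TildeModule k e :=
  (tildeBasis k e).constr k fun x => tildeBasis k e (LTilde.mulRight g x)

variable [Finite M] [RightFountain M]

lemma lTildeRight_basis (g : MaxSubgroup e) (x : LTilde e) :
    lTildeRight k g (tildeBasis k e x) = tildeBasis k e (LTilde.mulRight g x) :=
  Module.Basis.constr_basis _ _ _ _

lemma lTildeRight_one : lTildeRight k (1 : MaxSubgroup e) = LinearMap.id := by
  refine (tildeBasis k e).ext fun x => ?_
  rw [lTildeRight_basis, LinearMap.id_apply]
  congr 1
  exact Subtype.ext (mul_e_of_lTildeRel x.2)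

lemma lTildeRight_mul (g h : MaxSubgroup e) :
    lTildeRight k (g * h) = lTildeRight k h ∘ₗ lTildeRight k g := by
  refine (tildeBasis k e).ext fun x => ?_
  rw [LinearMap.comp_apply, lTildeRight_basis, lTildeRight_basis, lTildeRight_basis]
  congr 1
  exact Subtype.ext (mul_assoc x.1 g.toM h.toM).symm

/-- The left action of `M` and the right action of `G_e` commute. -/
lemma lTildeRep_right (m : M) (g : MaxSubgroup e) (z : TildeModule k e) :
    lTildeRep k e m (lTildeRight k g z) = lTildeRight k g (lTildeRep k e m z) := by
  suffices h : lTildeRep k e m ∘ₗ lTildeRight k g = lTildeRight k g ∘ₗ lTildeRep k e m from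
    LinearMap.congr_fun h z
  refine (tildeBasis k e).ext fun x => ?_
  rw [LinearMap.comp_apply, LinearMap.comp_apply, lTildeRight_basis, lTildeRep_basis,
    lTildeRep_basis]
  by_cases h : LTildeRel (m * x.1) e.1
  · rw [tildeSmul_of_mem k (y := ⟨m * x.1, h⟩) rfl, lTildeRight_basis]
    exact tildeSmul_of_mem k (mul_assoc _ _ _).symm
  · rw [tildeSmul_of_not_mem k h, map_zero, tildeSmul_of_not_mem]
    intro h2
    refine h ?_
    have h3 := lTildeRel_mul_maxSubgroup g⁻¹ h2
    rwa [LTilde.mulRight, mul_assoc, mul_assoc, g.toM_mul_inv, mul_e_of_lTildeRel x.2] at h3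

/-! ### The module `k L̃_e ⊗_{k G_e} V` -/

variable {k} {V : Type*} [AddCommGroup V] [Module k V]

/-- The relations `xg ⊗ v = x ⊗ gv` that define the tensor product over `k G_e`. -/
noncomputable def balancedRelations (σ : Representation k (MaxSubgroup e) V) :
    Submodule k (TildeModule k e ⊗[k] V) :=
  Submodule.span k {t | ∃ (g : MaxSubgroup e) (x : TildeModule k e) (v : V),
    t = lTildeRight k g x ⊗ₜ[k] v - x ⊗ₜ[k] σ g v}

/-- The underlying space of `k L̃_e ⊗_{k G_e} V`. -/
abbrev TildeInd (σ : Representation k (MaxSubgroup e) V) : Type _ :=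
  (TildeModule k e ⊗[k] V) ⧸ balancedRelations σ

lemma balancedRelations_le (σ : Representation k (MaxSubgroup e) V) (m : M) :
    balancedRelations σ ≤ (balancedRelations σ).comap
      (TensorProduct.map (lTildeRep k e m) LinearMap.id) := by
  refine Submodule.span_le.2 ?_
  rintro _ ⟨g, x, v, rfl⟩
  refine Submodule.subset_span ⟨g, lTildeRep k e m x, v, ?_⟩
  simp [lTildeRep_right]

/-- The left `kM`-module `k L̃_e ⊗_{k G_e} V`. -/
noncomputable def tildeIndRep (σ : Representation k (MaxSubgroup e) V) :
    Representation k M (TildeInd σ) where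
  toFun m := (balancedRelations σ).mapQ _ (TensorProduct.map (lTildeRep k e m) LinearMap.id)
    (balancedRelations_le σ m)
  map_one' := by
    ext x v
    simp
  map_mul' m n := by
    ext x v
    simp

end Tilde

/-! ### The `k[G_f × G_e]`-module `f rad(k L̃_e) / f I(f) rad(k L̃_e)` -/

section Radical

/-- The radical (intersection of all maximal submodules) of the `kM`-module defined by a
representation, as a subspace. -/
noncomputable def radical {k M X : Type*} [Field k] [Monoid M] [AddCommGroup X] [Module k X]
    (ρ : Representation k M X) : Submodule k X :=
  ((Module.jacobson (MonoidAlgebra k M) (RepModule ρ)).restrictScalars k).map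
    (RepModule.equiv ρ).toLinearMap

/-- `I · U`: the span of all `mu` with `m ∈ I` and `u ∈ U`. -/
noncomputable def setSmul {k M X : Type*} [Field k] [Monoid M] [AddCommGroup X] [Module k X]
    (ρ : Representation k M X) (I : Set M) (U : Submodule k X) : Submodule k X :=
  Submodule.span k {x | ∃ m ∈ I, ∃ u ∈ U, x = ρ m u}

section general

variable {k M X : Type*} [Field k] [Monoid M] [AddCommGroup X] [Module k X]
  (ρ : Representation k M X)

lemma apply_mem_radical (m : M) {x : X} (hx : x ∈ radical ρ) : ρ m x ∈ radical ρ := by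
  obtain ⟨y, hy, rfl⟩ := hx
  refine ⟨MonoidAlgebra.of k M m • y,
    Submodule.smul_mem (Module.jacobson (MonoidAlgebra k M) (RepModule ρ)) _ hy, ?_⟩
  rw [RepModule.of_smul]
  rfl

/-- The radical is preserved by the endomorphisms of the module. -/
lemma endo_mem_radical (T : X →ₗ[k] X) (hT : ∀ m x, ρ m (T x) = T (ρ m x)) {x : X}
    (hx : x ∈ radical ρ) : T x ∈ radical ρ := by
  obtain ⟨y, hy, rfl⟩ := hx
  exact ⟨RepModule.endo ρ T hT y, Module.le_comap_jacobson (RepModule.endo ρ T hT) hy, rfl⟩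

end general

variable (k : Type*) {M : Type*} [Field k] [Monoid M] (f e : Idem M)

/-- `f rad(k L̃_e)`. -/
noncomputable def fRad : Submodule k (TildeModule k e) :=
  (radical (lTildeRep k e)).map (lTildeRep k e f.1)

/-- `f I(f) rad(k L̃_e)`. -/
noncomputable def fIRad : Submodule k (TildeModule k e) :=
  (setSmul (lTildeRep k e) (nonDivisors f) (radical (lTildeRep k e))).map (lTildeRep k e f.1)

/-- The quotient space `f rad(k L̃_e) / f I(f) rad(k L̃_e)`. -/
abbrev ArrowQuotient : Type _ := ↥(fRad k f e) ⧸ (fIRad k f e).submoduleOf (fRad k f e)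

variable {f e} [Finite M] [RightFountain M]

/-- The map `x ↦ g x h⁻¹` on `k L̃_e`. -/
noncomputable def biAct (p : MaxSubgroup f × MaxSubgroup e) :
    TildeModule k e →ₗ[k] TildeModule k e :=
  lTildeRep k e p.1.toM ∘ₗ lTildeRight k p.2⁻¹

lemma biAct_lTildeRep (p : MaxSubgroup f × MaxSubgroup e) (x : TildeModule k e) :
    biAct k p (lTildeRep k e f.1 x) = lTildeRep k e f.1 (biAct k p x) := by
  simp only [biAct, LinearMap.comp_apply, lTildeRep_right, lTildeRep_lTildeRep, p.1.mul_e,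
    p.1.e_mul]

lemma biAct_mem_radical (p : MaxSubgroup f × MaxSubgroup e) {x : TildeModule k e}
    (hx : x ∈ radical (lTildeRep k e)) : biAct k p x ∈ radical (lTildeRep k e) :=
  apply_mem_radical (lTildeRep k e) p.1.toM
    (endo_mem_radical (lTildeRep k e) (lTildeRight k p.2⁻¹)
      (fun m x => lTildeRep_right k m p.2⁻¹ x) hx)

lemma biAct_mem_fRad (p : MaxSubgroup f × MaxSubgroup e) (x : TildeModule k e)
    (hx : x ∈ fRad k f e) : biAct k p x ∈ fRad k f e := by
  obtain ⟨y, hy, rfl⟩ := hx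
  exact ⟨biAct k p y, biAct_mem_radical k p hy, (biAct_lTildeRep k p y).symm⟩

lemma biAct_mem_fIRad (p : MaxSubgroup f × MaxSubgroup e) (x : TildeModule k e)
    (hx : x ∈ fIRad k f e) : biAct k p x ∈ fIRad k f e := by
  obtain ⟨y, hy, rfl⟩ := hx
  refine ⟨biAct k p y, ?_, (biAct_lTildeRep k p y).symm⟩
  have hle : setSmul (lTildeRep k e) (nonDivisors f) (radical (lTildeRep k e)) ≤
      (setSmul (lTildeRep k e) (nonDivisors f) (radical (lTildeRep k e))).comap (biAct k p) := by
    refine Submodule.span_le.2 ?_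
    rintro _ ⟨m, hm, z, hz, rfl⟩
    refine Submodule.subset_span ⟨p.1.toM * m, mul_mem_nonDivisors _ hm,
      lTildeRight k p.2⁻¹ z,
      endo_mem_radical (lTildeRep k e) _ (fun m x => lTildeRep_right k m p.2⁻¹ x) hz, ?_⟩
    simp only [biAct, LinearMap.comp_apply, lTildeRep_right, lTildeRep_lTildeRep]
  exact hle hy

lemma biAct_le_comap (p : MaxSubgroup f × MaxSubgroup e) :
    (fIRad k f e).submoduleOf (fRad k f e) ≤ ((fIRad k f e).submoduleOf (fRad k f e)).comap
      ((biAct k p).restrict (biAct_mem_fRad k p)) :=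
  fun x hx => biAct_mem_fIRad k p x.1 hx

lemma biAct_mul (p q : MaxSubgroup f × MaxSubgroup e) :
    biAct k (p * q) = biAct k p ∘ₗ biAct k q := by
  refine LinearMap.ext fun x => ?_
  simp only [biAct, Prod.fst_mul, Prod.snd_mul, mul_inv_rev, lTildeRight_mul,
    MaxSubgroup.toM_mul, LinearMap.comp_apply, lTildeRep_right, lTildeRep_lTildeRep]

variable (f e) in
/-- The representation of `G_f × G_e` on `f rad(k L̃_e) / f I(f) rad(k L̃_e)` that comes from the
bimodule structure: `(g, h)` sends the class of `x` to the class of `g x h⁻¹`. -/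
noncomputable def arrowRep :
    Representation k (MaxSubgroup f × MaxSubgroup e) (ArrowQuotient k f e) where
  toFun p := Submodule.mapQ _ _ ((biAct k p).restrict (biAct_mem_fRad k p))
    (biAct_le_comap k p)
  map_one' := by
    apply LinearMap.ext
    intro x
    obtain ⟨⟨_, y, hy, rfl⟩, rfl⟩ := Submodule.Quotient.mk_surjective _ x
    refine (Submodule.mapQ_apply _ _ _ _).trans (congrArg _ (Subtype.ext ?_))
    change lTildeRep k e f.1 (lTildeRight k (1 : MaxSubgroup e)⁻¹ (lTildeRep k e f.1 y)) = _
    rw [inv_one, lTildeRight_one, LinearMap.id_apply, lTildeRep_lTildeRep, f.2]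
  map_mul' p q := by
    apply LinearMap.ext
    intro x
    obtain ⟨x, rfl⟩ := Submodule.Quotient.mk_surjective _ x
    rw [Module.End.mul_apply, Submodule.mapQ_apply, Submodule.mapQ_apply, Submodule.mapQ_apply]
    exact congrArg _ (Subtype.ext (LinearMap.congr_fun (biAct_mul k p q) x.1))

end Radical

/-- The `k[G × H]`-module `W ⊗ D(V)`, where `W` is a `kG`-module, `V` is a `kH`-module and
`D(V)` is the dual space: `(g, h)` acts by `w ⊗ φ ↦ gw ⊗ (φ ∘ h⁻¹)`. -/
noncomputable def outerTensorDual {k G H W V : Type*} [Field k] [Group G] [Group H]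
    [AddCommGroup W] [Module k W] [AddCommGroup V] [Module k V]
    (τ : Representation k G W) (σ : Representation k H V) :
    Representation k (G × H) (W ⊗[k] Module.Dual k V) :=
  Representation.tprod (MonoidHom.comp τ (MonoidHom.fst G H))
    (MonoidHom.comp σ.dual (MonoidHom.snd G H))

end FountainMonoid

open FountainMonoid

/-!
Write `A = kM`, `L = k L̃_e`, `S = Coind_{G_e}(V)` and `T = Coind_{G_f}(W)`. The proof identifies
`Ext¹_A(S, T)` with the space of `k[G_f × G_e]`-linear maps from `f rad(L) / f I(f) rad(L)` to
`W ⊗ D(V)`. Since the order of `G_f × G_e` is invertible in `k`, the former module is semisimple;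
since `k` is a splitting field, `W ⊗ D(V)` is simple with scalar endomorphisms; so the dimension
of this space is the multiplicity of `W ⊗ D(V)`.

*Simplicity of the coinduced modules.* If `V` is simple, each nonzero submodule of `S` contains
`V^♯ = A e S`, so that `S` is simple if and only if `V^♯ = S`. A right inverse of the sandwich
matrix writes each element of `S` as a combination of translates of elements of `eS`. If the
projective covers of the simple modules are the modules `k L̃_{e_i} ⊗ U`, then the projective
cover of a simple submodule of `S / V^♯` maps to `S` with an image that is not contained in `V^♯`,
but all maps from `k L̃_{e_i} ⊗ U` to `S` have their image in `V^♯`. Each simple module has an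
apex (a minimal idempotent that does not annihilate it), which transports simplicity from the
representatives `e_i` to all idempotents (`isSimpleModule_coind`).

*The radical of `L`.* Projecting `L̃_e` to `G_e` gives, for `r ∈ R_e`, a linear map `x ↦ rx` from
`L` to `k G_e`. As all coinduced modules are simple and `k G_e` is semisimple, `rad(L)` is the
common kernel of these maps (`groupPart_eq_zero_of_mem_radical`,
`mem_radical_of_groupPart_eq_zero`). Averaging over `G_e` gives an `M`-equivariant section of
`L ⊗_k V → P = L ⊗_{k G_e} V`, which shows that the kernel `K` of the projection from `P` onto `S`
comes from `rad(L) ⊗ V` (`tildeSection_mem`).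

*The extension groups.* The sequence `0 → K → P → S → 0` gives `Ext¹(S, T) = Hom(K, T)`, for two
reasons. Each map from `P` to the simple module `T` kills `rad(L) ⊗ V` and hence `K`. And
`Ext¹(P, T) = 0`: a map to `T = Coind_{G_f}(W)` amounts to a `G_f`-equivariant map to `W` that
kills all translates by `I(f)`, so it extends from a submodule `Z` to the whole module `C` if
`Z ∩ I(f) C = I(f) Z` (`exists_extend_to_coind`). For the kernel `Z` of the projection from
`C = A ⊗ V` onto `P`, this equality uses that `M` is right Fountain: if `m ∈ Me` is not in `L̃_e`,
then `m = ma` for an idempotent `a ∈ Me` outside `L̃_e`, and `a ⊗ v ∈ Z`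
(`mem_span_of_mem_ker_freeCover`).

*The maps on the kernel.* A linear map `K → T` amounts to a map `γ : rad(L) → Hom(V, W)` that
kills `I(f) rad(L)` and commutes with `G_f` and `G_e` (`kerHomToRadicalHoms`). Such a `γ` factors
through `f rad(L) / f I(f) rad(L)`, and `Hom(V, W)` is `W ⊗ D(V)` (`arrowHomToRadicalHoms`).
-/

namespace FountainMonoid

open MonoidAlgebra (of)

/-! ### Stability of Green's relations in finite monoids -/

section Stability

variable {M : Type*} [Monoid M]

lemma mem_twoSidedIdeal_self (m : M) : m ∈ twoSidedIdeal m := ⟨1, 1, by simp⟩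

lemma twoSidedIdeal_subset {m n : M} (h : m ∈ twoSidedIdeal n) :
    twoSidedIdeal m ⊆ twoSidedIdeal n := by
  rintro _ ⟨a, b, rfl⟩
  obtain ⟨c, d, rfl⟩ := h
  exact ⟨a * c, d * b, by simp only [mul_assoc]⟩

lemma nonDivisors_eq_of_jRel {e f : Idem M} (h : JRel e.1 f.1) :
    nonDivisors e = nonDivisors f := by
  ext m
  refine not_congr ⟨fun hm => ?_, fun hm => ?_⟩
  · exact twoSidedIdeal_subset hm (h ▸ mem_twoSidedIdeal_self f.1)
  · exact twoSidedIdeal_subset hm (h ▸ mem_twoSidedIdeal_self e.1)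

lemma mem_nonDivisors_of_mem {f : Idem M} {m n : M} (hm : m ∈ nonDivisors f)
    (h : n ∈ twoSidedIdeal m) : n ∈ nonDivisors f :=
  fun hn => hm (twoSidedIdeal_subset h hn)

lemma mul_mem_nonDivisors_right {f : Idem M} {m : M} (hm : m ∈ nonDivisors f) (a : M) :
    m * a ∈ nonDivisors f := mem_nonDivisors_of_mem hm ⟨1, a, by simp⟩

/-- Stability on the right: an element of `fM` that divides the idempotent `f` generates `fM`. -/
lemma mem_rightIdeal_of_mem_twoSidedIdeal [Finite M] {f : Idem M} {y : M}
    (hy : f.1 * y = y)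
    (h : f.1 ∈ twoSidedIdeal y) : f.1 ∈ rightIdeal y := by
  obtain ⟨a, b, hab⟩ := h
  have iter : ∀ n : ℕ, f.1 = a ^ n * f.1 * (y * b) ^ n := by
    intro n
    induction n with
    | zero => simp
    | succ n ih =>
      calc f.1 = a ^ n * f.1 * (y * b) ^ n := ih
        _ = a ^ n * (a * y * b) * (y * b) ^ n := by rw [← hab]
        _ = a ^ n * (a * (f.1 * y) * b) * (y * b) ^ n := by rw [hy]
        _ = _ := by rw [pow_succ, pow_succ']; simp only [mul_assoc]
  obtain ⟨n, hn, hid⟩ := exists_idempotent_pow (y * b)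
  obtain ⟨n, rfl⟩ := Nat.exists_eq_succ_of_ne_zero hn.ne'
  have hf : f.1 * (y * b) ^ (n + 1) = f.1 := by
    conv_lhs => rw [iter (n + 1), mul_assoc, hid]
    exact (iter (n + 1)).symm
  refine ⟨b * (y * b) ^ n, ?_⟩
  rw [← mul_assoc, ← pow_succ']
  conv_lhs => rw [← hf, pow_succ']
  rw [← mul_assoc, ← mul_assoc, hy, pow_succ']

/-- Stability on the left: an element of `Mf` that divides the idempotent `f` generates `Mf`. -/
lemma mem_leftIdeal_of_mem_twoSidedIdeal [Finite M] {f : Idem M} {y : M}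
    (hy : y * f.1 = y)
    (h : f.1 ∈ twoSidedIdeal y) : f.1 ∈ leftIdeal y := by
  obtain ⟨a, b, hab⟩ := h
  have iter : ∀ n : ℕ, f.1 = (a * y) ^ n * f.1 * b ^ n := by
    intro n
    induction n with
    | zero => simp
    | succ n ih =>
      calc f.1 = (a * y) ^ n * f.1 * b ^ n := ih
        _ = (a * y) ^ n * (a * y * b) * b ^ n := by rw [← hab]
        _ = (a * y) ^ n * (a * (y * f.1) * b) * b ^ n := by rw [hy]
        _ = _ := by rw [pow_succ, pow_succ']; simp only [mul_assoc]
  obtain ⟨n, hn, hid⟩ := exists_idempotent_pow (a * y)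
  obtain ⟨n, rfl⟩ := Nat.exists_eq_succ_of_ne_zero hn.ne'
  have hf : (a * y) ^ (n + 1) * f.1 = f.1 := by
    conv_lhs => rw [iter (n + 1), ← mul_assoc, ← mul_assoc, hid]
    exact (iter (n + 1)).symm
  refine ⟨(a * y) ^ n * a, ?_⟩
  conv_lhs => rw [← hf, pow_succ]
  simp only [mul_assoc, hy]

lemma mem_leftIdeal_self (m : M) : m ∈ leftIdeal m := ⟨1, by simp⟩

lemma rRel_of_mem {f : Idem M} {y : M} (hy : f.1 * y = y) (h : f.1 ∈ rightIdeal y) :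
    RRel y f.1 :=
  Set.Subset.antisymm (rightIdeal_subset ⟨y, hy.symm⟩) (rightIdeal_subset h)

lemma not_mem_nonDivisors_of_rRel {f : Idem M} {y : M} (h : RRel y f.1) :
    y ∉ nonDivisors f := by
  have h' : f.1 ∈ rightIdeal y := h ▸ mem_rightIdeal_self f.1
  obtain ⟨a, ha⟩ := h'
  exact fun hn => hn ⟨1, a, by rw [one_mul, ha]⟩

/-- Among the elements of `fM`, those of `R_f` are the ones that divide `f`. -/
lemma rRel_iff_not_mem_nonDivisors [Finite M] {f : Idem M} {y : M} (hy : f.1 * y = y) :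
    RRel y f.1 ↔ y ∉ nonDivisors f :=
  ⟨not_mem_nonDivisors_of_rRel, fun h => rRel_of_mem hy
    (mem_rightIdeal_of_mem_twoSidedIdeal hy (not_not.1 h))⟩

/-- The elements of `fMf` that divide `f` form `G_f`. -/
lemma exists_maxSubgroup [Finite M] {f : Idem M} {y : M} (hy : f.1 * y = y) (hy' : y * f.1 = y)
    (h : y ∉ nonDivisors f) : ∃ g : MaxSubgroup f, g.toM = y := by
  have h := not_not.1 h
  obtain ⟨a, ha⟩ := mem_leftIdeal_of_mem_twoSidedIdeal hy' h
  obtain ⟨b, hb⟩ := mem_rightIdeal_of_mem_twoSidedIdeal hy h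
  have hl : f.1 * a * f.1 * y = f.1 := by rw [mul_assoc, hy, mul_assoc, ← ha, f.2]
  have hr : y * (f.1 * b * f.1) = f.1 := by
    rw [← mul_assoc, ← mul_assoc, hy', ← hb, f.2]
  have hab : f.1 * a * f.1 = f.1 * b * f.1 := by
    calc f.1 * a * f.1 = f.1 * a * f.1 * (y * (f.1 * b * f.1)) := by
          rw [hr, mul_assoc (f.1 * a), f.2]
      _ = f.1 * (f.1 * b * f.1) := by rw [← mul_assoc, hl]
      _ = _ := by rw [← mul_assoc, ← mul_assoc, f.2]
  refine ⟨⟨⟨y, hy, hy'⟩, ⟨f.1 * a * f.1, ?_, ?_⟩, Subtype.ext ?_, Subtype.ext ?_⟩, rfl⟩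
  · rw [← mul_assoc, ← mul_assoc, f.2]
  · rw [mul_assoc, f.2]
  · change y * (f.1 * a * f.1) = f.1
    rw [hab, hr]
  · exact hl

lemma MaxSubgroup.not_mem_nonDivisors {f : Idem M} (g : MaxSubgroup f) :
    g.toM ∉ nonDivisors f :=
  fun h => h ⟨1, (g⁻¹).toM, by rw [one_mul, g.toM_mul_inv]⟩

lemma MaxSubgroup.toM_injective {f : Idem M} :
    Function.Injective (MaxSubgroup.toM : MaxSubgroup f → M) :=
  fun _ _ h => Units.ext (Subtype.ext h)

lemma MaxSubgroup.rRel [Finite M] {f : Idem M} (g : MaxSubgroup f) : RRel g.toM f.1 :=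
  (rRel_iff_not_mem_nonDivisors g.e_mul).2 g.not_mem_nonDivisors

instance [Finite M] (e : Idem M) : Finite (LocalMonoid e) :=
  inferInstanceAs (Finite {m : M // e.1 * m = m ∧ m * e.1 = m})

/-- `x ∈ L̃_e` and `x = fx` divides `f` only if `e` and `f` generate the same two-sided ideal. -/
lemma jRel_of_lTildeRel [Finite M] {e f : Idem M} {x : M} (hx : LTildeRel x e.1)
    (hfx : f.1 * x = x)
    (h : x ∉ nonDivisors f) : JRel f.1 e.1 := by
  obtain ⟨b, hb⟩ := mem_rightIdeal_of_mem_twoSidedIdeal hfx (not_not.1 h)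
  -- `bx` is an idempotent generating `Mx`
  have hxbx : x * (b * x) = x := by rw [← mul_assoc, ← hb, hfx]
  have hid : IsIdempotentElem (b * x) := by
    rw [IsIdempotentElem, mul_assoc, hxbx]
  have heb : e.1 * (b * x) = e.1 := (hx _ hid).1 hxbx
  apply Set.Subset.antisymm
  · refine twoSidedIdeal_subset ⟨x, b, ?_⟩
    rw [mul_e_of_lTildeRel hx, ← hb]
  · refine twoSidedIdeal_subset ⟨e.1 * b, x, ?_⟩
    rw [mul_assoc, mul_assoc, hfx, heb]

lemma lTildeRel_self (e : Idem M) : LTildeRel e.1 e.1 := fun _ _ => Iff.rfl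

/-- An element of `Me` outside `L̃_e` is fixed on the right by an idempotent `a ∈ Me ∖ L̃_e`. -/
lemma exists_idem_of_not_lTildeRel [RightFountain M] {e : Idem M} {m : M} (hm : m * e.1 = m)
    (h : ¬ LTildeRel m e.1) : ∃ a : M, m * a = m ∧ a * e.1 = a ∧ ¬ LTildeRel a e.1 := by
  obtain ⟨a, ha⟩ := RightFountain.exists_idem m
  exact ⟨a.1, (ha a.1 a.2).2 a.2, (ha e.1 e.2).1 hm,
    fun h' => h fun b hb => (ha b hb).trans (h' b hb)⟩

/-- Each idempotent is `𝓙`-equivalent to one of the representatives. -/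
lemma IsRegularRepresentatives.exists_jRel_idem {n : ℕ} {ε : Fin n → Idem M}
    (hε : IsRegularRepresentatives ε) (e : Idem M) : ∃ i, JRel e.1 (ε i).1 :=
  hε.exists_jRel e.1 ⟨1, by rw [mul_one, e.2]⟩

end Stability

/-! ### Modules over a monoid algebra -/

section Modules

variable {k M : Type*} [Field k] [Monoid M]

section

variable {C : Type*} [AddCommGroup C] [Module (MonoidAlgebra k M) C]

lemma of_smul_of_smul (m n : M) (c : C) :
    of k M m • of k M n • c = of k M (m * n) • c := by
  rw [← mul_smul, ← map_mul]

lemma of_one_smul (c : C) : of k M 1 • c = c := by rw [map_one, one_smul]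

variable [Module k C] [IsScalarTower k (MonoidAlgebra k M) C]

/-- A subspace that is stable under `M` is a submodule over the monoid algebra. -/
def stableSubmodule (U : Submodule k C) (hU : ∀ (m : M), ∀ x ∈ U, of k M m • x ∈ U) :
    Submodule (MonoidAlgebra k M) C where
  carrier := U
  add_mem' := U.add_mem
  zero_mem' := U.zero_mem
  smul_mem' a x hx := by
    induction a using MonoidAlgebra.induction_on with
    | of m => exact hU m x hx
    | add a b ha hb => rw [add_smul]; exact U.add_mem ha hb
    | smul c a ha => rw [smul_assoc]; exact U.smul_mem c ha

/-- The submodule generated by a set is spanned, as a vector space, by the translates. -/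
lemma mem_span_translates (s : Set C) {x : C}
    (hx : x ∈ Submodule.span (MonoidAlgebra k M) s) :
    x ∈ Submodule.span k {y | ∃ (m : M), ∃ c ∈ s, y = of k M m • c} := by
  set U := Submodule.span k {y | ∃ (m : M), ∃ c ∈ s, y = of k M m • c} with hU
  have hstable : ∀ (m : M), ∀ x ∈ U, of k M m • x ∈ U := by
    intro m x hx
    induction hx using Submodule.span_induction with
    | mem y hy =>
      obtain ⟨n, c, hc, rfl⟩ := hy
      exact Submodule.subset_span ⟨m * n, c, hc, of_smul_of_smul m n c⟩
    | zero => rw [smul_zero]; exact U.zero_mem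
    | add x y _ _ hx hy => rw [smul_add]; exact U.add_mem hx hy
    | smul a x _ hx => rw [smul_comm]; exact U.smul_mem a hx
  have hle : Submodule.span (MonoidAlgebra k M) s ≤ stableSubmodule U hstable :=
    Submodule.span_le.2 fun c hc => Submodule.subset_span ⟨1, c, hc, (of_one_smul c).symm⟩
  exact hle hx

end

/-- A `k`-linear map that commutes with `M` is linear over the monoid algebra. -/
def homOfCommute {C D : Type*} [AddCommGroup C] [Module (MonoidAlgebra k M) C]
    [Module k C] [IsScalarTower k (MonoidAlgebra k M) C] [AddCommGroup D]
    [Module (MonoidAlgebra k M) D] [Module k D] [IsScalarTower k (MonoidAlgebra k M) D]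
    (T : C →ₗ[k] D) (hT : ∀ (m : M) (c : C), T (of k M m • c) = of k M m • T c) :
    C →ₗ[MonoidAlgebra k M] D :=
  MonoidAlgebra.equivariantOfLinearOfComm T hT

lemma homOfCommute_apply {C D : Type*} [AddCommGroup C] [Module (MonoidAlgebra k M) C]
    [Module k C] [IsScalarTower k (MonoidAlgebra k M) C] [AddCommGroup D]
    [Module (MonoidAlgebra k M) D] [Module k D] [IsScalarTower k (MonoidAlgebra k M) D]
    (T : C →ₗ[k] D) (hT : ∀ (m : M) (c : C), T (of k M m • c) = of k M m • T c) (c : C) :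
    homOfCommute T hT c = T c := rfl

variable {X : Type*} [AddCommGroup X] [Module k X] {ρ : Representation k M X}

lemma isIrreducible_iff : ρ.IsIrreducible ↔ IsSimpleModule (MonoidAlgebra k M) (RepModule ρ) :=
  Representation.irreducible_iff_isSimpleModule_asModule ρ

lemma eq_top_of_stable (hρ : ρ.IsIrreducible) {U : Submodule k X}
    (hU : ∀ m, ∀ x ∈ U, ρ m x ∈ U) (h : U ≠ ⊥) : U = ⊤ := by
  have := isIrreducible_iff.1 hρ
  let U' : Submodule (MonoidAlgebra k M) (RepModule ρ) :=
    stableSubmodule (U.comap (RepModule.equiv ρ).toLinearMap) fun m x hx => by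
      rw [RepModule.of_smul]; exact hU m _ hx
  obtain ⟨x, hx, hx0⟩ := Submodule.exists_mem_ne_zero_of_ne_bot h
  rcases eq_bot_or_eq_top U' with h' | h'
  · have hx' : (RepModule.equiv ρ).symm x ∈ U' := hx
    rw [h'] at hx'
    exact absurd hx' hx0
  · rw [eq_top_iff]
    intro y _
    have hy : (RepModule.equiv ρ).symm y ∈ U' := h' ▸ Submodule.mem_top
    exact hy

lemma isIrreducible_of [Nontrivial X]
    (h : ∀ U : Submodule k X, (∀ m, ∀ x ∈ U, ρ m x ∈ U) → U ≠ ⊥ → U = ⊤) :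
    ρ.IsIrreducible := by
  rw [isIrreducible_iff, isSimpleModule_iff]
  have : Nontrivial (RepModule ρ) := inferInstanceAs (Nontrivial X)
  refine { toNontrivial := inferInstance, eq_bot_or_eq_top := fun U' => ?_ }
  rw [or_iff_not_imp_left]
  intro hne
  obtain ⟨x, hx, hx0⟩ := Submodule.exists_mem_ne_zero_of_ne_bot hne
  have htop := h ((U'.restrictScalars k).comap (RepModule.equiv ρ).symm.toLinearMap)
    (fun m x hx => by
      have hm : of k M m • (RepModule.equiv ρ).symm x ∈ U' := U'.smul_mem (of k M m) hx
      rw [RepModule.of_smul] at hm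
      exact hm)
    (fun hbot => hx0 (by
      have hx' : RepModule.equiv ρ x ∈
        (U'.restrictScalars k).comap (RepModule.equiv ρ).symm.toLinearMap := hx
      rw [hbot] at hx'
      exact hx'))
  rw [eq_top_iff]
  intro y _
  have hy : RepModule.equiv ρ y ∈
    (U'.restrictScalars k).comap (RepModule.equiv ρ).symm.toLinearMap :=
    htop ▸ Submodule.mem_top
  exact hy

lemma nontrivial_of_isIrreducible (hρ : ρ.IsIrreducible) : Nontrivial X := by
  have := isIrreducible_iff.1 hρ
  exact IsSimpleModule.nontrivial (MonoidAlgebra k M) (RepModule ρ)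

lemma finite_of_isIrreducible [Finite M] (hρ : ρ.IsIrreducible) : Module.Finite k X := by
  have := nontrivial_of_isIrreducible hρ
  obtain ⟨x, hx⟩ := exists_ne (0 : X)
  have htop : Submodule.span k (Set.range fun m => ρ m x) = ⊤ := by
    refine eq_top_of_stable hρ (fun m y hy => ?_) fun h => hx ?_
    · induction hy using Submodule.span_induction with
      | mem y hy =>
        obtain ⟨n, rfl⟩ := hy
        exact Submodule.subset_span ⟨m * n, by simp⟩
      | zero => simp
      | add x y _ _ hx hy => rw [map_add]; exact Submodule.add_mem _ hx hy
      | smul a x _ hx => rw [map_smul]; exact Submodule.smul_mem _ a hx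
    · have : x ∈ Submodule.span k (Set.range fun m => ρ m x) :=
        Submodule.subset_span ⟨1, by simp⟩
      rwa [h, Submodule.mem_bot] at this
  exact Module.Finite.of_fg_top ⟨(Set.finite_range fun m => ρ m x).toFinset, by simpa using htop⟩

end Modules

/-! ### Apexes -/

section Apex

variable {k M : Type*} [Field k] [Monoid M] {C : Type*} [AddCommGroup C]
  [Module (MonoidAlgebra k M) C]

variable (k C) in
/-- `f` is an apex of the `kM`-module `C` when `I(f)` annihilates `C`, while `f` does not, and
each nonzero submodule contains `fC`. Such a module has a simple socle `kMfC`. -/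
structure IsApex (f : Idem M) : Prop where
  smul_eq_zero : ∀ m ∈ nonDivisors f, ∀ c : C, of k M m • c = 0
  exists_ne_zero : ∃ c : C, of k M f.1 • c ≠ 0
  smul_mem : ∀ X : Submodule (MonoidAlgebra k M) C, X ≠ ⊥ → ∀ c : C, of k M f.1 • c ∈ X

lemma IsApex.of_jRel {e f : Idem M} (h : IsApex k C e) (hef : JRel e.1 f.1) : IsApex k C f := by
  have hf : f.1 ∈ twoSidedIdeal e.1 := hef ▸ mem_twoSidedIdeal_self f.1
  have he : e.1 ∈ twoSidedIdeal f.1 := hef ▸ mem_twoSidedIdeal_self e.1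
  obtain ⟨p, q, hpq⟩ := hf
  obtain ⟨p', q', hpq'⟩ := he
  refine ⟨fun m hm => h.smul_eq_zero m (by rwa [nonDivisors_eq_of_jRel hef]), ?_, ?_⟩
  · by_contra! hall
    obtain ⟨c, hc⟩ := h.exists_ne_zero
    refine hc ?_
    rw [hpq', mul_assoc, ← of_smul_of_smul, ← of_smul_of_smul, hall, smul_zero]
  · intro X hX c
    rw [hpq, mul_assoc, ← of_smul_of_smul, ← of_smul_of_smul]
    exact X.smul_mem _ (h.smul_mem X hX _)

/-- In a simple module, each monoid element that acts nontrivially can be moved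
onto any other one. -/
lemma exists_mul_mul_smul_ne_zero [IsSimpleModule (MonoidAlgebra k M) C] {m n : M}
    (hm : ∃ c : C, of k M m • c ≠ 0) (hn : ∃ c : C, of k M n • c ≠ 0) :
    ∃ (x : M) (c : C), of k M (m * x * n) • c ≠ 0 := by
  obtain ⟨c, hc⟩ := hm
  obtain ⟨d, hd⟩ := hn
  by_contra! hall
  have htop : Submodule.span (MonoidAlgebra k M) {of k M n • d} = ⊤ :=
    (eq_bot_or_eq_top _).resolve_left fun h => hd (Submodule.span_singleton_eq_bot.1 h)
  obtain ⟨a, ha⟩ := Submodule.mem_span_singleton.1 (htop ▸ Submodule.mem_top : c ∈ _)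
  refine hc ?_
  rw [← ha]
  clear ha
  induction a using MonoidAlgebra.induction_on with
  | of x => rw [of_smul_of_smul, of_smul_of_smul, hall]
  | add a b ha hb => rw [add_smul, smul_add, ha, hb, add_zero]
  | smul t a ha =>
    have : t • a = algebraMap k (MonoidAlgebra k M) t * a := Algebra.smul_def t a
    rw [this, ← mul_smul, ← mul_assoc, ← Algebra.commutes, mul_assoc, mul_smul, mul_smul, ha,
      smul_zero]

/-- Each simple module has an apex: among the elements that act nontrivially, those generating a
minimal two-sided ideal form a regular `𝓙`-class. -/
lemma exists_isApex [Finite M] [IsSimpleModule (MonoidAlgebra k M) C] :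
    ∃ f : Idem M, IsApex k C f := by
  let N : Set M := {m | ∃ c : C, of k M m • c ≠ 0}
  have hN : N.Nonempty := by
    have := IsSimpleModule.nontrivial (MonoidAlgebra k M) C
    obtain ⟨c, hc⟩ := exists_ne (0 : C)
    exact ⟨1, c, by rwa [of_one_smul]⟩
  obtain ⟨m, hm, hmin⟩ := N.toFinite.exists_minimalFor (fun m => twoSidedIdeal m) N hN
  have hmin' : ∀ n ∈ N, n ∈ twoSidedIdeal m → m ∈ twoSidedIdeal n := fun n hn hnm =>
    hmin hn (twoSidedIdeal_subset hnm) (mem_twoSidedIdeal_self m)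
  -- `m` is a multiple of `m x m`, whence an idempotent in `MmM` that acts nontrivially
  obtain ⟨x, c, hx⟩ := exists_mul_mul_smul_ne_zero hm hm
  obtain ⟨a, b, hab⟩ := hmin' (m * x * m) ⟨c, hx⟩ ⟨1, x * m, by simp [mul_assoc]⟩
  have iter : ∀ n : ℕ, m = a ^ n * m * (x * m * b) ^ n := by
    intro n
    induction n with
    | zero => simp
    | succ n ih =>
      calc m = a ^ n * m * (x * m * b) ^ n := ih
        _ = a ^ n * (a * (m * x * m) * b) * (x * m * b) ^ n := by rw [← hab]
        _ = _ := by rw [pow_succ, pow_succ']; simp only [mul_assoc]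
  obtain ⟨n, hn, hid⟩ := exists_idempotent_pow (x * m * b)
  obtain ⟨n, rfl⟩ := Nat.exists_eq_succ_of_ne_zero hn.ne'
  refine ⟨⟨(x * m * b) ^ (n + 1), hid⟩, ?_⟩
  set f : Idem M := ⟨(x * m * b) ^ (n + 1), hid⟩ with hf
  have hfm : f.1 ∈ twoSidedIdeal m :=
    ⟨x, b * (x * m * b) ^ n, by rw [hf]; simp only [pow_succ', mul_assoc]⟩
  have hfN : f.1 ∈ N := by
    obtain ⟨c, hc⟩ := hm
    by_contra h
    have h : ∀ c : C, of k M f.1 • c = 0 := by simpa [N] using h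
    exact hc (by rw [iter (n + 1), ← of_smul_of_smul, h, smul_zero])
  refine ⟨fun y hy c => ?_, hfN, fun X hX c => ?_⟩
  · by_contra hyc
    obtain ⟨z, d, hz⟩ := exists_mul_mul_smul_ne_zero hfN ⟨c, hyc⟩
    have h1 : m ∈ twoSidedIdeal (f.1 * z * y) := hmin' _ ⟨d, hz⟩ (by
      obtain ⟨p, q, hpq⟩ := hfm
      exact ⟨p, q * z * y, by rw [hpq]; simp only [mul_assoc]⟩)
    have h2 : m ∈ twoSidedIdeal y :=
      twoSidedIdeal_subset ⟨f.1 * z, 1, by simp⟩ h1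
    exact hy (twoSidedIdeal_subset h2 hfm)
  · rw [(eq_bot_or_eq_top X).resolve_left hX]
    exact Submodule.mem_top

/-! ### The representation of `G_f` on `fC` -/

variable [Module k C] [IsScalarTower k (MonoidAlgebra k M) C]

variable (k C) in
/-- The subspace `fC` of a `kM`-module `C`. -/
def localSpace (f : Idem M) : Submodule k C where
  carrier := {c | of k M f.1 • c = c}
  add_mem' {x y} hx hy := by
    change of k M f.1 • (x + y) = x + y
    rw [smul_add, hx, hy]
  zero_mem' := smul_zero _
  smul_mem' a x hx := by
    change of k M f.1 • a • x = a • x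
    rw [smul_comm, hx]

lemma of_smul_mem_localSpace {f : Idem M} {m : M} (hm : f.1 * m = m) (c : C) :
    of k M m • c ∈ localSpace k C f := by
  change of k M f.1 • of k M m • c = of k M m • c
  rw [of_smul_of_smul, hm]

variable (k C) in
/-- The representation of `G_f` on `fC`. -/
noncomputable def localRep (f : Idem M) : Representation k (MaxSubgroup f) (localSpace k C f) where
  toFun g :=
    { toFun := fun c => ⟨of k M g.toM • c.1, of_smul_mem_localSpace g.e_mul c.1⟩
      map_add' := fun _ _ => Subtype.ext (smul_add _ _ _)
      map_smul' := fun _ _ => Subtype.ext (smul_comm _ _ _) }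
  map_one' := LinearMap.ext fun c => Subtype.ext c.2
  map_mul' _ _ := LinearMap.ext fun _ => Subtype.ext (of_smul_of_smul _ _ _).symm

lemma localRep_apply_coe {f : Idem M} (g : MaxSubgroup f) (c : localSpace k C f) :
    (localRep k C f g c : C) = of k M g.toM • c.1 := rfl

/-- If `f` is an apex of `C`, then `fC` is an irreducible representation of `G_f`. -/
lemma IsApex.localRep_isIrreducible [Finite M] {f : Idem M} (h : IsApex k C f) :
    (localRep k C f).IsIrreducible := by
  obtain ⟨c, hc⟩ := h.exists_ne_zero
  have : Nontrivial (localSpace k C f) :=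
    ⟨⟨of k M f.1 • c, of_smul_mem_localSpace f.2 c⟩, 0, fun h' => hc (congrArg Subtype.val h')⟩
  refine isIrreducible_of fun U hU hne => ?_
  obtain ⟨u, hu, hu0⟩ := Submodule.exists_mem_ne_zero_of_ne_bot hne
  rw [eq_top_iff]
  rintro d -
  have hd := h.smul_mem (Submodule.span (MonoidAlgebra k M) {u.1})
    (fun h' => hu0 (Subtype.ext (Submodule.span_singleton_eq_bot.1 h'))) d.1
  have hd' := mem_span_translates _ hd
  -- applying `f` to `kMu` lands in `U`, as `fMf ∖ G_f` annihilates `C`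
  have key : ∀ x ∈ Submodule.span k {y | ∃ (m : M), ∃ c ∈ ({u.1} : Set C), y = of k M m • c},
      ∃ z ∈ U, of k M f.1 • x = z.1 := by
    intro x hx
    induction hx using Submodule.span_induction with
    | mem y hy =>
      obtain ⟨m, _, rfl, rfl⟩ := hy
      rw [of_smul_of_smul, ← u.2, of_smul_of_smul]
      by_cases hm : f.1 * m * f.1 ∈ nonDivisors f
      · exact ⟨0, U.zero_mem, h.smul_eq_zero _ hm _⟩
      · obtain ⟨g, hg⟩ := exists_maxSubgroup (f := f) (y := f.1 * m * f.1)
          (by rw [← mul_assoc, ← mul_assoc, f.2]) (by rw [mul_assoc, f.2]) hm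
        refine ⟨_, hU g u hu, ?_⟩
        rw [localRep_apply_coe, hg]
    | zero => exact ⟨0, U.zero_mem, smul_zero _⟩
    | add x y _ _ hx hy =>
      obtain ⟨a, ha, hxa⟩ := hx
      obtain ⟨b, hb, hyb⟩ := hy
      exact ⟨a + b, U.add_mem ha hb, by rw [smul_add, hxa, hyb]; rfl⟩
    | smul t x _ hx =>
      obtain ⟨a, ha, hxa⟩ := hx
      exact ⟨t • a, U.smul_mem t ha, by rw [smul_comm, hxa]; rfl⟩
  obtain ⟨z, hz, hzd⟩ := key _ hd'
  rw [of_smul_of_smul, f.2] at hzd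
  have : d = z := Subtype.ext (by rw [← hzd]; exact d.2.symm)
  rwa [this]

end Apex

/-! ### Coinduced modules -/

section Coinduced

variable {k M : Type*} [Field k] [Monoid M] {e : Idem M} {V : Type*} [AddCommGroup V] [Module k V]
  (σ : Representation k (MaxSubgroup e) V)

variable (e) in
/-- `e` as an element of `R_e`. -/
def RClass.base : RClass e := ⟨e.1, rfl⟩

/-- Evaluation at `r ∈ R_e` on `Coind_{G_e}(V)`. -/
noncomputable def coindEval (r : RClass e) : RepModule (coindRep σ) →ₗ[k] V :=
  LinearMap.proj r ∘ₗ (coindSpace σ).subtype ∘ₗ (RepModule.equiv (coindRep σ)).toLinearMap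

variable {σ}

lemma coind_ext {φ ψ : RepModule (coindRep σ)} (h : ∀ r, coindEval σ r φ = coindEval σ r ψ) :
    φ = ψ :=
  Subtype.ext (funext h)

lemma coindEval_smul_group (g : MaxSubgroup e) (r : RClass e) (φ : RepModule (coindRep σ)) :
    coindEval σ (RClass.smul g r) φ = σ g (coindEval σ r φ) :=
  (RepModule.equiv (coindRep σ) φ).2 g r

lemma coindEval_of_smul {m : M} {r r' : RClass e} (h : r.1 * m = r'.1)
    (φ : RepModule (coindRep σ)) : coindEval σ r (of k M m • φ) = coindEval σ r' φ := by
  have h' : RRel (r.1 * m) e.1 := h ▸ r'.2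
  have hr : (⟨r.1 * m, h'⟩ : RClass e) = r' := Subtype.ext h
  rw [RepModule.of_smul, ← hr]
  exact dif_pos h'

lemma coindEval_of_smul_eq_zero {m : M} {r : RClass e} (h : ¬ RRel (r.1 * m) e.1)
    (φ : RepModule (coindRep σ)) : coindEval σ r (of k M m • φ) = 0 := by
  rw [RepModule.of_smul]
  exact dif_neg h

/-- The coinduced module is generated by its functions through evaluation at `e`. -/
lemma coindEval_eq_base (r : RClass e) (φ : RepModule (coindRep σ)) :
    coindEval σ r φ = coindEval σ (RClass.base e) (of k M r.1 • φ) :=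
  (coindEval_of_smul (r := RClass.base e) (e_mul_of_rRel r.2) φ).symm

lemma coindEval_base_smul_group (g : MaxSubgroup e) (φ : RepModule (coindRep σ)) :
    coindEval σ (RClass.base e) (of k M g.toM • φ) = σ g (coindEval σ (RClass.base e) φ) := by
  rw [← coindEval_smul_group]
  refine coindEval_of_smul ?_ φ
  exact (g.e_mul).trans g.mul_e.symm

lemma coind_smul_eq_zero_of_mem_nonDivisors {m : M} (hm : m ∈ nonDivisors e)
    (φ : RepModule (coindRep σ)) : of k M m • φ = 0 := by
  refine coind_ext fun r => ?_
  rw [map_zero, coindEval_of_smul_eq_zero]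
  exact fun h => not_mem_nonDivisors_of_rRel h (mul_mem_nonDivisors r.1 hm)

/-- For `φ ∈ e Coind_{G_e}(V)`, the value at `r` is obtained from the value at `e` when
`re ∈ G_e`, and vanishes otherwise. -/
lemma coind_fixed_ext [Finite M] {φ ψ : RepModule (coindRep σ)} (hφ : of k M e.1 • φ = φ)
    (hψ : of k M e.1 • ψ = ψ)
    (h : coindEval σ (RClass.base e) φ = coindEval σ (RClass.base e) ψ) : φ = ψ := by
  refine coind_ext fun r => ?_
  rw [← hφ, ← hψ]
  by_cases hr : RRel (r.1 * e.1) e.1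
  · obtain ⟨g, hg⟩ := exists_maxSubgroup (f := e) (y := r.1 * e.1)
      (by rw [← mul_assoc, e_mul_of_rRel r.2]) (by rw [mul_assoc, e.2])
      (not_mem_nonDivisors_of_rRel hr)
    have hg' : r.1 * e.1 = (RClass.smul g (RClass.base e)).1 := by
      rw [← hg]; exact g.mul_e.symm
    rw [coindEval_of_smul hg', coindEval_of_smul hg', coindEval_smul_group, coindEval_smul_group, h]
  · rw [coindEval_of_smul_eq_zero hr, coindEval_of_smul_eq_zero hr]

open Classical in
variable (σ) in
/-- The element of `e Coind_{G_e}(V)` with value `v` at `e`. -/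
noncomputable def coindLift (v : V) : RepModule (coindRep σ) :=
  (RepModule.equiv (coindRep σ)).symm
    ⟨fun r => if h : ∃ g : MaxSubgroup e, g.toM = r.1 * e.1 then σ h.choose v else 0, by
      intro g r
      by_cases h : ∃ g : MaxSubgroup e, g.toM = r.1 * e.1
      · have h' : ∃ g' : MaxSubgroup e, g'.toM = (RClass.smul g r).1 * e.1 :=
          ⟨g * h.choose, by
            rw [MaxSubgroup.toM_mul, h.choose_spec]; exact (mul_assoc _ _ _).symm⟩
        have hc : h'.choose = g * h.choose := MaxSubgroup.toM_injective (by
          rw [h'.choose_spec, MaxSubgroup.toM_mul, h.choose_spec]; exact mul_assoc _ _ _)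
        simp only
        rw [dif_pos h, dif_pos h', hc, map_mul, Module.End.mul_apply]
      · have h' : ¬ ∃ g' : MaxSubgroup e, g'.toM = (RClass.smul g r).1 * e.1 := by
          rintro ⟨g', hg'⟩
          refine h ⟨g⁻¹ * g', ?_⟩
          rw [MaxSubgroup.toM_mul, hg']
          change (g⁻¹).toM * (g.toM * r.1 * e.1) = _
          rw [← mul_assoc, ← mul_assoc, g.toM_inv_mul, e_mul_of_rRel r.2]
        simp only
        rw [dif_neg h, dif_neg h', map_zero]⟩

lemma coindEval_coindLift {r : RClass e} {g : MaxSubgroup e} (h : g.toM = r.1 * e.1) (v : V) :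
    coindEval σ r (coindLift σ v) = σ g v := by
  classical
  have h' : ∃ g : MaxSubgroup e, g.toM = r.1 * e.1 := ⟨g, h⟩
  have hc : h'.choose = g := MaxSubgroup.toM_injective (by rw [h'.choose_spec, h])
  refine (dif_pos h').trans ?_
  rw [hc]

lemma coindEval_coindLift_eq_zero {r : RClass e} (h : r.1 * e.1 ∈ nonDivisors e) (v : V) :
    coindEval σ r (coindLift σ v) = 0 := by
  classical
  refine dif_neg ?_
  rintro ⟨g, hg⟩
  exact g.not_mem_nonDivisors (hg ▸ h)

lemma coindEval_base_coindLift (v : V) : coindEval σ (RClass.base e) (coindLift σ v) = v := by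
  rw [coindEval_coindLift (g := 1) (MaxSubgroup.toM_one.trans e.2.symm), map_one,
    Module.End.one_apply]

lemma of_smul_coindLift [Finite M] (v : V) : of k M e.1 • coindLift σ v = coindLift σ v := by
  refine coind_ext fun r => ?_
  by_cases h : r.1 * e.1 ∈ nonDivisors e
  · rw [coindEval_coindLift_eq_zero h]
    by_cases hr : RRel (r.1 * e.1) e.1
    · exact absurd h (not_mem_nonDivisors_of_rRel hr)
    · rw [coindEval_of_smul_eq_zero hr]
  · obtain ⟨g, hg⟩ := exists_maxSubgroup (f := e) (y := r.1 * e.1)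
      (by rw [← mul_assoc, e_mul_of_rRel r.2]) (by rw [mul_assoc, e.2]) h
    rw [coindEval_of_smul (r' := ⟨g.toM, g.rRel⟩) hg.symm,
      coindEval_coindLift (g := g) g.mul_e.symm, coindEval_coindLift (g := g) hg]

/-- `e` is an apex of `Coind_{G_e}(V)` for irreducible `V`. -/
lemma isApex_coind [Finite M] (hσ : σ.IsIrreducible) : IsApex k (RepModule (coindRep σ)) e := by
  have := nontrivial_of_isIrreducible hσ
  refine ⟨fun m hm c => coind_smul_eq_zero_of_mem_nonDivisors hm c, ?_, fun X hX c => ?_⟩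
  · obtain ⟨v, hv⟩ := exists_ne (0 : V)
    refine ⟨coindLift σ v, fun h => hv ?_⟩
    rw [of_smul_coindLift] at h
    rw [← coindEval_base_coindLift (σ := σ) v, h, map_zero]
  · obtain ⟨φ, hφX, hφ⟩ := Submodule.exists_mem_ne_zero_of_ne_bot hX
    -- the values at `e` of the elements of `eX` form a `G_e`-stable subspace of `V`
    let Y : Submodule k V :=
      ((X.restrictScalars k) ⊓ localSpace k _ e).map (coindEval σ (RClass.base e))
    have hY : Y = ⊤ := by
      refine eq_top_of_stable hσ ?_ fun hbot => hφ ?_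
      · rintro g _ ⟨x, ⟨hx, hx'⟩, rfl⟩
        refine ⟨of k M g.toM • x, ⟨X.smul_mem _ hx, of_smul_mem_localSpace g.e_mul x⟩, ?_⟩
        exact coindEval_base_smul_group g x
      · refine coind_ext fun r => ?_
        rw [map_zero, coindEval_eq_base]
        have : coindEval σ (RClass.base e) (of k M r.1 • φ) ∈ Y :=
          ⟨_, ⟨X.smul_mem _ hφX, of_smul_mem_localSpace (e_mul_of_rRel r.2) φ⟩, rfl⟩
        rwa [hbot, Submodule.mem_bot] at this
    obtain ⟨x, ⟨hx, hx'⟩, hxc⟩ :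
        coindEval σ (RClass.base e) (of k M e.1 • c) ∈ Y := hY ▸ Submodule.mem_top
    rwa [coind_fixed_ext (of_smul_mem_localSpace e.2 c) hx' hxc.symm]

lemma IsApex.sharp_le (h : IsApex k (RepModule (coindRep σ)) e)
    {X : Submodule (MonoidAlgebra k M) (RepModule (coindRep σ))} (hX : X ≠ ⊥) : sharp σ ≤ X := by
  refine Submodule.span_le.2 ?_
  rintro _ ⟨φ, rfl⟩
  exact h.smul_mem X hX φ

/-- For irreducible `V`, the module `Coind_{G_e}(V)` is simple as soon as it equals `V^♯`. -/
lemma isSimpleModule_coind_of_sharp_eq_top [Finite M] (hσ : σ.IsIrreducible)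
    (h : sharp σ = ⊤) :
    IsSimpleModule (MonoidAlgebra k M) (RepModule (coindRep σ)) := by
  have hA := isApex_coind hσ
  rw [isSimpleModule_iff]
  have : Nontrivial (RepModule (coindRep σ)) := by
    obtain ⟨c, hc⟩ := hA.exists_ne_zero
    exact ⟨_, _, hc⟩
  refine { toNontrivial := inferInstance, eq_bot_or_eq_top := fun X => ?_ }
  rw [or_iff_not_imp_left]
  intro hX
  exact top_le_iff.1 (h ▸ hA.sharp_le hX)

/-! ### Embedding a module with an apex into a coinduced module -/

variable [Finite M] {C : Type*} [AddCommGroup C] [Module (MonoidAlgebra k M) C] [Module k C]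
  [IsScalarTower k (MonoidAlgebra k M) C]

/-- The linear map `c ↦ (r ↦ rc)` from `C` to `Coind_{G_f}(fC)`, where `I(f)` annihilates `C`. -/
noncomputable def toCoind {f : Idem M}
    (h : ∀ m ∈ nonDivisors f, ∀ c : C, of k M m • c = 0) :
    C →ₗ[MonoidAlgebra k M] RepModule (coindRep (localRep k C f)) :=
  homOfCommute
    { toFun := fun c => (RepModule.equiv (coindRep (localRep k C f))).symm
        ⟨fun r => ⟨of k M r.1 • c, of_smul_mem_localSpace (e_mul_of_rRel r.2) c⟩,
          fun g r => Subtype.ext (of_smul_of_smul g.toM r.1 c).symm⟩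
      map_add' := fun c d => coind_ext fun r => Subtype.ext (smul_add _ c d)
      map_smul' := fun a c => coind_ext fun r => Subtype.ext (smul_comm _ a c) } (by
    intro m c
    refine coind_ext fun r => ?_
    by_cases hr : RRel (r.1 * m) f.1
    · rw [coindEval_of_smul (r' := ⟨r.1 * m, hr⟩) rfl]
      exact Subtype.ext (of_smul_of_smul _ _ _)
    · rw [coindEval_of_smul_eq_zero hr]
      refine Subtype.ext ((of_smul_of_smul _ _ _).trans (h _ ?_ c))
      rw [rRel_iff_not_mem_nonDivisors (by rw [← mul_assoc, e_mul_of_rRel r.2]), not_not] at hr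
      exact hr)

lemma coindEval_toCoind {f : Idem M} (h : ∀ m ∈ nonDivisors f, ∀ c : C, of k M m • c = 0)
    (r : RClass f) (c : C) :
    (coindEval (localRep k C f) r (toCoind h c) : C) = of k M r.1 • c := rfl

lemma IsApex.toCoind_injective {f : Idem M} (h : IsApex k C f) :
    Function.Injective (toCoind h.smul_eq_zero) := by
  rw [← LinearMap.ker_eq_bot]
  by_contra hne
  obtain ⟨c, hc⟩ := h.exists_ne_zero
  have hmem := h.smul_mem _ hne c
  refine hc ?_
  have h0 := coindEval_toCoind h.smul_eq_zero (RClass.base f) (of k M f.1 • c)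
  rw [LinearMap.mem_ker.1 hmem, map_zero] at h0
  rw [← show of k M f.1 • of k M f.1 • c = of k M f.1 • c by rw [of_smul_of_smul, f.2]]
  exact h0.symm

/-- A simple module with apex `f` is isomorphic to `(fC)^♯`. -/
lemma IsApex.nonempty_equiv_sharp {f : Idem M} (h : IsApex k C f)
    [IsSimpleModule (MonoidAlgebra k M) C] :
    Nonempty (C ≃ₗ[MonoidAlgebra k M] sharp (localRep k C f)) := by
  have hinj := h.toCoind_injective
  have hA := isApex_coind h.localRep_isIrreducible
  have hle : sharp (localRep k C f) ≤ LinearMap.range (toCoind h.smul_eq_zero) := by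
    refine hA.sharp_le fun hbot => ?_
    obtain ⟨c, hc⟩ := h.exists_ne_zero
    rw [LinearMap.range_eq_bot] at hbot
    exact hc (hinj (by rw [hbot]; simp))
  let E := LinearEquiv.ofInjective _ hinj
  have : IsSimpleModule (MonoidAlgebra k M) (LinearMap.range (toCoind h.smul_eq_zero)) :=
    IsSimpleModule.congr E.symm
  have hatom : IsAtom (LinearMap.range (toCoind h.smul_eq_zero)) := isSimpleModule_iff_isAtom.1 this
  have heq : sharp (localRep k C f) = LinearMap.range (toCoind h.smul_eq_zero) := by
    refine (hatom.le_iff.1 hle).resolve_left fun hbot => ?_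
    obtain ⟨φ, hφ⟩ := hA.exists_ne_zero
    have : of k M f.1 • φ ∈ sharp (localRep k C f) := Submodule.subset_span ⟨φ, rfl⟩
    rw [hbot] at this
    exact hφ this
  exact ⟨E.trans (LinearEquiv.ofEq _ _ heq.symm)⟩

/-- A module with apex `f` is simple when `Coind_{G_f}(fC)` is. -/
lemma IsApex.isSimpleModule {f : Idem M} (h : IsApex k C f)
    [IsSimpleModule (MonoidAlgebra k M) (RepModule (coindRep (localRep k C f)))] :
    IsSimpleModule (MonoidAlgebra k M) C := by
  have hinj := h.toCoind_injective
  have hsurj : Function.Surjective (toCoind h.smul_eq_zero) := by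
    rcases LinearMap.surjective_or_eq_zero (toCoind h.smul_eq_zero) with h' | h'
    · exact h'
    · obtain ⟨c, hc⟩ := h.exists_ne_zero
      exact absurd (hinj (by rw [h']; simp)) hc
  exact IsSimpleModule.congr (LinearEquiv.ofBijective _ ⟨hinj, hsurj⟩)

end Coinduced

/-! ### Right invertible sandwich matrices -/

section SandwichInvertible

variable {k M : Type*} [Field k] [Monoid M]

lemma mul_e_of_lRel {e : Idem M} {m : M} (h : LRel m e.1) : m * e.1 = m := by
  have h' : m ∈ leftIdeal e.1 := h ▸ mem_leftIdeal_self m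
  obtain ⟨a, rfl⟩ := h'
  rw [mul_assoc, e.2]

lemma jRel_of_rRel {m n : M} (h : RRel m n) : JRel m n := by
  apply Set.Subset.antisymm
  · obtain ⟨a, ha⟩ : m ∈ rightIdeal n := h ▸ mem_rightIdeal_self m
    exact twoSidedIdeal_subset ⟨1, a, by rw [one_mul, ha]⟩
  · obtain ⟨a, ha⟩ : n ∈ rightIdeal m := h ▸ mem_rightIdeal_self n
    exact twoSidedIdeal_subset ⟨1, a, by rw [one_mul, ha]⟩

variable [Finite M] {e : Idem M}

/-- Two `𝓛`-equivalent elements of `R_e` lie in the same `G_e`-orbit. -/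
lemma exists_smul_eq_of_lRel {r r' : RClass e} (h : LRel r.1 r'.1) :
    ∃ g : MaxSubgroup e, r = RClass.smul g r' := by
  obtain ⟨c, hc⟩ : r.1 ∈ leftIdeal r'.1 := h ▸ mem_leftIdeal_self r.1
  have hr : r.1 = e.1 * c * e.1 * r'.1 := by
    rw [mul_assoc, e_mul_of_rRel r'.2, mul_assoc, ← hc, e_mul_of_rRel r.2]
  obtain ⟨g, hg⟩ := exists_maxSubgroup (f := e) (y := e.1 * c * e.1)
    (by rw [← mul_assoc, ← mul_assoc, e.2]) (by rw [mul_assoc, e.2])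
    (fun hn => not_mem_nonDivisors_of_rRel r.2 (hr ▸ mul_mem_nonDivisors_right hn r'.1))
  exact ⟨g, Subtype.ext (by rw [hr, ← hg]; rfl)⟩

instance (e : Idem M) : Finite (LClassesIn e) :=
  inferInstanceAs (Finite {c : Set M // ∃ x, JRel x e.1 ∧ c = {y | LRel y x}})

variable {V : Type*} [AddCommGroup V] [Module k V] {σ : Representation k (MaxSubgroup e) V}

/-- The entries of the sandwich matrix are the values of the translates of `e Coind_{G_e}(V)`. -/
lemma coindEval_sandwich (s : SandwichData e) (a : RClassesIn e) (b : LClassesIn e) (v : V) :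
    coindEval σ ⟨s.lam b, s.lam_rRel b⟩ (of k M (s.rho a) • coindLift σ v) =
      σ.asAlgebraHom (s.matrix k b a) v := by
  classical
  have hrho := mul_e_of_lRel (s.rho_lRel a)
  by_cases h : ∃ g : MaxSubgroup e, g.toM = s.lam b * s.rho a
  · have hmat : s.matrix k b a = of k _ h.choose := dif_pos h
    rw [hmat, σ.asAlgebraHom_of, coindEval_of_smul (r' := ⟨h.choose.toM, h.choose.rRel⟩)
      h.choose_spec.symm, coindEval_coindLift (g := h.choose) h.choose.mul_e.symm]
  · have hmat : s.matrix k b a = 0 := dif_neg h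
    rw [hmat, map_zero, LinearMap.zero_apply, coindEval_of_smul_eq_zero]
    intro hR
    refine h (exists_maxSubgroup ?_ ?_ (not_mem_nonDivisors_of_rRel hR))
    · rw [← mul_assoc, e_mul_of_rRel (s.lam_rRel b)]
    · rw [mul_assoc, hrho]

/-- A right inverse `Q` of the sandwich matrix expresses each `φ` as a combination of
translates of elements of `e Coind_{G_e}(V)`. -/
lemma sharp_eq_top_of_sandwichRightInvertible (h : SandwichRightInvertible k e)
    (σ : Representation k (MaxSubgroup e) V) : sharp σ = ⊤ := by
  classical
  let _ : Fintype (RClassesIn e) := Fintype.ofFinite _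
  let _ : Fintype (LClassesIn e) := Fintype.ofFinite _
  obtain ⟨s, Q, hQ⟩ := h
  rw [eq_top_iff]
  rintro φ -
  let w : RClassesIn e → V := fun a =>
    ∑ b, σ.asAlgebraHom (Q a b) (coindEval σ ⟨s.lam b, s.lam_rRel b⟩ φ)
  have hφ : φ = ∑ a, of k M (s.rho a) • coindLift σ (w a) := by
    have hlam : ∀ b, coindEval σ ⟨s.lam b, s.lam_rRel b⟩ φ =
        coindEval σ ⟨s.lam b, s.lam_rRel b⟩ (∑ a, of k M (s.rho a) • coindLift σ (w a)) := by
      intro b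
      rw [map_sum]
      simp only [coindEval_sandwich, w, map_sum]
      rw [Finset.sum_comm]
      have hPQ : ∀ b', ∑ a, s.matrix k b a * Q a b' =
          (1 : Matrix (LClassesIn e) (LClassesIn e) (MonoidAlgebra k (MaxSubgroup e))) b b' := by
        intro b'
        have := congrFun (congrFun hQ b) b'
        rw [Matrix.mul_apply] at this
        convert this
      have hsum : ∀ b', ∑ a, σ.asAlgebraHom (s.matrix k b a) (σ.asAlgebraHom (Q a b')
          (coindEval σ ⟨s.lam b', s.lam_rRel b'⟩ φ)) =
          σ.asAlgebraHom ((1 : Matrix (LClassesIn e) (LClassesIn e)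
            (MonoidAlgebra k (MaxSubgroup e))) b b')
            (coindEval σ ⟨s.lam b', s.lam_rRel b'⟩ φ) := by
        intro b'
        rw [← hPQ, map_sum, LinearMap.sum_apply]
        exact Finset.sum_congr rfl fun a _ => by rw [map_mul, Module.End.mul_apply]
      simp only [hsum]
      rw [Finset.sum_eq_single b]
      · rw [Matrix.one_apply_eq, map_one, Module.End.one_apply]
      · intro b' _ hb
        rw [Matrix.one_apply_ne hb.symm, map_zero, LinearMap.zero_apply]
      · simp
    refine coind_ext fun r => ?_
    let b : LClassesIn e := ⟨{y | LRel y r.1}, r.1, jRel_of_rRel r.2, rfl⟩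
    have hb : LRel (s.lam b) r.1 := s.lam_mem b
    obtain ⟨g, hg⟩ := exists_smul_eq_of_lRel (r := r) (r' := ⟨s.lam b, s.lam_rRel b⟩) hb.symm
    rw [hg, coindEval_smul_group, coindEval_smul_group, hlam]
  rw [hφ]
  refine Submodule.sum_mem _ fun a _ => Submodule.smul_mem _ _ ?_
  exact Submodule.subset_span ⟨coindLift σ (w a), of_smul_coindLift _⟩

end SandwichInvertible

/-! ### The module `k L̃_e ⊗_{k G_e} V` -/

section TildeInduced

variable {k M : Type*} [Field k] [Monoid M] {e : Idem M}

/-- `e` as an element of `L̃_e`. -/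
def LTilde.base (e : Idem M) : LTilde e := ⟨e.1, lTildeRel_self e⟩

lemma lTildeRep_base (x : LTilde e) :
    lTildeRep k e x.1 (tildeBasis k e (LTilde.base e)) = tildeBasis k e x := by
  rw [lTildeRep_basis]
  exact tildeSmul_of_mem k (mul_e_of_lTildeRel x.2)

variable [Finite M] [RightFountain M]
  {V : Type*} [AddCommGroup V] [Module k V] (σ : Representation k (MaxSubgroup e) V)

/-- The projection of `k L̃_e ⊗_k V` onto `k L̃_e ⊗_{k G_e} V`. -/
noncomputable def tildeIndMk : TildeModule k e ⊗[k] V →ₗ[k] RepModule (tildeIndRep σ) :=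
  (RepModule.equiv (tildeIndRep σ)).symm.toLinearMap ∘ₗ (balancedRelations σ).mkQ

lemma tildeIndMk_surjective : Function.Surjective (tildeIndMk σ) :=
  (balancedRelations σ).mkQ_surjective

lemma of_smul_tildeIndMk (m : M) (t : TildeModule k e ⊗[k] V) :
    of k M m • tildeIndMk σ t =
      tildeIndMk σ (TensorProduct.map (lTildeRep k e m) LinearMap.id t) := by
  rw [RepModule.of_smul]
  rfl

lemma of_smul_tildeIndMk_tmul (m : M) (x : TildeModule k e) (v : V) :
    of k M m • tildeIndMk σ (x ⊗ₜ v) = tildeIndMk σ (lTildeRep k e m x ⊗ₜ v) := by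
  rw [of_smul_tildeIndMk, TensorProduct.map_tmul, LinearMap.id_apply]

lemma tildeIndMk_right (g : MaxSubgroup e) (x : TildeModule k e) (v : V) :
    tildeIndMk σ (lTildeRight k g x ⊗ₜ v) = tildeIndMk σ (x ⊗ₜ σ g v) := by
  rw [← sub_eq_zero, ← map_sub]
  have : lTildeRight k g x ⊗ₜ[k] v - x ⊗ₜ[k] σ g v ∈ balancedRelations σ :=
    Submodule.subset_span ⟨g, x, v, rfl⟩
  exact (Submodule.Quotient.mk_eq_zero _).2 this

/-- The vectors `e ⊗ v` generate `k L̃_e ⊗_{k G_e} V` as a module; two linear maps that agree on the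
translates of these vectors are equal. -/
lemma tildeInd_ext {D : Type*} [AddCommGroup D] [Module k D]
    {T T' : RepModule (tildeIndRep σ) →ₗ[k] D}
    (h : ∀ (x : LTilde e) (v : V), T (tildeIndMk σ (tildeBasis k e x ⊗ₜ v)) =
      T' (tildeIndMk σ (tildeBasis k e x ⊗ₜ v))) : T = T' := by
  have : T ∘ₗ tildeIndMk σ = T' ∘ₗ tildeIndMk σ := by
    apply TensorProduct.ext
    refine (tildeBasis k e).ext fun x => LinearMap.ext fun v => ?_
    exact h x v
  refine LinearMap.ext fun p => ?_
  obtain ⟨t, rfl⟩ := tildeIndMk_surjective σ p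
  exact LinearMap.congr_fun this t

/-- If `f` and `e` are not `𝓙`-equivalent, there is no nonzero map from `k L̃_e ⊗_{k G_e} V` to
`Coind_{G_f}(W)`; otherwise, for `f = e`, all such maps have their image in `W^♯`. -/
lemma tildeInd_hom_mem {f : Idem M} {W : Type*} [AddCommGroup W] [Module k W]
    {τ : Representation k (MaxSubgroup f) W}
    (hfe : JRel f.1 e.1 → f = e)
    (β : RepModule (tildeIndRep σ) →ₗ[MonoidAlgebra k M] RepModule (coindRep τ))
    (p : RepModule (tildeIndRep σ)) : β p ∈ sharp τ := by
  have hbasis : ∀ (x : LTilde e) (v : V), tildeIndMk σ (tildeBasis k e x ⊗ₜ v) =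
      of k M x.1 • tildeIndMk σ (tildeBasis k e (LTilde.base e) ⊗ₜ v) := by
    intro x v
    rw [of_smul_tildeIndMk_tmul, lTildeRep_base]
  by_cases hJ : JRel f.1 e.1
  · obtain rfl := hfe hJ
    suffices h : ((sharp τ).mkQ.restrictScalars k) ∘ₗ β.restrictScalars k = 0 by
      have := LinearMap.congr_fun h p
      exact (Submodule.Quotient.mk_eq_zero _).1 this
    refine tildeInd_ext σ fun x v => ?_
    refine (Submodule.Quotient.mk_eq_zero _).2 ?_
    rw [LinearMap.restrictScalars_apply, hbasis, ← mul_e_of_lTildeRel x.2, ← of_smul_of_smul,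
      map_smul, map_smul]
    exact Submodule.smul_mem _ _ (Submodule.subset_span ⟨_, rfl⟩)
  · suffices h : β.restrictScalars k = 0 by
      have := LinearMap.congr_fun h p
      rw [LinearMap.restrictScalars_apply] at this
      rw [this]
      exact Submodule.zero_mem _
    refine tildeInd_ext σ fun x v => ?_
    refine coind_ext fun r => ?_
    rw [LinearMap.zero_apply, map_zero, coindEval_eq_base, LinearMap.restrictScalars_apply,
      ← map_smul, of_smul_tildeIndMk_tmul, lTildeRep_basis]
    by_cases hx : LTildeRel (r.1 * x.1) e.1
    · have hmem : r.1 * x.1 ∈ nonDivisors f := by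
        by_contra hn
        exact hJ (jRel_of_lTildeRel hx (by rw [← mul_assoc, e_mul_of_rRel r.2]) hn)
      rw [tildeSmul_of_mem k (y := ⟨r.1 * x.1, hx⟩) rfl, hbasis, map_smul,
        coind_smul_eq_zero_of_mem_nonDivisors hmem, map_zero]
    · rw [tildeSmul_of_not_mem k hx, TensorProduct.zero_tmul, map_zero, map_zero, map_zero]

end TildeInduced

/-! ### All coinduced modules are simple -/

section Simple

variable {k : Type u} [Field k] {M : Type v} [Monoid M] [Finite M]

instance {X : Type*} [AddCommGroup X] [Module k X] [Module.Finite k X]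
    (ρ : Representation k M X) : Module.Finite k (RepModule ρ) :=
  inferInstanceAs (Module.Finite k X)

/-- A submodule `X` of a finite dimensional module `C` is everything if each simple module is a
quotient of a projective module all of whose maps to `C` have image in `X`. -/
lemma eq_top_of_projective {A : Type w} [Ring A] {C : Type w} [AddCommGroup C]
    [Module A C] [IsArtinian A C] (X : Submodule A C)
    (h : ∀ S : Submodule A (C ⧸ X), IsSimpleModule A S →
      ∃ (P : Type w) (_ : AddCommGroup P) (_ : Module A P) (ψ : P →ₗ[A] S),
        Module.Projective A P ∧ Function.Surjective ψ ∧ ∀ (β : P →ₗ[A] C) (p : P), β p ∈ X) :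
    X = ⊤ := by
  by_contra hne
  have : Nontrivial (C ⧸ X) := Submodule.Quotient.nontrivial_iff.2 hne
  obtain ⟨S, hS⟩ : ∃ S : Submodule A (C ⧸ X), IsAtom S := IsAtomic.exists_atom _
  have hS : IsSimpleModule A S := isSimpleModule_iff_isAtom.2 hS
  obtain ⟨P, _, _, ψ, hproj, hψ, hX⟩ := h S hS
  obtain ⟨β, hβ⟩ := Module.projective_lifting_property X.mkQ (S.subtype ∘ₗ ψ) X.mkQ_surjective
  have := IsSimpleModule.nontrivial A S
  obtain ⟨s, hs⟩ := exists_ne (0 : S)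
  obtain ⟨p, rfl⟩ := hψ s
  have hβp := LinearMap.congr_fun hβ p
  rw [LinearMap.comp_apply, X.mkQ_apply, (Submodule.Quotient.mk_eq_zero _).2 (hX β p)] at hβp
  exact hs (Subtype.ext hβp.symm)

/-- Each simple module is isomorphic to `U^♯` for some simple `k G_{e_i}`-module `U`. -/
lemma exists_equiv_sharp {n : ℕ} {ε : Fin n → Idem M} (hε : IsRegularRepresentatives ε)
    (S : Type w) [AddCommGroup S] [Module (MonoidAlgebra k M) S] [Module k S]
    [IsScalarTower k (MonoidAlgebra k M) S] [IsSimpleModule (MonoidAlgebra k M) S] :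
    ∃ (i : Fin n) (U : Type w) (_ : AddCommGroup U) (_ : Module k U)
      (π : Representation k (MaxSubgroup (ε i)) U),
      π.IsIrreducible ∧ Nonempty (S ≃ₗ[MonoidAlgebra k M] sharp π) := by
  obtain ⟨f, hf⟩ := exists_isApex (k := k) (M := M) (C := S)
  obtain ⟨i, hi⟩ := hε.exists_jRel_idem f
  have hA : IsApex k S (ε i) := hf.of_jRel hi
  exact ⟨i, localSpace k S (ε i), inferInstance, inferInstance, localRep k S (ε i),
    hA.localRep_isIrreducible, hA.nonempty_equiv_sharp⟩

/-- If the projective covers are the modules `k L̃_{e_i} ⊗ U`, then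
`Coind_{G_{e_j}}(W) = W^♯`: a simple submodule of the quotient would give a map from such
a projective cover to `Coind_{G_{e_j}}(W)` whose image is not contained in `W^♯`. -/
lemma sharp_eq_top_of_isProjectiveCover [RightFountain M] {n : ℕ} {ε : Fin n → Idem M}
    (hε : IsRegularRepresentatives ε)
    (h : ∀ (i : Fin n) (U : Type (max u v)) [AddCommGroup U] [Module k U]
      (π : Representation k (MaxSubgroup (ε i)) U), π.IsIrreducible →
        IsProjectiveCover (MonoidAlgebra k M) (RepModule (tildeIndRep π)) (sharp π))
    (j : Fin n) (W : Type (max u v)) [AddCommGroup W] [Module k W]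
    (τ : Representation k (MaxSubgroup (ε j)) W) (hτ : τ.IsIrreducible) : sharp τ = ⊤ := by
  have := finite_of_isIrreducible hτ
  have : IsArtinian (MonoidAlgebra k M) (RepModule (coindRep τ)) :=
    isArtinian_of_tower k inferInstance
  refine eq_top_of_projective (sharp τ) fun S hS => ?_
  obtain ⟨i, U, _, _, π, hπ, ⟨E⟩⟩ := exists_equiv_sharp (k := k) hε S
  obtain ⟨hproj, ψ, hψ, -⟩ := h i U π hπ
  exact ⟨_, _, _, E.symm.toLinearMap ∘ₗ ψ, hproj, E.symm.surjective.comp hψ,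
    tildeInd_hom_mem _ (fun hJ => congrArg ε (hε.eq_of_jRel j i hJ))⟩

/-- Under each of the three conditions, all the modules `Coind_{G_e}(V)` with `V` simple are
simple. -/
lemma isSimpleModule_coind [RightFountain M] {n : ℕ} {ε : Fin n → Idem M}
    (hε : IsRegularRepresentatives ε)
    (hcond :
      (∀ i, SandwichRightInvertible k (ε i)) ∨
      (∀ (i : Fin n) (U : Type (max u v)) [AddCommGroup U] [Module k U]
        (π : Representation k (MaxSubgroup (ε i)) U), π.IsIrreducible →
          IsSimpleModule (MonoidAlgebra k M) (RepModule (coindRep π))) ∨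
      (∀ (i : Fin n) (U : Type (max u v)) [AddCommGroup U] [Module k U]
        (π : Representation k (MaxSubgroup (ε i)) U), π.IsIrreducible →
          IsProjectiveCover (MonoidAlgebra k M) (RepModule (tildeIndRep π)) (sharp π)))
    (e : Idem M) (V : Type (max u v)) [AddCommGroup V] [Module k V]
    (σ : Representation k (MaxSubgroup e) V) (hσ : σ.IsIrreducible) :
    IsSimpleModule (MonoidAlgebra k M) (RepModule (coindRep σ)) := by
  have hrep : ∀ (i : Fin n) (U : Type (max u v)) [AddCommGroup U] [Module k U]
        (π : Representation k (MaxSubgroup (ε i)) U), π.IsIrreducible →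
          IsSimpleModule (MonoidAlgebra k M) (RepModule (coindRep π)) := by
    rcases hcond with h | h | h
    · intro i U _ _ π hπ
      exact isSimpleModule_coind_of_sharp_eq_top hπ
        (sharp_eq_top_of_sandwichRightInvertible (h i) π)
    · exact h
    · intro i U _ _ π hπ
      exact isSimpleModule_coind_of_sharp_eq_top hπ
        (sharp_eq_top_of_isProjectiveCover hε h i U π hπ)
  obtain ⟨i, hi⟩ := hε.exists_jRel_idem e
  have hA : IsApex k (RepModule (coindRep σ)) (ε i) := (isApex_coind hσ).of_jRel hi
  have := hrep i _ _ hA.localRep_isIrreducible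
  exact hA.isSimpleModule

end Simple

/-! ### Irreducible representations over a splitting field -/

section Splitting

variable {k G V : Type*} [Field k] [Group G] [AddCommGroup V] [Module k V]
  {ρ : Representation k G V}

/-- An irreducible representation is generated by each nonzero vector. -/
lemma exists_asAlgebraHom_apply_eq (hρ : ρ.IsIrreducible) {x : V} (hx : x ≠ 0) (y : V) :
    ∃ a : MonoidAlgebra k G, ρ.asAlgebraHom a x = y := by
  have htop : LinearMap.range (ρ.asAlgebraHom.toLinearMap.flip x) = ⊤ := by
    refine eq_top_of_stable hρ ?_ fun h => hx ?_
    · rintro g _ ⟨a, rfl⟩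
      refine ⟨of k G g * a, ?_⟩
      simp only [LinearMap.flip_apply, AlgHom.toLinearMap_apply, map_mul, Module.End.mul_apply,
        ρ.asAlgebraHom_of]
    · have : x ∈ LinearMap.range (ρ.asAlgebraHom.toLinearMap.flip x) := ⟨1, by simp⟩
      rwa [h, Submodule.mem_bot] at this
  have : y ∈ LinearMap.range (ρ.asAlgebraHom.toLinearMap.flip x) := htop ▸ Submodule.mem_top
  exact this

lemma commute_asAlgebraHom {T : V →ₗ[k] V} (hT : ∀ g x, T (ρ g x) = ρ g (T x))
    (a : MonoidAlgebra k G) (x : V) : T (ρ.asAlgebraHom a x) = ρ.asAlgebraHom a (T x) := by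
  induction a using MonoidAlgebra.induction_on with
  | of g => rw [ρ.asAlgebraHom_of, hT]
  | add a b ha hb => simp only [map_add, LinearMap.add_apply, ha, hb]
  | smul c a ha => simp only [map_smul, LinearMap.smul_apply, ha]

/-- If some operator of rank one with eigenvalue `1` commutes with all endomorphisms of
an irreducible representation, then these endomorphisms are scalars. -/
lemma exists_eq_smul_of_rank_one (hρ : ρ.IsIrreducible) {T : V →ₗ[k] V}
    (hT : ∀ g x, T (ρ g x) = ρ g (T x)) {E : V →ₗ[k] V} (hTE : ∀ x, T (E x) = E (T x))
    {x₀ : V} (hx₀ : x₀ ≠ 0) (hE₀ : E x₀ = x₀) (hE : ∀ x, ∃ c : k, E x = c • x₀) :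
    ∃ c : k, ∀ x, T x = c • x := by
  obtain ⟨c, hc⟩ := hE (T x₀)
  rw [← hTE, hE₀] at hc
  refine ⟨c, ?_⟩
  have htop : LinearMap.ker (T - c • LinearMap.id) = ⊤ := by
    refine eq_top_of_stable hρ (fun g x hx => ?_) fun h => hx₀ ?_
    · have hx' : T x = c • x := sub_eq_zero.1 hx
      exact sub_eq_zero.2 (by rw [hT, hx', map_smul]; rfl)
    · have : x₀ ∈ LinearMap.ker (T - c • LinearMap.id) := sub_eq_zero.2 hc
      rwa [h, Submodule.mem_bot] at this
  intro x
  have : x ∈ LinearMap.ker (T - c • LinearMap.id) := htop ▸ Submodule.mem_top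
  exact sub_eq_zero.1 this

/-- The diagonal matrix units of a split semisimple group algebra are primitive idempotents; one of
them acts on `V` with rank one. -/
lemma exists_smul_of_commute_of_isSplit [Finite G] [NeZero (Nat.card G : k)]
    (hsplit : IsSplitAlgebra k (MonoidAlgebra k G)) (hρ : ρ.IsIrreducible) {T : V →ₗ[k] V}
    (hT : ∀ g x, T (ρ g x) = ρ g (T x)) : ∃ c : k, ∀ x, T x = c • x := by
  classical
  obtain ⟨r, d, φ, hsurj, hker⟩ := hsplit
  have hinj : Function.Injective φ := by
    rw [injective_iff_map_eq_zero]
    intro a ha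
    have : a ∈ RingHom.ker φ := ha
    rwa [hker, IsSemisimpleRing.jacobson_eq_bot, Submodule.mem_bot] at this
  let Φ := AlgEquiv.ofBijective φ ⟨hinj, hsurj⟩
  let p : (i : Fin r) → Fin (d i) → MonoidAlgebra k G := fun i j =>
    Φ.symm (Pi.single i (Matrix.single j j 1))
  have hp : ∑ i, ∑ j, p i j = 1 := by
    apply Φ.injective
    simp only [p, map_sum, AlgEquiv.apply_symm_apply, map_one]
    ext i a b
    simp only [Finset.sum_apply, Matrix.sum_apply, Pi.one_apply]
    rw [Finset.sum_eq_single i]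
    · simp [Matrix.single_apply, Matrix.one_apply, ite_and]
    · intro i' _ hi'
      simp [Pi.single_eq_of_ne hi'.symm]
    · simp
  have hpap : ∀ i j (a : MonoidAlgebra k G), p i j * a * p i j = (Φ a i j j) • p i j := by
    intro i j a
    apply Φ.injective
    simp only [p, map_mul, AlgEquiv.apply_symm_apply, map_smul]
    ext i' b c
    by_cases hi : i' = i
    · subst hi
      simp only [Pi.mul_apply, Pi.single_eq_same, Pi.smul_apply, Matrix.smul_apply]
      rw [Matrix.single_mul_mul_single, one_mul, mul_one]
      simp [Matrix.single_apply]
    · simp [Pi.single_eq_of_ne hi]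
  have := nontrivial_of_isIrreducible hρ
  obtain ⟨y, hy⟩ := exists_ne (0 : V)
  obtain ⟨i, j, x, hx⟩ : ∃ i j x, ρ.asAlgebraHom (p i j) x ≠ 0 := by
    by_contra! h
    refine hy ?_
    have : ρ.asAlgebraHom (∑ i, ∑ j, p i j) y = 0 := by
      simp only [map_sum, LinearMap.sum_apply, h, Finset.sum_const_zero]
    rwa [hp, map_one] at this
  refine exists_eq_smul_of_rank_one hρ hT (E := ρ.asAlgebraHom (p i j))
    (commute_asAlgebraHom hT _) hx ?_ fun z => ?_
  · rw [← Module.End.mul_apply, ← map_mul]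
    have := hpap i j 1
    rw [mul_one, map_one, Pi.one_apply, Matrix.one_apply_eq, one_smul] at this
    rw [this]
  · obtain ⟨a, rfl⟩ := exists_asAlgebraHom_apply_eq hρ hx z
    refine ⟨Φ a i j j, ?_⟩
    rw [← Module.End.mul_apply, ← Module.End.mul_apply, ← map_mul, ← map_mul, hpap, map_smul,
      LinearMap.smul_apply]

/-- Burnside's theorem for an irreducible representation all of whose endomorphisms are scalars. -/
lemma asAlgebraHom_surjective [Module.Finite k V] (hρ : ρ.IsIrreducible)
    (hend : ∀ T : V →ₗ[k] V, (∀ g x, T (ρ g x) = ρ g (T x)) → ∃ c : k, ∀ x, T x = c • x) :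
    Function.Surjective ρ.asAlgebraHom := by
  classical
  intro f
  have := isIrreducible_iff.1 hρ
  let F : Module.End (Module.End (MonoidAlgebra k G) (RepModule ρ)) (RepModule ρ) :=
    { toFun := fun x => (RepModule.equiv ρ).symm (f (RepModule.equiv ρ x))
      map_add' := by simp
      map_smul' := fun T x => by
        obtain ⟨c, hc⟩ := hend
          ((RepModule.equiv ρ).toLinearMap ∘ₗ T.restrictScalars k ∘ₗ
            (RepModule.equiv ρ).symm.toLinearMap) fun g x => by
          have := T.map_smul (of k G g) ((RepModule.equiv ρ).symm x)
          rw [RepModule.of_smul, RepModule.of_smul] at this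
          exact this
        have hc' : ∀ x : RepModule ρ, T x = c • x := hc
        simp only [Module.End.smul_def, RingHom.id_apply, hc', map_smul] }
  let b := Module.finBasis k V
  obtain ⟨a, ha⟩ := jacobson_density F
    (Finset.univ.image fun i => (RepModule.equiv ρ).symm (b i))
  refine ⟨a, b.ext fun i => ?_⟩
  have := ha ((RepModule.equiv ρ).symm (b i)) (Finset.mem_image_of_mem _ (Finset.mem_univ i))
  rw [RepModule.smul_def] at this
  exact this.symm

end Splitting

/-! ### The outer tensor product `W ⊗ D(V)` -/

section OuterTensor

variable {k G H W V : Type*} [Field k] [Group G] [Group H] [AddCommGroup W] [Module k W]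
  [AddCommGroup V] [Module k V] {τ : Representation k G W}
  {σ : Representation k H V}

variable (k W V) in
/-- The isomorphism from `W ⊗ D(V)` to `Hom(V, W)`. -/
noncomputable def tensorDualEquiv [Module.Finite k V] : W ⊗[k] Module.Dual k V ≃ₗ[k] (V →ₗ[k] W) :=
  (TensorProduct.comm k W (Module.Dual k V)).trans (dualTensorHomEquiv k V W)

lemma tensorDualEquiv_tmul [Module.Finite k V] (w : W) (ℓ : Module.Dual k V) (v : V) :
    tensorDualEquiv k W V (w ⊗ₜ ℓ) v = ℓ v • w := by
  simp [tensorDualEquiv, dualTensorHomEquiv]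

lemma tensorDualEquiv_map [Module.Finite k V] (P : W →ₗ[k] W) (Q : V →ₗ[k] V)
    (u : W ⊗[k] Module.Dual k V) :
    tensorDualEquiv k W V (TensorProduct.map P Q.dualMap u) =
      P ∘ₗ tensorDualEquiv k W V u ∘ₗ Q := by
  induction u using TensorProduct.induction_on with
  | zero => simp
  | tmul w ℓ =>
    ext v
    simp [tensorDualEquiv_tmul]
  | add x y hx hy => rw [map_add, map_add, hx, hy, map_add, LinearMap.add_comp, LinearMap.comp_add]

lemma outerTensorDual_apply (g : G) (h : H) :
    outerTensorDual τ σ (g, h) = TensorProduct.map (τ g) (σ h⁻¹).dualMap := rfl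

lemma tensorDualEquiv_outerTensorDual [Module.Finite k V] (g : G) (h : H)
    (u : W ⊗[k] Module.Dual k V) :
    tensorDualEquiv k W V (outerTensorDual τ σ (g, h) u) =
      τ g ∘ₗ tensorDualEquiv k W V u ∘ₗ σ h⁻¹ := by
  rw [outerTensorDual_apply, tensorDualEquiv_map]

/-- What is stable under `G × H` is stable under the operators `P ⊗ D(Q)`, for `P` and `Q` in the
images of the group algebras. -/
lemma map_mem_of_stable {U : Submodule k (W ⊗[k] Module.Dual k V)}
    (hU : ∀ p, ∀ u ∈ U, outerTensorDual τ σ p u ∈ U) (a : MonoidAlgebra k G)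
    (b : MonoidAlgebra k H) {u : W ⊗[k] Module.Dual k V} (hu : u ∈ U) :
    TensorProduct.map (τ.asAlgebraHom a) (σ.asAlgebraHom b).dualMap u ∈ U := by
  induction a using MonoidAlgebra.induction_on with
  | of g =>
    induction b using MonoidAlgebra.induction_on with
    | of h =>
      have := hU (g, h⁻¹) u hu
      rwa [outerTensorDual_apply, inv_inv, ← τ.asAlgebraHom_of, ← σ.asAlgebraHom_of] at this
    | add b b' hb hb' =>
      rw [map_add, show (σ.asAlgebraHom b + σ.asAlgebraHom b').dualMap =
        (σ.asAlgebraHom b).dualMap + (σ.asAlgebraHom b').dualMap from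
          map_add Module.Dual.transpose _ _, TensorProduct.map_add_right]
      exact U.add_mem hb hb'
    | smul c b hb =>
      rw [map_smul, show (c • σ.asAlgebraHom b).dualMap =
        c • (σ.asAlgebraHom b).dualMap from map_smul Module.Dual.transpose _ _,
        TensorProduct.map_smul_right]
      exact U.smul_mem c hb
  | add a a' ha ha' =>
    rw [map_add, TensorProduct.map_add_left]
    exact U.add_mem ha ha'
  | smul c a ha =>
    rw [map_smul, TensorProduct.map_smul_left]
    exact U.smul_mem c ha

lemma commute_map {T : W ⊗[k] Module.Dual k V →ₗ[k] W ⊗[k] Module.Dual k V}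
    (hT : ∀ p u, T (outerTensorDual τ σ p u) = outerTensorDual τ σ p (T u))
    (a : MonoidAlgebra k G) (b : MonoidAlgebra k H) (u : W ⊗[k] Module.Dual k V) :
    T (TensorProduct.map (τ.asAlgebraHom a) (σ.asAlgebraHom b).dualMap u) =
      TensorProduct.map (τ.asAlgebraHom a) (σ.asAlgebraHom b).dualMap (T u) := by
  induction a using MonoidAlgebra.induction_on with
  | of g =>
    induction b using MonoidAlgebra.induction_on with
    | of h =>
      have := hT (g, h⁻¹) u
      rwa [outerTensorDual_apply, inv_inv, ← τ.asAlgebraHom_of, ← σ.asAlgebraHom_of] at this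
    | add b b' hb hb' =>
      rw [map_add, show (σ.asAlgebraHom b + σ.asAlgebraHom b').dualMap =
        (σ.asAlgebraHom b).dualMap + (σ.asAlgebraHom b').dualMap from
          map_add Module.Dual.transpose _ _, TensorProduct.map_add_right, LinearMap.add_apply,
        map_add, hb, hb', LinearMap.add_apply]
    | smul c b hb =>
      rw [map_smul, show (c • σ.asAlgebraHom b).dualMap =
        c • (σ.asAlgebraHom b).dualMap from map_smul Module.Dual.transpose _ _,
        TensorProduct.map_smul_right, LinearMap.smul_apply, map_smul, hb, LinearMap.smul_apply]
  | add a a' ha ha' =>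
    rw [map_add, TensorProduct.map_add_left, LinearMap.add_apply, map_add, ha, ha',
      LinearMap.add_apply]
  | smul c a ha =>
    rw [map_smul, TensorProduct.map_smul_left, LinearMap.smul_apply, map_smul, ha,
      LinearMap.smul_apply]

/-- `W ⊗ D(V)` is irreducible when `kG` and `kH` map onto `End(W)` and `End(V)`. -/
lemma outerTensorDual_isIrreducible [Module.Finite k V] [Nontrivial W] [Nontrivial V]
    (hτ : Function.Surjective τ.asAlgebraHom) (hσ : Function.Surjective σ.asAlgebraHom) :
    (outerTensorDual τ σ).IsIrreducible := by
  have : Nontrivial (V →ₗ[k] W) := by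
    obtain ⟨w, hw⟩ := exists_ne (0 : W)
    obtain ⟨v, hv⟩ := exists_ne (0 : V)
    obtain ⟨ℓ, hℓ⟩ := Module.Projective.exists_dual_eq_one k hv
    refine ⟨LinearMap.smulRight ℓ w, 0, fun h => hw ?_⟩
    simpa [hℓ] using LinearMap.congr_fun h v
  have : Nontrivial (W ⊗[k] Module.Dual k V) := (tensorDualEquiv k W V).toEquiv.nontrivial
  refine isIrreducible_of fun U hU hne => ?_
  obtain ⟨u, hu, hu0⟩ := Submodule.exists_mem_ne_zero_of_ne_bot hne
  have hθ : tensorDualEquiv k W V u ≠ 0 := fun h =>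
    hu0 ((tensorDualEquiv k W V).injective (by rw [h, map_zero]))
  obtain ⟨v, hv⟩ : ∃ v, tensorDualEquiv k W V u v ≠ 0 := by
    by_contra! h
    exact hθ (LinearMap.ext h)
  rw [eq_top_iff, ← TensorProduct.span_tmul_eq_top, Submodule.span_le]
  rintro _ ⟨w, ℓ, rfl⟩
  obtain ⟨μ, hμ⟩ := Module.Projective.exists_dual_eq_one k hv
  obtain ⟨a, ha⟩ := hτ (LinearMap.smulRight μ w)
  obtain ⟨b, hb⟩ := hσ (LinearMap.smulRight ℓ v)
  have heq : w ⊗ₜ[k] ℓ =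
      TensorProduct.map (τ.asAlgebraHom a) (σ.asAlgebraHom b).dualMap u := by
    apply (tensorDualEquiv k W V).injective
    rw [tensorDualEquiv_map, ha, hb]
    ext x
    simp [tensorDualEquiv_tmul, hμ]
  rw [heq]
  exact map_mem_of_stable hU a b hu

/-- The endomorphisms of `W ⊗ D(V)` are scalars when `kG` and `kH` map onto `End(W)` and
`End(V)`. -/
lemma outerTensorDual_exists_smul [Module.Finite k V] [Nontrivial W] [Nontrivial V]
    (hτ : Function.Surjective τ.asAlgebraHom) (hσ : Function.Surjective σ.asAlgebraHom)
    {T : W ⊗[k] Module.Dual k V →ₗ[k] W ⊗[k] Module.Dual k V}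
    (hT : ∀ p u, T (outerTensorDual τ σ p u) = outerTensorDual τ σ p (T u)) :
    ∃ c : k, ∀ u, T u = c • u := by
  obtain ⟨w, hw⟩ := exists_ne (0 : W)
  obtain ⟨v, hv⟩ := exists_ne (0 : V)
  obtain ⟨μ, hμ⟩ := Module.Projective.exists_dual_eq_one k hw
  obtain ⟨ℓ, hℓ⟩ := Module.Projective.exists_dual_eq_one k hv
  obtain ⟨a, ha⟩ := hτ (LinearMap.smulRight μ w)
  obtain ⟨b, hb⟩ := hσ (LinearMap.smulRight ℓ v)
  have hval : ∀ u, TensorProduct.map (τ.asAlgebraHom a) (σ.asAlgebraHom b).dualMap u =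
      (μ (tensorDualEquiv k W V u v)) • (w ⊗ₜ[k] ℓ) := by
    intro u
    apply (tensorDualEquiv k W V).injective
    rw [tensorDualEquiv_map, ha, hb]
    ext x
    simp [tensorDualEquiv_tmul, smul_smul, mul_comm]
  refine exists_eq_smul_of_rank_one (outerTensorDual_isIrreducible hτ hσ) hT
    (E := TensorProduct.map (τ.asAlgebraHom a) (σ.asAlgebraHom b).dualMap) (commute_map hT a b)
    (x₀ := w ⊗ₜ[k] ℓ) ?_ ?_ fun u => ⟨_, hval u⟩
  · intro h
    have := congrArg (fun u => tensorDualEquiv k W V u v) h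
    simp only [tensorDualEquiv_tmul, hℓ, one_smul, map_zero, LinearMap.zero_apply] at this
    exact hw this
  · rw [hval, tensorDualEquiv_tmul, hℓ, one_smul, hμ, one_smul]

end OuterTensor

/-! ### Multiplicities in semisimple modules -/

section Multiplicity

variable {k A : Type*} [Field k] [Ring A] [Algebra k A]

variable (k) in
lemma finite_submodule {X : Type*} [AddCommGroup X] [Module A X] [Module k X]
    [IsScalarTower k A X] [Module.Finite k X] (N : Submodule A X) : Module.Finite k N :=
  Module.Finite.of_injective (N.subtype.restrictScalars k) N.injective_subtype

section Hom

variable {Z S : Type*} [AddCommGroup Z] [Module A Z] [Module k Z] [IsScalarTower k A Z]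
  [AddCommGroup S] [Module A S] [Module k S] [IsScalarTower k A S]

lemma finite_hom [Module.Finite k Z] [Module.Finite k S] : Module.Finite k (Z →ₗ[A] S) :=
  Module.Finite.of_injective (LinearMap.restrictScalarsₗ k A Z S k)
    (LinearMap.restrictScalars_injective k)

variable (k) in
/-- Restriction of linear maps to a submodule. -/
def restrictHom (N : Submodule A Z) : (Z →ₗ[A] S) →ₗ[k] (N →ₗ[A] S) where
  toFun f := f ∘ₗ N.subtype
  map_add' _ _ := rfl
  map_smul' _ _ := rfl

variable (k) in
/-- Composition of linear maps with the projection to a quotient. -/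
def inflateHom (N : Submodule A Z) : ((Z ⧸ N) →ₗ[A] S) →ₗ[k] (Z →ₗ[A] S) where
  toFun f := f ∘ₗ N.mkQ
  map_add' _ _ := rfl
  map_smul' _ _ := rfl

variable (k) in
lemma finrank_hom_eq_add [IsSemisimpleModule A Z] [Module.Finite k Z] [Module.Finite k S]
    (N : Submodule A Z) :
    Module.finrank k (Z →ₗ[A] S) =
      Module.finrank k (N →ₗ[A] S) + Module.finrank k ((Z ⧸ N) →ₗ[A] S) := by
  have := finite_hom (k := k) (A := A) (Z := Z) (S := S)
  have hsurj : Function.Surjective (restrictHom k (S := S) N) := by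
    intro f
    obtain ⟨N', hN'⟩ := exists_isCompl N
    refine ⟨f ∘ₗ N.projectionOnto N' hN', LinearMap.ext fun x => ?_⟩
    exact congrArg f (Submodule.projectionOnto_apply_left hN' x)
  have hinj : Function.Injective (inflateHom k (S := S) N) := fun f g h =>
    LinearMap.ext fun x => by
      obtain ⟨x, rfl⟩ := N.mkQ_surjective x
      exact LinearMap.congr_fun h x
  have hker : LinearMap.range (inflateHom k (S := S) N) = LinearMap.ker (restrictHom k N) := by
    apply le_antisymm
    · rintro _ ⟨f, rfl⟩
      refine LinearMap.ext fun x => ?_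
      have : N.mkQ x = 0 := (Submodule.Quotient.mk_eq_zero _).2 x.2
      exact (congrArg f this).trans (map_zero f)
    · intro f hf
      refine ⟨N.liftQ f fun x hx => ?_, LinearMap.ext fun x => rfl⟩
      exact LinearMap.congr_fun hf ⟨x, hx⟩
  rw [← LinearMap.finrank_range_add_finrank_ker (restrictHom k (S := S) N), ← hker,
    LinearMap.finrank_range_of_inj hinj, LinearMap.range_eq_top.2 hsurj, finrank_top]

variable (k) in
/-- Composition of linear maps with an isomorphism of the sources. -/
def congrHom {Z' : Type*} [AddCommGroup Z'] [Module A Z'] (E : Z ≃ₗ[A] Z') :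
    (Z' →ₗ[A] S) ≃ₗ[k] (Z →ₗ[A] S) where
  toFun f := f ∘ₗ E.toLinearMap
  map_add' _ _ := rfl
  map_smul' _ _ := rfl
  invFun f := f ∘ₗ E.symm.toLinearMap
  left_inv f := by ext; simp
  right_inv f := by ext; simp

open Classical in
variable (k) in
/-- Schur's lemma, for a simple module `S` whose endomorphisms are scalars. -/
lemma finrank_hom_of_isSimpleModule {Q : Type*} [AddCommGroup Q] [Module A Q]
    [IsSimpleModule A Q] [IsSimpleModule A S]
    (hS : ∀ T : S →ₗ[A] S, ∃ c : k, ∀ x, T x = c • x) :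
    Module.finrank k (Q →ₗ[A] S) = if Nonempty (Q ≃ₗ[A] S) then 1 else 0 := by
  split_ifs with h
  · obtain ⟨E⟩ := h
    rw [← (congrHom k E).finrank_eq]
    have := IsSimpleModule.nontrivial A S
    refine finrank_eq_one (LinearMap.id : S →ₗ[A] S) (fun h => ?_) fun T => ?_
    · obtain ⟨s, hs⟩ := exists_ne (0 : S)
      exact hs (LinearMap.congr_fun h s)
    · obtain ⟨c, hc⟩ := hS T
      exact ⟨c, LinearMap.ext fun x => (hc x).symm⟩
  · have : Subsingleton (Q →ₗ[A] S) := ⟨fun f g => by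
      have hzero : ∀ f : Q →ₗ[A] S, f = 0 := fun f =>
        (LinearMap.bijective_or_eq_zero f).resolve_left fun hf =>
          h ⟨LinearEquiv.ofBijective f hf⟩
      rw [hzero f, hzero g]⟩
    exact Module.finrank_zero_of_subsingleton

end Hom

lemma eq_add_sum_of_succ {n : ℕ} (h : Fin (n + 1) → ℕ) (δ : Fin n → ℕ)
    (hδ : ∀ i, h i.succ = h i.castSucc + δ i) : h (Fin.last n) = h 0 + ∑ i, δ i := by
  induction n with
  | zero => simp
  | succ n ih =>
    have h' : h (Fin.last n).castSucc = h 0 + ∑ i : Fin n, δ i.castSucc :=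
      ih (fun i => h i.castSucc) (fun i => δ i.castSucc) fun i => hδ i.castSucc
    rw [Fin.sum_univ_castSucc, ← add_assoc, ← h']
    exact hδ (Fin.last n)

/-- In a semisimple module `X`, the multiplicity of a simple module `S` whose endomorphisms are
scalars is the dimension of `Hom(X, S)`. -/
lemma isConstituentMultiplicity_finrank_hom {X S : Type*} [AddCommGroup X] [Module A X]
    [Module k X] [IsScalarTower k A X] [AddCommGroup S] [Module A S] [Module k S]
    [IsScalarTower k A S] [IsSemisimpleModule A X] [Module.Finite k X] [Module.Finite k S]
    [IsSimpleModule A S] (hS : ∀ T : S →ₗ[A] S, ∃ c : k, ∀ x, T x = c • x) :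
    IsConstituentMultiplicity A X S (Module.finrank k (X →ₗ[A] S)) := by
  classical
  have : IsArtinian A X := isArtinian_of_tower k inferInstance
  have : IsNoetherian A X := isNoetherian_of_tower k inferInstance
  refine ⟨exists_compositionSeries_of_isNoetherian_isArtinian A X, fun s hbot htop => ?_⟩
  have hstep : ∀ i : Fin s.length, Module.finrank k (s i.succ →ₗ[A] S) =
      Module.finrank k (s i.castSucc →ₗ[A] S) +
        if Nonempty ((↥(s i.succ) ⧸ (s i.castSucc).submoduleOf (s i.succ)) ≃ₗ[A] S)
          then 1 else 0 := by
    intro i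
    have hcov : s i.castSucc ⋖ s i.succ := s.step i
    have hle : s i.castSucc ≤ s i.succ := hcov.le
    have : IsSimpleModule A (↥(s i.succ) ⧸ (s i.castSucc).submoduleOf (s i.succ)) :=
      (covBy_iff_quot_is_simple hle).1 hcov
    have := finite_submodule k (s i.succ)
    rw [finrank_hom_eq_add k ((s i.castSucc).submoduleOf (s i.succ)),
      ← finrank_hom_of_isSimpleModule k hS,
      (congrHom k (Submodule.submoduleOfEquivOfLe hle)).finrank_eq]
  have hsum := eq_add_sum_of_succ (fun j => Module.finrank k (s j →ₗ[A] S)) _ hstep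
  have hlast : s (Fin.last _) = ⊤ := htop
  have hhead : s 0 = ⊥ := hbot
  have hfin : ∀ {N N' : Submodule A X}, N = N' →
      Module.finrank k (N →ₗ[A] S) = Module.finrank k (N' →ₗ[A] S) := by
    rintro N _ rfl; rfl
  have h0 : Module.finrank k ((⊥ : Submodule A X) →ₗ[A] S) = 0 := by
    have : Subsingleton ((⊥ : Submodule A X) →ₗ[A] S) :=
      ⟨fun f g => LinearMap.ext fun x => by rw [Subsingleton.elim x 0, map_zero, map_zero]⟩
    exact Module.finrank_zero_of_subsingleton
  rw [hfin hlast, hfin hhead, h0, zero_add,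
    ← (congrHom k (Submodule.topEquiv (R := A) (M := X))).finrank_eq] at hsum
  rw [hsum, factorCount, Nat.card_eq_fintype_card, Fintype.card_subtype, Finset.card_filter]

end Multiplicity

/-! ### The projection of `k L̃_e` onto `k G_e` -/

section GroupPart

variable (k : Type*) {M : Type*} [Field k] [Monoid M] {e : Idem M}

lemma MaxSubgroup.lTildeRel {M : Type*} [Monoid M] {e : Idem M} (g : MaxSubgroup e) :
    LTildeRel g.toM e.1 := fun a _ => by
  refine ⟨fun h => ?_, fun h => ?_⟩
  · rw [← g.toM_inv_mul, mul_assoc, h]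
  · rw [← g.mul_e, mul_assoc, h]

open Classical in
/-- The projection of `k L̃_e` onto `k G_e` that kills the elements of `L̃_e ∖ G_e`. -/
noncomputable def groupPart : TildeModule k e →ₗ[k] MonoidAlgebra k (MaxSubgroup e) :=
  (tildeBasis k e).constr k fun x =>
    if h : ∃ g : MaxSubgroup e, g.toM = x.1 then of k (MaxSubgroup e) h.choose else 0

lemma groupPart_basis {x : LTilde e} {g : MaxSubgroup e} (h : g.toM = x.1) :
    groupPart k (tildeBasis k e x) = of k (MaxSubgroup e) g := by
  have h' : ∃ g : MaxSubgroup e, g.toM = x.1 := ⟨g, h⟩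
  have hc : h'.choose = g := MaxSubgroup.toM_injective (by rw [h'.choose_spec, h])
  rw [groupPart, Module.Basis.constr_basis, dif_pos h', hc]

lemma groupPart_basis_eq_zero {x : LTilde e} (h : ¬ ∃ g : MaxSubgroup e, g.toM = x.1) :
    groupPart k (tildeBasis k e x) = 0 := by
  rw [groupPart, Module.Basis.constr_basis, dif_neg h]

lemma groupPart_smul_basis {m : M} {x : LTilde e} {g : MaxSubgroup e} (h : g.toM = m * x.1) :
    groupPart k (lTildeRep k e m (tildeBasis k e x)) = of k (MaxSubgroup e) g := by
  rw [lTildeRep_basis, tildeSmul_of_mem k (y := ⟨g.toM, g.lTildeRel⟩) h.symm,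
    groupPart_basis k rfl]

lemma groupPart_smul_basis_eq_zero {m : M} {x : LTilde e}
    (h : ¬ ∃ g : MaxSubgroup e, g.toM = m * x.1) :
    groupPart k (lTildeRep k e m (tildeBasis k e x)) = 0 := by
  rw [lTildeRep_basis]
  by_cases hx : LTildeRel (m * x.1) e.1
  · rw [tildeSmul_of_mem k (y := ⟨m * x.1, hx⟩) rfl, groupPart_basis_eq_zero k h]
  · rw [tildeSmul_of_not_mem k hx, map_zero]

lemma groupPart_smul_of_mem_nonDivisors {m : M} (hm : m ∈ nonDivisors e) (x : TildeModule k e) :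
    groupPart k (lTildeRep k e m x) = 0 := by
  suffices h : groupPart k ∘ₗ lTildeRep k e m = 0 from LinearMap.congr_fun h x
  refine (tildeBasis k e).ext fun x => ?_
  refine groupPart_smul_basis_eq_zero k ?_
  rintro ⟨g, hg⟩
  exact g.not_mem_nonDivisors (hg ▸ mul_mem_nonDivisors_right hm x.1)

lemma groupPart_smul_left (g : MaxSubgroup e) {m : M} (hm : e.1 * m = m) (x : TildeModule k e) :
    groupPart k (lTildeRep k e (g.toM * m) x) =
      of k (MaxSubgroup e) g * groupPart k (lTildeRep k e m x) := by
  suffices h : groupPart k ∘ₗ lTildeRep k e (g.toM * m) =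
      LinearMap.mulLeft k (of k (MaxSubgroup e) g) ∘ₗ groupPart k ∘ₗ lTildeRep k e m from
    LinearMap.congr_fun h x
  refine (tildeBasis k e).ext fun x => ?_
  rw [LinearMap.comp_apply, LinearMap.comp_apply, LinearMap.comp_apply, LinearMap.mulLeft_apply]
  by_cases hx : ∃ h : MaxSubgroup e, h.toM = m * x.1
  · obtain ⟨h, hh⟩ := hx
    rw [groupPart_smul_basis k hh, ← map_mul]
    exact groupPart_smul_basis k (by rw [MaxSubgroup.toM_mul, hh, mul_assoc])
  · rw [groupPart_smul_basis_eq_zero k hx, mul_zero, groupPart_smul_basis_eq_zero]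
    rintro ⟨h, hh⟩
    refine hx ⟨g⁻¹ * h, ?_⟩
    rw [MaxSubgroup.toM_mul, hh, ← mul_assoc, ← mul_assoc, g.toM_inv_mul, hm]

lemma groupPart_right [Finite M] [RightFountain M] (g : MaxSubgroup e) (x : TildeModule k e) :
    groupPart k (lTildeRight k g x) = groupPart k x * of k (MaxSubgroup e) g := by
  suffices h : groupPart k ∘ₗ lTildeRight k g =
      LinearMap.mulRight k (of k (MaxSubgroup e) g) ∘ₗ groupPart k from LinearMap.congr_fun h x
  refine (tildeBasis k e).ext fun x => ?_
  rw [LinearMap.comp_apply, LinearMap.comp_apply, LinearMap.mulRight_apply, lTildeRight_basis]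
  by_cases hx : ∃ h : MaxSubgroup e, h.toM = x.1
  · obtain ⟨h, hh⟩ := hx
    rw [groupPart_basis k hh, ← map_mul]
    exact groupPart_basis k (by rw [MaxSubgroup.toM_mul, hh]; rfl)
  · rw [groupPart_basis_eq_zero k hx, zero_mul, groupPart_basis_eq_zero]
    rintro ⟨h, hh⟩
    have hh : h.toM = x.1 * g.toM := hh
    refine hx ⟨h * g⁻¹, ?_⟩
    rw [MaxSubgroup.toM_mul, hh, mul_assoc, g.toM_mul_inv, mul_e_of_lTildeRel x.2]

/-- The inclusion of `k G_e` in `k L̃_e`. -/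
noncomputable def groupInclusion : MonoidAlgebra k (MaxSubgroup e) →ₗ[k] TildeModule k e :=
  (MonoidAlgebra.basis (MaxSubgroup e) k).constr k fun g =>
    tildeBasis k e ⟨g.toM, g.lTildeRel⟩

lemma groupInclusion_of (g : MaxSubgroup e) :
    groupInclusion k (of k (MaxSubgroup e) g) = tildeBasis k e ⟨g.toM, g.lTildeRel⟩ := by
  have : of k (MaxSubgroup e) g = MonoidAlgebra.basis (MaxSubgroup e) k g := by simp
  rw [this, groupInclusion, Module.Basis.constr_basis]

/-- An element of `e k L̃_e` agrees with its projection to `k G_e` up to elements of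
`L̃_e ∩ I(e)`. -/
lemma sub_groupPart_mem [Finite M] {m : M} (hm : e.1 * m = m) (x : TildeModule k e) :
    lTildeRep k e m x - groupInclusion k (groupPart k (lTildeRep k e m x)) ∈
      Submodule.span k {y | ∃ z : LTilde e, z.1 ∈ nonDivisors e ∧ y = tildeBasis k e z} := by
  have hx := (tildeBasis k e).mem_span x
  induction hx using Submodule.span_induction with
  | zero => simp
  | add x y _ _ hx hy =>
    rw [map_add, map_add, map_add, add_sub_add_comm]
    exact Submodule.add_mem _ hx hy
  | smul c x _ hx =>
    rw [map_smul, map_smul, map_smul, ← smul_sub]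
    exact Submodule.smul_mem _ c hx
  | mem _ hx =>
    obtain ⟨x, rfl⟩ := hx
    by_cases h : ∃ g : MaxSubgroup e, g.toM = m * x.1
    · obtain ⟨g, hg⟩ := h
      rw [groupPart_smul_basis k hg, groupInclusion_of, lTildeRep_basis,
        tildeSmul_of_mem k (y := ⟨g.toM, g.lTildeRel⟩) hg.symm, sub_self]
      exact Submodule.zero_mem _
    · rw [groupPart_smul_basis_eq_zero k h, map_zero, sub_zero, lTildeRep_basis]
      by_cases hx : LTildeRel (m * x.1) e.1
      · rw [tildeSmul_of_mem k (y := ⟨m * x.1, hx⟩) rfl]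
        refine Submodule.subset_span ⟨_, ?_, rfl⟩
        by_contra hn
        exact h (exists_maxSubgroup (by rw [← mul_assoc, hm]) (mul_e_of_lTildeRel hx) hn)
      · rw [tildeSmul_of_not_mem k hx]
        exact Submodule.zero_mem _

end GroupPart

/-! ### The map from `k L̃_e ⊗_{k G_e} V` onto `Coind_{G_e}(V)` -/

section TildeToCoind

variable {k : Type*} [Field k] {M : Type*} [Monoid M] {e : Idem M}
  {V : Type*} [AddCommGroup V] [Module k V] (σ : Representation k (MaxSubgroup e) V)

/-- The map `x ⊗ v ↦ (r ↦ (rx) v)`, where `rx` is projected to `k G_e`, as a linear map. -/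
noncomputable def tildeToCoindAux :
    TildeModule k e ⊗[k] V →ₗ[k] RepModule (coindRep σ) :=
  TensorProduct.lift
    { toFun := fun x =>
        { toFun := fun v => (RepModule.equiv (coindRep σ)).symm
            ⟨fun r => σ.asAlgebraHom (groupPart k (lTildeRep k e r.1 x)) v, fun g r => by
              change σ.asAlgebraHom (groupPart k (lTildeRep k e (g.toM * r.1) x)) v =
                σ g (σ.asAlgebraHom (groupPart k (lTildeRep k e r.1 x)) v)
              rw [groupPart_smul_left k g (e_mul_of_rRel r.2), map_mul, Module.End.mul_apply,
                σ.asAlgebraHom_of]⟩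
          map_add' := fun v w => coind_ext fun r =>
            map_add (σ.asAlgebraHom (groupPart k (lTildeRep k e r.1 x))) v w
          map_smul' := fun c v => coind_ext fun r =>
            map_smul (σ.asAlgebraHom (groupPart k (lTildeRep k e r.1 x))) c v }
      map_add' := fun x y => LinearMap.ext fun v => coind_ext fun r => by
        change σ.asAlgebraHom (groupPart k (lTildeRep k e r.1 (x + y))) v =
          σ.asAlgebraHom (groupPart k (lTildeRep k e r.1 x)) v +
            σ.asAlgebraHom (groupPart k (lTildeRep k e r.1 y)) v
        rw [map_add, map_add, map_add, LinearMap.add_apply]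
      map_smul' := fun c x => LinearMap.ext fun v => coind_ext fun r => by
        change σ.asAlgebraHom (groupPart k (lTildeRep k e r.1 (c • x))) v =
          c • σ.asAlgebraHom (groupPart k (lTildeRep k e r.1 x)) v
        rw [map_smul, map_smul, map_smul, LinearMap.smul_apply] }

lemma coindEval_tildeToCoindAux (r : RClass e) (x : TildeModule k e) (v : V) :
    coindEval σ r (tildeToCoindAux σ (x ⊗ₜ v)) =
      σ.asAlgebraHom (groupPart k (lTildeRep k e r.1 x)) v := by
  rw [tildeToCoindAux, TensorProduct.lift.tmul]
  rfl

variable [Finite M] [RightFountain M]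

/-- The linear map `x ↦ x ⊗ v` from `k L̃_e` to `k L̃_e ⊗_{k G_e} V`. -/
noncomputable def tmulRight (v : V) :
    RepModule (lTildeRep k e) →ₗ[MonoidAlgebra k M] RepModule (tildeIndRep σ) :=
  homOfCommute (tildeIndMk σ ∘ₗ (TensorProduct.mk k (TildeModule k e) V).flip v ∘ₗ
    (RepModule.equiv (lTildeRep k e)).toLinearMap) (by
      intro m x
      rw [RepModule.of_smul]
      exact (of_smul_tildeIndMk_tmul σ m _ v).symm)

lemma tmulRight_apply (v : V) (x : TildeModule k e) :
    tmulRight σ v ((RepModule.equiv (lTildeRep k e)).symm x) = tildeIndMk σ (x ⊗ₜ v) := rfl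

lemma balancedRelations_le_ker : balancedRelations σ ≤ LinearMap.ker (tildeToCoindAux σ) := by
  refine Submodule.span_le.2 ?_
  rintro _ ⟨g, x, v, rfl⟩
  refine coind_ext fun r => ?_
  rw [map_sub, map_sub, map_zero, coindEval_tildeToCoindAux, coindEval_tildeToCoindAux,
    lTildeRep_right, groupPart_right, map_mul, Module.End.mul_apply, σ.asAlgebraHom_of, sub_self]

/-- The `kM`-linear map from `k L̃_e ⊗_{k G_e} V` to `Coind_{G_e}(V)` that sends `x ⊗ v` to
`r ↦ (rx) v`, where `rx` is projected to `k G_e`. -/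
noncomputable def tildeToCoind :
    RepModule (tildeIndRep σ) →ₗ[MonoidAlgebra k M] RepModule (coindRep σ) :=
  homOfCommute ((balancedRelations σ).liftQ (tildeToCoindAux σ) (balancedRelations_le_ker σ) ∘ₗ
    (RepModule.equiv (tildeIndRep σ)).toLinearMap) (by
      intro m p
      obtain ⟨t, rfl⟩ := tildeIndMk_surjective σ p
      rw [of_smul_tildeIndMk]
      change tildeToCoindAux σ _ = of k M m • tildeToCoindAux σ t
      induction t using TensorProduct.induction_on with
      | zero => simp only [map_zero, smul_zero]
      | add x y hx hy => rw [map_add, map_add, map_add, hx, hy, smul_add]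
      | tmul x v =>
        rw [TensorProduct.map_tmul, LinearMap.id_apply]
        refine coind_ext fun r => ?_
        rw [coindEval_tildeToCoindAux, lTildeRep_lTildeRep]
        by_cases hr : RRel (r.1 * m) e.1
        · rw [coindEval_of_smul (r' := ⟨r.1 * m, hr⟩) rfl, coindEval_tildeToCoindAux]
        · rw [coindEval_of_smul_eq_zero hr]
          rw [rRel_iff_not_mem_nonDivisors (by rw [← mul_assoc, e_mul_of_rRel r.2]), not_not] at hr
          rw [groupPart_smul_of_mem_nonDivisors k hr, map_zero, LinearMap.zero_apply])

lemma coindEval_tildeToCoind (r : RClass e) (x : TildeModule k e) (v : V) :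
    coindEval σ r (tildeToCoind σ (tildeIndMk σ (x ⊗ₜ v))) =
      σ.asAlgebraHom (groupPart k (lTildeRep k e r.1 x)) v :=
  coindEval_tildeToCoindAux σ r x v

lemma tildeToCoind_surjective [Nontrivial V]
    [IsSimpleModule (MonoidAlgebra k M) (RepModule (coindRep σ))] :
    Function.Surjective (tildeToCoind σ) := by
  refine (LinearMap.surjective_or_eq_zero _).resolve_right fun h => ?_
  obtain ⟨v, hv⟩ := exists_ne (0 : V)
  refine hv ?_
  have h1 := coindEval_tildeToCoind σ (RClass.base e) (tildeBasis k e (LTilde.base e)) v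
  rw [groupPart_smul_basis k (g := 1) (MaxSubgroup.toM_one.trans e.2.symm), map_one, map_one,
    Module.End.one_apply, h, LinearMap.zero_apply, map_zero] at h1
  exact h1.symm

end TildeToCoind

/-! ### The radical of `k L̃_e` -/

section RadicalOfTilde

lemma apply_eq_zero_of_mem_radical {k M X : Type*} [Field k] [Monoid M] [AddCommGroup X]
    [Module k X] {ρ : Representation k M X} {S : Type*} [AddCommGroup S]
    [Module (MonoidAlgebra k M) S] [IsSimpleModule (MonoidAlgebra k M) S]
    (T : RepModule ρ →ₗ[MonoidAlgebra k M] S) {x : X} (hx : x ∈ radical ρ) :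
    T ((RepModule.equiv ρ).symm x) = 0 := by
  obtain ⟨y, hy, rfl⟩ := hx
  have := Module.le_comap_jacobson T hy
  rw [Submodule.mem_comap, IsSimpleModule.jacobson_eq_bot, Submodule.mem_bot] at this
  exact this

lemma asAlgebraHom_ofModule' {k G V : Type*} [Field k] [Monoid G] [AddCommGroup V] [Module k V]
    [Module (MonoidAlgebra k G) V] [IsScalarTower k (MonoidAlgebra k G) V]
    (a : MonoidAlgebra k G) (x : V) :
    (Representation.ofModule' (k := k) (G := G) V).asAlgebraHom a x = a • x := by
  have : (Representation.ofModule' (k := k) (G := G) V).asAlgebraHom = Algebra.lsmul k k V :=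
    Equiv.apply_symm_apply _ _
  rw [this]
  rfl

lemma isIrreducible_ofModule' {k G V : Type*} [Field k] [Monoid G] [AddCommGroup V] [Module k V]
    [Module (MonoidAlgebra k G) V] [IsScalarTower k (MonoidAlgebra k G) V]
    [IsSimpleModule (MonoidAlgebra k G) V] :
    (Representation.ofModule' (k := k) (G := G) V).IsIrreducible := by
  have := IsSimpleModule.nontrivial (MonoidAlgebra k G) V
  refine isIrreducible_of fun U hU hne => ?_
  have hU' : ∀ (g : G), ∀ x ∈ U, of k G g • x ∈ U := fun g x hx => by
    have := hU g x hx
    rwa [← Representation.asAlgebraHom_of, asAlgebraHom_ofModule'] at this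
  have htop : stableSubmodule U hU' = ⊤ := (eq_bot_or_eq_top _).resolve_left fun h => by
    refine hne ((Submodule.eq_bot_iff _).2 fun x hx => ?_)
    have hx' : x ∈ stableSubmodule U hU' := hx
    rwa [h] at hx'
  rw [eq_top_iff]
  intro x _
  have hx : x ∈ stableSubmodule U hU' := htop ▸ Submodule.mem_top
  exact hx

/-- An element of a semisimple group algebra is zero if it vanishes on all irreducible
representations. -/
lemma eq_zero_of_asAlgebraHom_eq_zero {k : Type u} {G : Type v} [Field k] [Group G] [Finite G]
    [NeZero (Nat.card G : k)] {a : MonoidAlgebra k G}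
    (h : ∀ (V : Type (max u v)) [AddCommGroup V] [Module k V] (ρ : Representation k G V),
      ρ.IsIrreducible → ρ.asAlgebraHom a = 0) : a = 0 := by
  have : a ∈ Ring.jacobson (MonoidAlgebra k G) := by
    refine Submodule.mem_sInf.2 fun I hI => ?_
    have : IsSimpleModule (MonoidAlgebra k G) (MonoidAlgebra k G ⧸ I) :=
      isSimpleModule_iff_isCoatom.2 hI
    have h' := h (MonoidAlgebra k G ⧸ I) (Representation.ofModule' _) isIrreducible_ofModule'
    have h1 := LinearMap.congr_fun h' (I.mkQ 1)
    rw [asAlgebraHom_ofModule', ← map_smul, smul_eq_mul, mul_one, LinearMap.zero_apply] at h1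
    exact (Submodule.Quotient.mk_eq_zero _).1 h1
  rwa [IsSemisimpleRing.jacobson_eq_bot, Submodule.mem_bot] at this

variable {k : Type u} [Field k] {M : Type v} [Monoid M] [Finite M] {e : Idem M}

/-- If all coinduced modules are simple, the elements of the radical of `k L̃_e` are annihilated by
the maps `x ↦ rx` to `k G_e`. -/
lemma groupPart_eq_zero_of_mem_radical [RightFountain M]
    [NeZero (Nat.card (MaxSubgroup e) : k)]
    (hsimple : ∀ (V : Type (max u v)) [AddCommGroup V] [Module k V]
      (σ : Representation k (MaxSubgroup e) V), σ.IsIrreducible →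
        IsSimpleModule (MonoidAlgebra k M) (RepModule (coindRep σ)))
    {x : TildeModule k e} (hx : x ∈ radical (lTildeRep k e)) (r : RClass e) :
    groupPart k (lTildeRep k e r.1 x) = 0 := by
  refine eq_zero_of_asAlgebraHom_eq_zero fun V _ _ σ hσ => LinearMap.ext fun v => ?_
  have := hsimple V σ hσ
  have h0 := apply_eq_zero_of_mem_radical (tildeToCoind σ ∘ₗ tmulRight σ v) hx
  rw [LinearMap.zero_apply, ← coindEval_tildeToCoind, ← tmulRight_apply]
  exact (congrArg (coindEval σ r) h0).trans (map_zero _)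

/-- A simple quotient of `k L̃_e` on which `f` is an apex forces `f` to be `𝓙`-equivalent to `e`. -/
lemma jRel_of_isApex_quotient {f : Idem M} {S : Type*} [AddCommGroup S]
    [Module (MonoidAlgebra k M) S] [Module k S] [IsScalarTower k (MonoidAlgebra k M) S]
    (π : RepModule (lTildeRep k e) →ₗ[MonoidAlgebra k M] S) (hπ : Function.Surjective π)
    (hf : IsApex k S f) : JRel f.1 e.1 := by
  obtain ⟨c, hc⟩ := hf.exists_ne_zero
  obtain ⟨y, rfl⟩ := hπ c
  by_contra hJ
  refine hc ?_
  suffices h : (π.restrictScalars k) ∘ₗ (RepModule.equiv (lTildeRep k e)).symm.toLinearMap ∘ₗ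
      lTildeRep k e f.1 = 0 by
    rw [← map_smul, RepModule.of_smul]
    exact LinearMap.congr_fun h _
  refine (tildeBasis k e).ext fun x => ?_
  rw [LinearMap.comp_apply, LinearMap.comp_apply, lTildeRep_basis]
  by_cases hx : LTildeRel (f.1 * x.1) e.1
  · have hmem : f.1 * x.1 ∈ nonDivisors f := by
      by_contra hn
      exact hJ (jRel_of_lTildeRel hx (by rw [← mul_assoc, f.2]) hn)
    rw [tildeSmul_of_mem k (y := ⟨f.1 * x.1, hx⟩) rfl, ← lTildeRep_base]
    have h0 := hf.smul_eq_zero _ hmem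
      (π ((RepModule.equiv (lTildeRep k e)).symm (tildeBasis k e (LTilde.base e))))
    rw [← map_smul, RepModule.of_smul] at h0
    exact h0
  · rw [tildeSmul_of_not_mem k hx, map_zero]
    exact map_zero π

/-- The elements that are annihilated by the maps `x ↦ rx` to `k G_e` lie in the radical: in
a simple quotient of `k L̃_e`, with apex `e`, they generate a submodule annihilated by `e`. -/
lemma mem_radical_of_groupPart_eq_zero {x : TildeModule k e}
    (h : ∀ r : RClass e, groupPart k (lTildeRep k e r.1 x) = 0) :
    x ∈ radical (lTildeRep k e) := by
  refine ⟨(RepModule.equiv (lTildeRep k e)).symm x, Submodule.mem_sInf.2 fun X hX => ?_, rfl⟩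
  have : IsSimpleModule (MonoidAlgebra k M) (RepModule (lTildeRep k e) ⧸ X) :=
    isSimpleModule_iff_isCoatom.2 hX
  obtain ⟨f, hf⟩ := exists_isApex (k := k) (M := M) (C := RepModule (lTildeRep k e) ⧸ X)
  have hA := hf.of_jRel (jRel_of_isApex_quotient X.mkQ X.mkQ_surjective hf)
  by_contra hx
  have hne : Submodule.span (MonoidAlgebra k M)
      {X.mkQ ((RepModule.equiv (lTildeRep k e)).symm x)} ≠ ⊥ := fun hbot =>
    hx ((Submodule.Quotient.mk_eq_zero _).1 (Submodule.span_singleton_eq_bot.1 hbot))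
  -- `L̃_e ∩ I(e)` is sent to zero
  have hI : ∀ y ∈ Submodule.span k {y | ∃ z : LTilde e, z.1 ∈ nonDivisors e ∧
      y = tildeBasis k e z}, X.mkQ ((RepModule.equiv (lTildeRep k e)).symm y) = 0 := by
    intro y hy
    induction hy using Submodule.span_induction with
    | mem y hy =>
      obtain ⟨z, hz, rfl⟩ := hy
      have h0 := hA.smul_eq_zero _ hz
        (X.mkQ ((RepModule.equiv (lTildeRep k e)).symm (tildeBasis k e (LTilde.base e))))
      rw [← map_smul, RepModule.of_smul, LinearEquiv.apply_symm_apply, lTildeRep_base] at h0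
      exact h0
    | zero => rw [map_zero, map_zero]
    | add x y _ _ hx hy => rw [map_add, map_add, hx, hy, add_zero]
    | smul c x _ hx =>
      rw [map_smul]
      exact (map_smul (X.mkQ.restrictScalars k) c _).trans (by
        rw [LinearMap.restrictScalars_apply, hx, smul_zero])
  obtain ⟨c, hc⟩ := hA.exists_ne_zero
  refine hc ?_
  have hmem := mem_span_translates _ (hA.smul_mem _ hne c)
  have hzero : ∀ y ∈ Submodule.span k {y | ∃ (m : M),
      ∃ c ∈ ({X.mkQ ((RepModule.equiv (lTildeRep k e)).symm x)} : Set _),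
        y = of k M m • c}, of k M e.1 • y = 0 := by
    intro y hy
    induction hy using Submodule.span_induction with
    | mem y hy =>
      obtain ⟨m, _, rfl, rfl⟩ := hy
      rw [of_smul_of_smul]
      by_cases hm : e.1 * m ∈ nonDivisors e
      · exact hA.smul_eq_zero _ hm _
      · have hem : e.1 * (e.1 * m) = e.1 * m := by rw [← mul_assoc, e.2]
        have hr := (rRel_iff_not_mem_nonDivisors hem).2 hm
        have hs := sub_groupPart_mem k hem x
        rw [h ⟨_, hr⟩, map_zero, sub_zero] at hs
        rw [← map_smul, RepModule.of_smul]
        exact hI _ hs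
    | zero => rw [smul_zero]
    | add x y _ _ hx hy => rw [smul_add, hx, hy, add_zero]
    | smul c x _ hx => rw [smul_comm, hx, smul_zero]
  have := hzero _ hmem
  rwa [of_smul_of_smul, e.2] at this

end RadicalOfTilde

/-! ### A section of the projection onto `k L̃_e ⊗_{k G_e} V` -/

section Section

/-- Over a field, the elements of `L ⊗ V` killed by all `q_i ⊗ V` come from `(⋂ ker q_i) ⊗ V`. -/
lemma mem_range_rTensor_of_forall {k ι L N V : Type*} [Field k] [Finite ι] [AddCommGroup L]
    [Module k L] [AddCommGroup N] [Module k N] [AddCommGroup V] [Module k V]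
    (q : ι → L →ₗ[k] N) {y : L ⊗[k] V} (hy : ∀ i, (q i).rTensor V y = 0) :
    y ∈ LinearMap.range ((⨅ i, LinearMap.ker (q i)).subtype.rTensor V) := by
  classical
  have := Fintype.ofFinite ι
  have hsum : LinearMap.pi q = ∑ i, LinearMap.single k (fun _ : ι => N) i ∘ₗ q i := by
    refine LinearMap.ext fun x => funext fun j => ?_
    simp [Finset.sum_apply, Pi.single_apply]
  have h0 : (LinearMap.pi q).rTensor V y = 0 := by
    rw [hsum]
    change LinearMap.rTensorHom V _ y = 0
    rw [map_sum, LinearMap.sum_apply]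
    refine Finset.sum_eq_zero fun i _ => ?_
    rw [LinearMap.coe_rTensorHom, LinearMap.rTensor_comp, LinearMap.comp_apply, hy, map_zero]
  have hex := Module.Flat.rTensor_exact V (LinearMap.exact_subtype_ker_map (LinearMap.pi q))
  obtain ⟨z, hz⟩ := (hex y).1 h0
  rw [← LinearMap.ker_pi]
  exact ⟨z, hz⟩

noncomputable instance {M : Type*} [Monoid M] [Finite M] (e : Idem M) : Fintype (MaxSubgroup e) :=
  Fintype.ofFinite _

variable {k : Type*} [Field k] {M : Type*} [Monoid M] [Finite M] {e : Idem M}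
  {V : Type*} [AddCommGroup V] [Module k V] (σ : Representation k (MaxSubgroup e) V)

/-- The map `v ↦ |G_e|⁻¹ ∑ g⁻¹ ⊗ g v`. -/
noncomputable def casimir : V →ₗ[k] MonoidAlgebra k (MaxSubgroup e) ⊗[k] V :=
  (Nat.card (MaxSubgroup e) : k)⁻¹ •
    ∑ g : MaxSubgroup e, TensorProduct.mk k _ V (of k (MaxSubgroup e) g⁻¹) ∘ₗ σ g

lemma casimir_apply (v : V) : casimir σ v = (Nat.card (MaxSubgroup e) : k)⁻¹ •
    ∑ g : MaxSubgroup e, of k (MaxSubgroup e) g⁻¹ ⊗ₜ[k] σ g v := by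
  simp only [casimir, LinearMap.smul_apply, LinearMap.sum_apply, LinearMap.comp_apply,
    TensorProduct.mk_apply]

lemma casimir_asAlgebraHom (a : MonoidAlgebra k (MaxSubgroup e)) (v : V) :
    casimir σ (σ.asAlgebraHom a v) = (Nat.card (MaxSubgroup e) : k)⁻¹ •
      ∑ g : MaxSubgroup e, (a * of k (MaxSubgroup e) g⁻¹) ⊗ₜ[k] σ g v := by
  induction a using MonoidAlgebra.induction_on with
  | of h =>
    rw [σ.asAlgebraHom_of, casimir_apply]
    congr 1
    refine Fintype.sum_equiv (Equiv.mulRight h) _ _ fun g => ?_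
    rw [Equiv.coe_mulRight, ← map_mul, mul_inv_rev, mul_inv_cancel_left, map_mul,
      Module.End.mul_apply]
  | add a b ha hb =>
    simp only [map_add, LinearMap.add_apply, ha, hb, add_mul, TensorProduct.add_tmul,
      Finset.sum_add_distrib, smul_add]
  | smul c a ha =>
    rw [map_smul, LinearMap.smul_apply, map_smul, ha, smul_comm, Finset.smul_sum]
    simp only [smul_mul_assoc, TensorProduct.smul_tmul']

variable [RightFountain M]

/-- The operator `x ⊗ v ↦ |G_e|⁻¹ ∑ x g⁻¹ ⊗ g v`. -/
noncomputable def averaging : TildeModule k e ⊗[k] V →ₗ[k] TildeModule k e ⊗[k] V :=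
  (Nat.card (MaxSubgroup e) : k)⁻¹ •
    ∑ g : MaxSubgroup e, TensorProduct.map (lTildeRight k g⁻¹) (σ g)

lemma averaging_tmul (x : TildeModule k e) (v : V) :
    averaging σ (x ⊗ₜ v) = (Nat.card (MaxSubgroup e) : k)⁻¹ •
      ∑ g : MaxSubgroup e, lTildeRight k g⁻¹ x ⊗ₜ[k] σ g v := by
  simp only [averaging, LinearMap.smul_apply, LinearMap.sum_apply, TensorProduct.map_tmul]

lemma averaging_smul (m : M) (t : TildeModule k e ⊗[k] V) :
    averaging σ (TensorProduct.map (lTildeRep k e m) LinearMap.id t) =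
      TensorProduct.map (lTildeRep k e m) LinearMap.id (averaging σ t) := by
  induction t using TensorProduct.induction_on with
  | zero => simp only [map_zero]
  | add x y hx hy => rw [map_add, map_add, hx, hy, map_add, map_add]
  | tmul x v =>
    rw [TensorProduct.map_tmul, averaging_tmul, averaging_tmul, map_smul, map_sum]
    simp only [TensorProduct.map_tmul, LinearMap.id_apply, lTildeRep_right]

/-- The section `x ⊗ v ↦ |G_e|⁻¹ ∑ x g⁻¹ ⊗ g v` of the projection onto `k L̃_e ⊗_{k G_e} V`. -/
noncomputable def tildeSection : RepModule (tildeIndRep σ) →ₗ[k] TildeModule k e ⊗[k] V :=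
  (balancedRelations σ).liftQ (averaging σ) (by
    refine Submodule.span_le.2 ?_
    rintro _ ⟨h, x, v, rfl⟩
    rw [SetLike.mem_coe, LinearMap.mem_ker, map_sub, sub_eq_zero, averaging_tmul, averaging_tmul]
    congr 1
    refine Fintype.sum_equiv (Equiv.mulRight h⁻¹) _ _ fun g => ?_
    rw [← LinearMap.comp_apply, ← lTildeRight_mul, Equiv.coe_mulRight, mul_inv_rev, inv_inv,
      ← Module.End.mul_apply, ← map_mul, mul_assoc, inv_mul_cancel, mul_one]) ∘ₗ
    (RepModule.equiv (tildeIndRep σ)).toLinearMap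

lemma tildeSection_mk (t : TildeModule k e ⊗[k] V) :
    tildeSection σ (tildeIndMk σ t) = averaging σ t := rfl

lemma tildeSection_smul (m : M) (p : RepModule (tildeIndRep σ)) :
    tildeSection σ (of k M m • p) =
      TensorProduct.map (lTildeRep k e m) LinearMap.id (tildeSection σ p) := by
  obtain ⟨t, rfl⟩ := tildeIndMk_surjective σ p
  rw [of_smul_tildeIndMk, tildeSection_mk, tildeSection_mk, averaging_smul]

lemma tildeIndMk_averaging [NeZero (Nat.card (MaxSubgroup e) : k)]
    (t : TildeModule k e ⊗[k] V) : tildeIndMk σ (averaging σ t) = tildeIndMk σ t := by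
  induction t using TensorProduct.induction_on with
  | zero => simp only [map_zero]
  | add x y hx hy => rw [map_add, map_add, hx, hy, map_add]
  | tmul x v =>
    rw [averaging_tmul, map_smul, map_sum]
    have : ∀ g : MaxSubgroup e, tildeIndMk σ (lTildeRight k g⁻¹ x ⊗ₜ[k] σ g v) =
        tildeIndMk σ (x ⊗ₜ v) := fun g => by
      rw [tildeIndMk_right, ← Module.End.mul_apply, ← map_mul, inv_mul_cancel, map_one,
        Module.End.one_apply]
    simp only [this, Finset.sum_const, Finset.card_univ, ← Nat.card_eq_fintype_card]
    rw [← Nat.cast_smul_eq_nsmul k, inv_smul_smul₀ (NeZero.ne _)]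

lemma tildeIndMk_tildeSection [NeZero (Nat.card (MaxSubgroup e) : k)]
    (p : RepModule (tildeIndRep σ)) : tildeIndMk σ (tildeSection σ p) = p := by
  obtain ⟨t, rfl⟩ := tildeIndMk_surjective σ p
  rw [tildeSection_mk, tildeIndMk_averaging]

lemma rTensor_tildeSection (r : RClass e) (p : RepModule (tildeIndRep σ)) :
    (groupPart k ∘ₗ lTildeRep k e r.1).rTensor V (tildeSection σ p) =
      casimir σ (coindEval σ r (tildeToCoind σ p)) := by
  obtain ⟨t, rfl⟩ := tildeIndMk_surjective σ p
  induction t using TensorProduct.induction_on with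
  | zero => simp only [map_zero]
  | add x y hx hy => simp only [map_add, hx, hy]
  | tmul x v =>
    rw [coindEval_tildeToCoind, casimir_asAlgebraHom, tildeSection_mk, averaging_tmul, map_smul,
      map_sum]
    simp only [LinearMap.rTensor_tmul, LinearMap.comp_apply, lTildeRep_right, groupPart_right]

/-- The kernel of `k L̃_e ⊗_{k G_e} V → Coind_{G_e}(V)` comes from `rad(k L̃_e) ⊗ V`. -/
lemma tildeSection_mem {p : RepModule (tildeIndRep σ)} (hp : tildeToCoind σ p = 0) :
    tildeSection σ p ∈ Submodule.span k {t : TildeModule k e ⊗[k] V |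
      ∃ x ∈ radical (lTildeRep k e), ∃ v : V, t = x ⊗ₜ v} := by
  obtain ⟨z, hz⟩ := mem_range_rTensor_of_forall
    (fun r : RClass e => groupPart k ∘ₗ lTildeRep k e r.1) (y := tildeSection σ p) fun r => by
      rw [rTensor_tildeSection, hp, map_zero, map_zero]
  rw [← hz]
  clear hz
  induction z using TensorProduct.induction_on with
  | zero => rw [map_zero]; exact Submodule.zero_mem _
  | add x y hx hy => rw [map_add]; exact Submodule.add_mem _ hx hy
  | tmul x v =>
    refine Submodule.subset_span ⟨x.1, mem_radical_of_groupPart_eq_zero fun r => ?_, v, rfl⟩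
    exact (Submodule.mem_iInf _).1 x.2 r

end Section

/-! ### Linear maps to a coinduced module -/

section CoindHom

variable {k : Type*} [Field k] {M : Type*} [Monoid M] [Finite M] {f : Idem M}
  {W : Type*} [AddCommGroup W] [Module k W] {τ : Representation k (MaxSubgroup f) W}
  {C : Type*} [AddCommGroup C] [Module (MonoidAlgebra k M) C] [Module k C]
  [IsScalarTower k (MonoidAlgebra k M) C]

lemma coindHom_ext {k : Type*} [Field k] {M : Type*} [Monoid M] {f : Idem M}
    {W : Type*} [AddCommGroup W] [Module k W] {τ : Representation k (MaxSubgroup f) W}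
    {C : Type*} [AddCommGroup C] [Module (MonoidAlgebra k M) C]
    {α β : C →ₗ[MonoidAlgebra k M] RepModule (coindRep τ)}
    (h : ∀ c, coindEval τ (RClass.base f) (α c) = coindEval τ (RClass.base f) (β c)) : α = β :=
  LinearMap.ext fun c => coind_ext fun r => by
    rw [coindEval_eq_base r (α c), coindEval_eq_base r (β c), ← map_smul, ← map_smul, h]

/-- The `kM`-linear map `c ↦ (r ↦ γ(rc))` to `Coind_{G_f}(W)`, where `γ : C → W` is
`G_f`-equivariant and vanishes on `I(f) C`. -/
noncomputable def coindHom (γ : C →ₗ[k] W) (hg : ∀ (g : MaxSubgroup f) c,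
      γ (of k M g.toM • c) = τ g (γ c))
    (h0 : ∀ m ∈ nonDivisors f, ∀ c, γ (of k M m • c) = 0) :
    C →ₗ[MonoidAlgebra k M] RepModule (coindRep τ) :=
  homOfCommute
    { toFun := fun c => (RepModule.equiv (coindRep τ)).symm
        ⟨fun r => γ (of k M r.1 • c), fun g r => by
          rw [← hg, of_smul_of_smul]
          rfl⟩
      map_add' := fun c d => coind_ext fun r =>
        (congrArg γ (smul_add _ c d)).trans (map_add γ _ _)
      map_smul' := fun a c => coind_ext fun r =>
        (congrArg γ (smul_comm _ a c)).trans (map_smul γ _ _) } (by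
    intro m c
    refine coind_ext fun r => ?_
    by_cases hr : RRel (r.1 * m) f.1
    · rw [coindEval_of_smul (r' := ⟨r.1 * m, hr⟩) rfl]
      exact congrArg γ (of_smul_of_smul _ _ _)
    · rw [coindEval_of_smul_eq_zero hr]
      refine (congrArg γ (of_smul_of_smul _ _ _)).trans (h0 _ ?_ c)
      rw [rRel_iff_not_mem_nonDivisors (by rw [← mul_assoc, e_mul_of_rRel r.2]), not_not] at hr
      exact hr)

lemma coindEval_coindHom (γ : C →ₗ[k] W) (hg : ∀ (g : MaxSubgroup f) c,
      γ (of k M g.toM • c) = τ g (γ c))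
    (h0 : ∀ m ∈ nonDivisors f, ∀ c, γ (of k M m • c) = 0) (c : C) :
    coindEval τ (RClass.base f) (coindHom γ hg h0 c) = γ c := by
  have h1 := hg 1 c
  rw [MaxSubgroup.toM_one, map_one, Module.End.one_apply] at h1
  exact h1

end CoindHom

/-! ### Maps from the kernel of `k L̃_e ⊗_{k G_e} V → Coind_{G_e}(V)` to `Coind_{G_f}(W)` -/

section RadicalHoms

variable {k : Type*} [Field k] {M : Type*} [Monoid M] [Finite M] [RightFountain M] {e f : Idem M}
  {V : Type*} [AddCommGroup V] [Module k V] (σ : Representation k (MaxSubgroup e) V)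
  {W : Type*} [AddCommGroup W] [Module k W] (τ : Representation k (MaxSubgroup f) W)

/-- The left action of `m ∈ M` on `rad(k L̃_e)`. -/
noncomputable def radicalLeft (m : M) :
    radical (lTildeRep k e) →ₗ[k] radical (lTildeRep k e) :=
  (lTildeRep k e m).restrict fun _ hx => apply_mem_radical (lTildeRep k e) m hx

/-- The right action of `g ∈ G_e` on `rad(k L̃_e)`. -/
noncomputable def radicalRight (g : MaxSubgroup e) :
    radical (lTildeRep k e) →ₗ[k] radical (lTildeRep k e) :=
  (lTildeRight k g).restrict fun _ hx =>
    endo_mem_radical (lTildeRep k e) _ (fun m x => lTildeRep_right k m g x) hx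

/-- The space of the linear maps `γ : rad(k L̃_e) → Hom(V, W)` that vanish on `I(f) rad(k L̃_e)` and
satisfy `γ(gx) = g γ(x)` for `g ∈ G_f` and `γ(xh) = γ(x) h` for `h ∈ G_e`. -/
def radicalHoms : Submodule k (radical (lTildeRep k e) →ₗ[k] V →ₗ[k] W) where
  carrier := {γ | (∀ m ∈ nonDivisors f, ∀ x, γ (radicalLeft m x) = 0) ∧
    (∀ (g : MaxSubgroup f) x, γ (radicalLeft g.toM x) = τ g ∘ₗ γ x) ∧
    (∀ (h : MaxSubgroup e) x, γ (radicalRight h x) = γ x ∘ₗ σ h)}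
  zero_mem' := by
    refine ⟨fun _ _ _ => rfl, fun _ _ => ?_, fun _ _ => ?_⟩
    · rw [LinearMap.zero_apply, LinearMap.zero_apply, LinearMap.comp_zero]
    · rw [LinearMap.zero_apply, LinearMap.zero_apply, LinearMap.zero_comp]
  add_mem' := by
    rintro γ δ ⟨h1, h2, h3⟩ ⟨h1', h2', h3'⟩
    refine ⟨fun m hm x => ?_, fun g x => ?_, fun h x => ?_⟩
    · rw [LinearMap.add_apply, h1 m hm, h1' m hm, add_zero]
    · rw [LinearMap.add_apply, LinearMap.add_apply, h2, h2', LinearMap.comp_add]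
    · rw [LinearMap.add_apply, LinearMap.add_apply, h3, h3', LinearMap.add_comp]
  smul_mem' := by
    rintro c γ ⟨h1, h2, h3⟩
    refine ⟨fun m hm x => ?_, fun g x => ?_, fun h x => ?_⟩
    · rw [LinearMap.smul_apply, h1 m hm, smul_zero]
    · rw [LinearMap.smul_apply, LinearMap.smul_apply, h2, LinearMap.comp_smul]
    · rw [LinearMap.smul_apply, LinearMap.smul_apply, h3, LinearMap.smul_comp]

variable {σ τ}

lemma tildeIndMk_mem_ker (hrad : ∀ x ∈ radical (lTildeRep k e), ∀ r : RClass e,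
      groupPart k (lTildeRep k e r.1 x) = 0) (x : radical (lTildeRep k e)) (v : V) :
    tildeIndMk σ (x.1 ⊗ₜ v) ∈ LinearMap.ker (tildeToCoind σ) := by
  refine coind_ext fun r => ?_
  rw [coindEval_tildeToCoind, hrad x.1 x.2 r, map_zero, LinearMap.zero_apply, map_zero]

variable (σ) in
/-- The bilinear map `(x, v) ↦ x ⊗ v` from `rad(k L̃_e) × V` to the kernel of
`k L̃_e ⊗_{k G_e} V → Coind_{G_e}(V)`. -/
noncomputable def tmulKer (hrad : ∀ x ∈ radical (lTildeRep k e), ∀ r : RClass e,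
      groupPart k (lTildeRep k e r.1 x) = 0) :
    radical (lTildeRep k e) →ₗ[k] V →ₗ[k] LinearMap.ker (tildeToCoind σ) :=
  LinearMap.mk₂ k (fun x v => ⟨tildeIndMk σ (x.1 ⊗ₜ v), tildeIndMk_mem_ker hrad x v⟩)
    (fun x y v => Subtype.ext
      ((congrArg _ (TensorProduct.add_tmul x.1 y.1 v)).trans (map_add (tildeIndMk σ) _ _)))
    (fun c x v => Subtype.ext
      ((congrArg _ (TensorProduct.smul_tmul' c x.1 v).symm).trans (map_smul (tildeIndMk σ) _ _)))
    (fun x v w => Subtype.ext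
      ((congrArg _ (TensorProduct.tmul_add x.1 v w)).trans (map_add (tildeIndMk σ) _ _)))
    (fun c x v => Subtype.ext
      ((congrArg _ (TensorProduct.tmul_smul c x.1 v)).trans (map_smul (tildeIndMk σ) _ _)))

lemma tmulKer_left (hrad : ∀ x ∈ radical (lTildeRep k e), ∀ r : RClass e,
      groupPart k (lTildeRep k e r.1 x) = 0) (m : M) (x : radical (lTildeRep k e)) (v : V) :
    tmulKer σ hrad (radicalLeft m x) v = of k M m • tmulKer σ hrad x v :=
  Subtype.ext (of_smul_tildeIndMk_tmul σ m x.1 v).symm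

lemma tmulKer_right (hrad : ∀ x ∈ radical (lTildeRep k e), ∀ r : RClass e,
      groupPart k (lTildeRep k e r.1 x) = 0) (h : MaxSubgroup e) (x : radical (lTildeRep k e))
    (v : V) : tmulKer σ hrad (radicalRight h x) v = tmulKer σ hrad x (σ h v) :=
  Subtype.ext (tildeIndMk_right σ h x.1 v)

lemma compr₂_tmulKer_mem (hrad : ∀ x ∈ radical (lTildeRep k e), ∀ r : RClass e,
      groupPart k (lTildeRep k e r.1 x) = 0)
    (α : LinearMap.ker (tildeToCoind σ) →ₗ[MonoidAlgebra k M] RepModule (coindRep τ)) :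
    (tmulKer σ hrad).compr₂ (coindEval τ (RClass.base f) ∘ₗ α.restrictScalars k) ∈
      radicalHoms σ τ := by
  refine ⟨fun m hm x => LinearMap.ext fun v => ?_, fun g x => LinearMap.ext fun v => ?_,
    fun h x => LinearMap.ext fun v => ?_⟩
  · rw [LinearMap.compr₂_apply, tmulKer_left, LinearMap.comp_apply,
      LinearMap.restrictScalars_apply, map_smul, coind_smul_eq_zero_of_mem_nonDivisors hm,
      map_zero, LinearMap.zero_apply]
  · rw [LinearMap.compr₂_apply, tmulKer_left, LinearMap.comp_apply, LinearMap.comp_apply,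
      LinearMap.restrictScalars_apply, map_smul, coindEval_base_smul_group]
    rfl
  · rw [LinearMap.compr₂_apply, tmulKer_right]
    rfl

variable (σ τ) in
/-- A linear map `α` from the kernel of `k L̃_e ⊗_{k G_e} V → Coind_{G_e}(V)` to `Coind_{G_f}(W)`
determines `γ(x)(v) = α(x ⊗ v)(f)`. -/
noncomputable def kerHomToRadicalHoms (hrad : ∀ x ∈ radical (lTildeRep k e), ∀ r : RClass e,
      groupPart k (lTildeRep k e r.1 x) = 0) :
    (LinearMap.ker (tildeToCoind σ) →ₗ[MonoidAlgebra k M] RepModule (coindRep τ)) →ₗ[k]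
      radicalHoms σ τ where
  toFun α := ⟨_, compr₂_tmulKer_mem hrad α⟩
  map_add' α β := Subtype.ext (LinearMap.ext fun x => LinearMap.ext fun v =>
    map_add (coindEval τ (RClass.base f)) (α (tmulKer σ hrad x v)) (β (tmulKer σ hrad x v)))
  map_smul' c α := Subtype.ext (LinearMap.ext fun x => LinearMap.ext fun v =>
    map_smul (coindEval τ (RClass.base f)) c (α (tmulKer σ hrad x v)))

lemma kerHomToRadicalHoms_apply (hrad : ∀ x ∈ radical (lTildeRep k e), ∀ r : RClass e,
      groupPart k (lTildeRep k e r.1 x) = 0)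
    (α : LinearMap.ker (tildeToCoind σ) →ₗ[MonoidAlgebra k M] RepModule (coindRep τ))
    (x : radical (lTildeRep k e)) (v : V) :
    (kerHomToRadicalHoms σ τ hrad α).1 x v = coindEval τ (RClass.base f)
      (α (tmulKer σ hrad x v)) := rfl

lemma kerHomToRadicalHoms_injective [NeZero (Nat.card (MaxSubgroup e) : k)]
    (hrad : ∀ x ∈ radical (lTildeRep k e), ∀ r : RClass e,
      groupPart k (lTildeRep k e r.1 x) = 0) :
    Function.Injective (kerHomToRadicalHoms σ τ hrad) := by
  refine (injective_iff_map_eq_zero _).2 fun α hα => ?_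
  have hα' : ∀ (x : radical (lTildeRep k e)) (v : V), coindEval τ (RClass.base f)
      (α (tmulKer σ hrad x v)) = 0 := fun x v => by
    rw [← kerHomToRadicalHoms_apply, hα]
    rfl
  have key : ∀ t ∈ Submodule.span k {t : TildeModule k e ⊗[k] V |
      ∃ x ∈ radical (lTildeRep k e), ∃ v : V, t = x ⊗ₜ v},
      ∃ q : LinearMap.ker (tildeToCoind σ), q.1 = tildeIndMk σ t ∧
        coindEval τ (RClass.base f) (α q) = 0 := by
    intro t ht
    induction ht using Submodule.span_induction with
    | mem t ht =>
      obtain ⟨x, hx, v, rfl⟩ := ht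
      exact ⟨tmulKer σ hrad ⟨x, hx⟩ v, rfl, hα' ⟨x, hx⟩ v⟩
    | zero => exact ⟨0, (map_zero (tildeIndMk σ)).symm, by rw [map_zero, map_zero]⟩
    | add x y _ _ hx hy =>
      obtain ⟨p, hp, hp'⟩ := hx
      obtain ⟨q, hq, hq'⟩ := hy
      refine ⟨p + q, ?_, by rw [map_add, map_add, hp', hq', add_zero]⟩
      rw [map_add, ← hp, ← hq]
      rfl
    | smul c x _ hx =>
      obtain ⟨p, hp, hp'⟩ := hx
      refine ⟨c • p, ?_, ?_⟩
      · rw [map_smul, ← hp]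
        rfl
      · refine (congrArg _ ((α.restrictScalars k).map_smul c p)).trans ?_
        rw [map_smul, LinearMap.restrictScalars_apply, hp', smul_zero]
  refine coindHom_ext fun p => ?_
  rw [LinearMap.zero_apply, map_zero]
  obtain ⟨q, hq, h0⟩ := key _ (tildeSection_mem σ (LinearMap.mem_ker.1 p.2))
  rw [← h0]
  exact congrArg _ (congrArg α (Subtype.ext (hq.trans (tildeIndMk_tildeSection σ _)).symm))

/-- `γ` is extended to `k L̃_e` arbitrarily; then `α(p)(f) = γ(s(p))`, where `s` is the section
given by averaging over `G_e`. -/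
lemma kerHomToRadicalHoms_surjective [NeZero (Nat.card (MaxSubgroup e) : k)]
    (hrad : ∀ x ∈ radical (lTildeRep k e), ∀ r : RClass e,
      groupPart k (lTildeRep k e r.1 x) = 0) :
    Function.Surjective (kerHomToRadicalHoms σ τ hrad) := by
  rintro ⟨γ, h1, h2, h3⟩
  obtain ⟨γ', hγ'⟩ := LinearMap.exists_extend γ
  have hγ : ∀ x : radical (lTildeRep k e), γ' x.1 = γ x := fun x => LinearMap.congr_fun hγ' x
  let δ : TildeModule k e ⊗[k] V →ₗ[k] W := TensorProduct.lift γ'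
  have hδ : ∀ (m : M) (x : radical (lTildeRep k e)) (v : V),
      δ (TensorProduct.map (lTildeRep k e m) LinearMap.id (x.1 ⊗ₜ v)) =
        γ (radicalLeft m x) v := fun m x v => by
    rw [← hγ]
    exact TensorProduct.lift.tmul _ _
  have hδ0 : ∀ m ∈ nonDivisors f, ∀ p ∈ LinearMap.ker (tildeToCoind σ),
      δ (TensorProduct.map (lTildeRep k e m) LinearMap.id (tildeSection σ p)) = 0 := by
    intro m hm p hp
    have ht := tildeSection_mem σ (LinearMap.mem_ker.1 hp)
    generalize tildeSection σ p = t at ht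
    induction ht using Submodule.span_induction with
    | mem t ht =>
      obtain ⟨x, hx, v, rfl⟩ := ht
      rw [hδ m ⟨x, hx⟩ v, h1 m hm, LinearMap.zero_apply]
    | zero => rw [map_zero, map_zero]
    | add x y _ _ hx hy => rw [map_add, map_add, hx, hy, add_zero]
    | smul c x _ hx => rw [map_smul, map_smul, hx, smul_zero]
  have hδg : ∀ (g : MaxSubgroup f), ∀ p ∈ LinearMap.ker (tildeToCoind σ),
      δ (TensorProduct.map (lTildeRep k e g.toM) LinearMap.id (tildeSection σ p)) =
        τ g (δ (tildeSection σ p)) := by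
    intro g p hp
    have ht := tildeSection_mem σ (LinearMap.mem_ker.1 hp)
    generalize tildeSection σ p = t at ht
    induction ht using Submodule.span_induction with
    | mem t ht =>
      obtain ⟨x, hx, v, rfl⟩ := ht
      rw [hδ _ ⟨x, hx⟩ v, h2, LinearMap.comp_apply, ← hγ]
      exact congrArg (τ g) (TensorProduct.lift.tmul _ _).symm
    | zero => simp only [map_zero]
    | add x y _ _ hx hy => simp only [map_add, hx, hy]
    | smul c x _ hx => simp only [map_smul, hx]
  refine ⟨coindHom (δ ∘ₗ tildeSection σ ∘ₗ
      (LinearMap.ker (tildeToCoind σ)).subtype.restrictScalars k) (fun g p => ?_)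
      (fun m hm p => ?_), Subtype.ext (LinearMap.ext fun x => LinearMap.ext fun v => ?_)⟩
  · exact (congrArg δ (tildeSection_smul σ g.toM p.1)).trans (hδg g p.1 p.2)
  · exact (congrArg δ (tildeSection_smul σ m p.1)).trans (hδ0 m hm p.1 p.2)
  rw [kerHomToRadicalHoms_apply]
  refine (coindEval_coindHom _ _ _ _).trans ?_
  change δ (tildeSection σ (tildeIndMk σ (x.1 ⊗ₜ v))) = γ x v
  rw [tildeSection_mk, averaging_tmul, map_smul, map_sum]
  have : ∀ g : MaxSubgroup e, δ (lTildeRight k g⁻¹ x.1 ⊗ₜ[k] σ g v) = γ x v := fun g => by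
    have h : δ (lTildeRight k g⁻¹ x.1 ⊗ₜ[k] σ g v) = γ' (radicalRight g⁻¹ x).1 (σ g v) :=
      TensorProduct.lift.tmul _ _
    rw [h, hγ, h3, LinearMap.comp_apply, ← Module.End.mul_apply, ← map_mul, inv_mul_cancel,
      map_one, Module.End.one_apply]
  simp only [this, Finset.sum_const, Finset.card_univ, ← Nat.card_eq_fintype_card]
  rw [← Nat.cast_smul_eq_nsmul k, inv_smul_smul₀ (NeZero.ne _)]

end RadicalHoms

/-! ### `Ext¹` through a short exact sequence -/

section ExtOne

open CategoryTheory Abelian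

variable {A : Type w} [Ring A]

/-- `Ext¹_A(P, T) = 0` if all linear maps from the kernel of a projection `F → P`, with `F`
projective, to `T` extend to `F`. -/
lemma subsingleton_arrowSpace {F P T : Type w} [AddCommGroup F] [Module A F]
    [Module.Projective A F] [AddCommGroup P] [Module A P] [AddCommGroup T] [Module A T]
    (π : F →ₗ[A] P) (hπ : Function.Surjective π)
    (h : ∀ α : LinearMap.ker π →ₗ[A] T, ∃ β : F →ₗ[A] T,
      β ∘ₗ (LinearMap.ker π).subtype = α) : Subsingleton (ArrowSpace A P T) := by
  have hS := LinearMap.shortExact_shortComplexKer hπ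
  have hproj : Projective (ModuleCat.of A F) := (IsProjective.iff_projective F).1 inferInstance
  refine subsingleton_of_forall_eq 0 fun x => ?_
  obtain ⟨y, rfl⟩ := Ext.contravariant_sequence_exact₃ hS (ModuleCat.of A T) x
    (Ext.eq_zero_of_projective _) (add_zero 1)
  obtain ⟨a, rfl⟩ := Ext.mk₀_bijective _ _ |>.2 y
  obtain ⟨β, hβ⟩ := h a.hom
  have ha : a = π.shortComplexKer.f ≫ ModuleCat.ofHom β := ModuleCat.hom_ext hβ.symm
  rw [ha, ← Ext.mk₀_comp_mk₀, hS.extClass_comp_assoc]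

variable (k : Type u) [Field k] [Algebra k A]

/-- The connecting map `Hom_A(ker π, T) → Ext¹_A(S, T)`. -/
noncomputable def connectingHom {P S T : Type w} [AddCommGroup P] [Module A P] [AddCommGroup S]
    [Module A S] [AddCommGroup T] [Module A T] [Module k T] [IsScalarTower k A T]
    (π : P →ₗ[A] S) (hπ : Function.Surjective π) :
    (LinearMap.ker π →ₗ[A] T) →ₗ[k] ArrowSpace A S T where
  toFun α := (LinearMap.shortExact_shortComplexKer hπ).extClass.comp
    (Ext.mk₀ (ModuleCat.ofHom α)) (add_zero 1)
  map_add' α β := by rw [ModuleCat.ofHom_add, Ext.mk₀_add, Ext.comp_add]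
  map_smul' c α := by
    rw [RingHom.id_apply, ← Ext.comp_smul, ← Ext.mk₀_smul]
    refine congrArg (fun a => Ext.comp _ (Ext.mk₀ a) _)
      (ModuleCat.hom_ext (LinearMap.ext fun x => ?_))
    exact (algebraMap_smul A c (α x)).symm

lemma connectingHom_bijective {P S T : Type w} [AddCommGroup P] [Module A P] [AddCommGroup S]
    [Module A S] [AddCommGroup T] [Module A T] [Module k T] [IsScalarTower k A T]
    (π : P →ₗ[A] S) (hπ : Function.Surjective π) [Subsingleton (ArrowSpace A P T)]
    (h0 : ∀ β : P →ₗ[A] T, ∀ p ∈ LinearMap.ker π, β p = 0) :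
    Function.Bijective (connectingHom (T := T) k π hπ) := by
  have hS := LinearMap.shortExact_shortComplexKer hπ
  constructor
  · refine (injective_iff_map_eq_zero _).2 fun α hα => ?_
    obtain ⟨y, hy⟩ := Ext.contravariant_sequence_exact₁ hS (ModuleCat.of A T) _ (add_zero 1) hα
    obtain ⟨b, rfl⟩ := Ext.mk₀_bijective _ _ |>.2 y
    rw [Ext.mk₀_comp_mk₀] at hy
    have hb := (Ext.mk₀_bijective _ _).1 hy
    refine LinearMap.ext fun p => ?_
    have := LinearMap.congr_fun (congrArg ModuleCat.Hom.hom hb) p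
    exact this.symm.trans (h0 b.hom p.1 p.2)
  · intro x
    obtain ⟨y, rfl⟩ := Ext.contravariant_sequence_exact₃ hS (ModuleCat.of A T) x
      (Subsingleton.elim (α := ArrowSpace A P T) _ _) (add_zero 1)
    obtain ⟨a, rfl⟩ := Ext.mk₀_bijective _ _ |>.2 y
    exact ⟨a.hom, rfl⟩

end ExtOne

/-! ### Extending linear maps to a coinduced module -/

section ExtendToCoind

lemma exists_comp_eq_of_ker_le {k X Q W : Type*} [Field k] [AddCommGroup X] [Module k X]
    [AddCommGroup Q] [Module k Q] [AddCommGroup W] [Module k W] (φ : X →ₗ[k] Q) (γ : X →ₗ[k] W)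
    (h : LinearMap.ker φ ≤ LinearMap.ker γ) : ∃ δ : Q →ₗ[k] W, ∀ x, δ (φ x) = γ x := by
  obtain ⟨δ, hδ⟩ := LinearMap.exists_extend
    ((LinearMap.ker φ).liftQ γ h ∘ₗ φ.quotKerEquivRange.symm.toLinearMap)
  refine ⟨δ, fun x => ?_⟩
  have := LinearMap.congr_fun hδ ⟨φ x, x, rfl⟩
  refine this.trans ?_
  exact congrArg ((LinearMap.ker φ).liftQ γ h)
    (LinearMap.quotKerEquivRange_symm_apply_image φ x (LinearMap.mem_range_self φ x))

variable {k : Type*} [Field k] {M : Type*} [Monoid M] [Finite M] {f : Idem M}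
  {W : Type*} [AddCommGroup W] [Module k W] {τ : Representation k (MaxSubgroup f) W}
  {C : Type*} [AddCommGroup C] [Module (MonoidAlgebra k M) C] [Module k C]
  [IsScalarTower k (MonoidAlgebra k M) C]

/-- If `Z ∩ I(f) C = I(f) Z`, the linear maps from `Z` to `Coind_{G_f}(W)` extend to `C`: the
corresponding map `Z → W` extends to a linear map that vanishes on `I(f) C`, and the average of
the latter over `G_f` is equivariant. -/
lemma exists_extend_to_coind [NeZero (Nat.card (MaxSubgroup f) : k)]
    (Z : Submodule (MonoidAlgebra k M) C)
    (hZ : ∀ z ∈ Z, z ∈ Submodule.span k {y | ∃ m ∈ nonDivisors f, ∃ c : C, y = of k M m • c} →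
      z ∈ Submodule.span k {y | ∃ m ∈ nonDivisors f, ∃ c ∈ Z, y = of k M m • c})
    (α : Z →ₗ[MonoidAlgebra k M] RepModule (coindRep τ)) :
    ∃ β : C →ₗ[MonoidAlgebra k M] RepModule (coindRep τ), β ∘ₗ Z.subtype = α := by
  let N : Submodule k C := Submodule.span k {y | ∃ m ∈ nonDivisors f, ∃ c : C, y = of k M m • c}
  have hN : ∀ m ∈ nonDivisors f, ∀ c : C, of k M m • c ∈ N := fun m hm c =>
    Submodule.subset_span ⟨m, hm, c, rfl⟩
  let γ : Z →ₗ[k] W := coindEval τ (RClass.base f) ∘ₗ α.restrictScalars k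
  have hker : LinearMap.ker (N.mkQ ∘ₗ Z.subtype.restrictScalars k) ≤ LinearMap.ker γ := by
    intro z hz
    have hzN : z.1 ∈ N := (Submodule.Quotient.mk_eq_zero N).1 hz
    have key : ∀ y ∈ Submodule.span k {y | ∃ m ∈ nonDivisors f, ∃ c ∈ Z, y = of k M m • c},
        ∃ z : Z, z.1 = y ∧ γ z = 0 := by
      intro y hy
      induction hy using Submodule.span_induction with
      | mem y hy =>
        obtain ⟨m, hm, c, hc, rfl⟩ := hy
        refine ⟨of k M m • ⟨c, hc⟩, rfl, ?_⟩
        change coindEval τ (RClass.base f) (α (of k M m • ⟨c, hc⟩)) = 0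
        rw [map_smul, coind_smul_eq_zero_of_mem_nonDivisors hm, map_zero]
      | zero => exact ⟨0, rfl, map_zero γ⟩
      | add x y _ _ hx hy =>
        obtain ⟨x, rfl, hx⟩ := hx
        obtain ⟨y, rfl, hy⟩ := hy
        exact ⟨x + y, rfl, by rw [map_add, hx, hy, add_zero]⟩
      | smul c x _ hx =>
        obtain ⟨x, rfl, hx⟩ := hx
        exact ⟨c • x, rfl, by rw [map_smul, hx, smul_zero]⟩
    obtain ⟨z', hz', h0⟩ := key z.1 (hZ z.1 z.2 hzN)
    rwa [LinearMap.mem_ker, ← Subtype.ext hz']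
  obtain ⟨δ, hδ⟩ := exists_comp_eq_of_ker_le _ γ hker
  let ε : C →ₗ[k] W := (Nat.card (MaxSubgroup f) : k)⁻¹ • ∑ g : MaxSubgroup f,
    τ g⁻¹ ∘ₗ δ ∘ₗ N.mkQ ∘ₗ Module.toModuleEnd k (S := MonoidAlgebra k M) C (of k M g.toM)
  have hε : ∀ c, ε c = (Nat.card (MaxSubgroup f) : k)⁻¹ • ∑ g : MaxSubgroup f,
      τ g⁻¹ (δ (N.mkQ (of k M g.toM • c))) := fun c => by
    simp only [ε, LinearMap.smul_apply, LinearMap.sum_apply, LinearMap.comp_apply]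
    rfl
  have hεg : ∀ (h : MaxSubgroup f) c, ε (of k M h.toM • c) = τ h (ε c) := fun h c => by
    rw [hε, hε, map_smul, map_sum]
    congr 1
    refine Fintype.sum_equiv (Equiv.mulRight h) _ _ fun g => ?_
    rw [Equiv.coe_mulRight, of_smul_of_smul, mul_inv_rev, ← MaxSubgroup.toM_mul,
      ← Module.End.mul_apply (τ h), ← map_mul, mul_inv_cancel_left]
  have hε0 : ∀ m ∈ nonDivisors f, ∀ c, ε (of k M m • c) = 0 := fun m hm c => by
    rw [hε]
    have : ∀ g : MaxSubgroup f, N.mkQ (of k M g.toM • of k M m • c) = 0 := fun g => by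
      rw [of_smul_of_smul]
      exact (Submodule.Quotient.mk_eq_zero N).2 (hN _ (mul_mem_nonDivisors _ hm) c)
    simp only [this, map_zero, Finset.sum_const_zero, smul_zero]
  refine ⟨coindHom ε hεg hε0, coindHom_ext fun z => ?_⟩
  · refine (coindEval_coindHom ε hεg hε0 z.1).trans ?_
    change ε z.1 = γ z
    have : ∀ g : MaxSubgroup f, τ g⁻¹ (δ (N.mkQ (of k M g.toM • z.1))) = γ z := fun g => by
      refine (congrArg (τ g⁻¹) (hδ (of k M g.toM • z))).trans ?_
      change τ g⁻¹ (coindEval τ (RClass.base f) (α (of k M g.toM • z))) = _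
      rw [map_smul, coindEval_base_smul_group, ← Module.End.mul_apply, ← map_mul, inv_mul_cancel,
        map_one, Module.End.one_apply]
      rfl
    simp only [hε, this, Finset.sum_const, Finset.card_univ, ← Nat.card_eq_fintype_card]
    rw [← Nat.cast_smul_eq_nsmul k, inv_smul_smul₀ (NeZero.ne _)]

end ExtendToCoind

/-! ### The vanishing of `Ext¹(k L̃_e ⊗_{k G_e} V, Coind_{G_f}(W))` -/

section Vanishing

/-- The linear map from `k L̃_e` to `kM` given by the inclusion of `L̃_e` in `M`. -/
noncomputable def tildeInclusion (k : Type*) {M : Type*} [Field k] [Monoid M] (e : Idem M) :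
    TildeModule k e →ₗ[k] MonoidAlgebra k M :=
  (tildeBasis k e).constr k fun x => of k M x.1

lemma tildeInclusion_basis {k M : Type*} [Field k] [Monoid M] {e : Idem M} (x : LTilde e) :
    tildeInclusion k e (tildeBasis k e x) = of k M x.1 :=
  Module.Basis.constr_basis _ _ _ _

variable {k : Type*} [Field k] {M : Type*} [Monoid M] [Finite M] [RightFountain M] {e : Idem M}
  {V : Type*} [AddCommGroup V] [Module k V] (σ : Representation k (MaxSubgroup e) V)

/-- The projection from `kM ⊗ V` onto `k L̃_e ⊗_{k G_e} V` that sends `1 ⊗ v` to `e ⊗ v`. -/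
noncomputable def freeCover :
    MonoidAlgebra k M ⊗[k] V →ₗ[MonoidAlgebra k M] RepModule (tildeIndRep σ) :=
  TensorProduct.AlgebraTensorModule.lift (LinearMap.toSpanSingleton (MonoidAlgebra k M) _
    (tildeIndMk σ ∘ₗ TensorProduct.mk k _ V (tildeBasis k e (LTilde.base e))))

lemma freeCover_tmul (m : M) (v : V) : freeCover σ (of k M m ⊗ₜ v) =
    tildeIndMk σ (lTildeRep k e m (tildeBasis k e (LTilde.base e)) ⊗ₜ v) := by
  rw [← of_smul_tildeIndMk_tmul]
  exact TensorProduct.AlgebraTensorModule.lift_tmul _ _ _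

lemma freeCover_tildeInclusion (t : TildeModule k e ⊗[k] V) :
    freeCover σ ((tildeInclusion k e).rTensor V t) = tildeIndMk σ t := by
  suffices h : (freeCover σ).restrictScalars k ∘ₗ (tildeInclusion k e).rTensor V = tildeIndMk σ
    from LinearMap.congr_fun h t
  refine TensorProduct.ext (LinearMap.ext fun x => LinearMap.ext fun v => ?_)
  change freeCover σ (tildeInclusion k e x ⊗ₜ v) = tildeIndMk σ (x ⊗ₜ v)
  suffices h : (freeCover σ).restrictScalars k ∘ₗ
      (TensorProduct.mk k (MonoidAlgebra k M) V).flip v ∘ₗ tildeInclusion k e =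
      tildeIndMk σ ∘ₗ (TensorProduct.mk k (TildeModule k e) V).flip v from LinearMap.congr_fun h x
  refine (tildeBasis k e).ext fun x => ?_
  change freeCover σ (tildeInclusion k e (tildeBasis k e x) ⊗ₜ v) =
    tildeIndMk σ (tildeBasis k e x ⊗ₜ v)
  rw [tildeInclusion_basis, freeCover_tmul, lTildeRep_base]

lemma freeCover_surjective : Function.Surjective (freeCover σ) := fun p => by
  obtain ⟨t, rfl⟩ := tildeIndMk_surjective σ p
  exact ⟨_, freeCover_tildeInclusion σ t⟩

/-- The linear section of `freeCover` given by averaging over `G_e`. -/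
noncomputable def freeSection : RepModule (tildeIndRep σ) →ₗ[k] MonoidAlgebra k M ⊗[k] V :=
  (tildeInclusion k e).rTensor V ∘ₗ tildeSection σ

lemma freeCover_freeSection [NeZero (Nat.card (MaxSubgroup e) : k)]
    (p : RepModule (tildeIndRep σ)) : freeCover σ (freeSection σ p) = p := by
  rw [freeSection, LinearMap.comp_apply, freeCover_tildeInclusion, tildeIndMk_tildeSection]

lemma freeSection_tmul (x : LTilde e) (v : V) :
    freeSection σ (tildeIndMk σ (tildeBasis k e x ⊗ₜ v)) = (Nat.card (MaxSubgroup e) : k)⁻¹ •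
      ∑ g : MaxSubgroup e, of k M (x.1 * (g⁻¹).toM) ⊗ₜ[k] σ g v := by
  rw [freeSection, LinearMap.comp_apply, tildeSection_mk, averaging_tmul, map_smul, map_sum]
  simp only [LinearMap.rTensor_tmul, lTildeRight_basis, tildeInclusion_basis]
  rfl

/-- On `I(f)(kM ⊗ V)`, the operator `t ↦ t - s(π(t))`, where `π` is the projection and `s` its
section, takes values in `I(f) ker π`. -/
lemma sub_freeSection_mem [NeZero (Nat.card (MaxSubgroup e) : k)] {f : Idem M} {m : M}
    (hm : m ∈ nonDivisors f) (v : V) :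
    of k M m ⊗ₜ v - freeSection σ (freeCover σ (of k M m ⊗ₜ v)) ∈ Submodule.span k
      {y | ∃ m ∈ nonDivisors f, ∃ c ∈ LinearMap.ker (freeCover σ), y = of k M m • c} := by
  have hsmul : ∀ (m n : M) (v : V),
      of k M m • (of k M n ⊗ₜ[k] v) = of k M (m * n) ⊗ₜ[k] v := fun m n v => by
    rw [TensorProduct.smul_tmul', smul_eq_mul, ← map_mul]
  by_cases h : LTildeRel (m * e.1) e.1
  · -- here `s(π(m ⊗ v)) = m s(π(1 ⊗ v))`
    have hz : of k M 1 ⊗ₜ v - freeSection σ (freeCover σ (of k M 1 ⊗ₜ v)) ∈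
        LinearMap.ker (freeCover σ) := by
      rw [LinearMap.mem_ker, map_sub, freeCover_freeSection, sub_self]
    refine Submodule.subset_span ⟨m, hm, _, hz, Eq.symm ?_⟩
    rw [smul_sub, hsmul, mul_one, freeCover_tmul, freeCover_tmul, map_one (lTildeRep k e),
      Module.End.one_apply, lTildeRep_basis, tildeSmul_of_mem k (y := ⟨m * e.1, h⟩) rfl,
      freeSection_tmul, freeSection_tmul, smul_comm, Finset.smul_sum]
    simp only [hsmul, mul_assoc]
    rfl
  · -- here `me = mea` with `a ⊗ v` in the kernel, since `M` is right Fountain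
    obtain ⟨a, ha, hae, ha'⟩ := exists_idem_of_not_lTildeRel (by rw [mul_assoc, e.2]) h
    have h0 : ∀ n : M, ¬ LTildeRel (n * e.1) e.1 → freeCover σ (of k M n ⊗ₜ v) = 0 :=
      fun n hn => by
        rw [freeCover_tmul, lTildeRep_basis, tildeSmul_of_not_mem k hn, TensorProduct.zero_tmul,
          map_zero]
    have hz : of k M 1 ⊗ₜ v - of k M e.1 ⊗ₜ v ∈ LinearMap.ker (freeCover σ) := by
      rw [LinearMap.mem_ker, map_sub, freeCover_tmul, freeCover_tmul, map_one (lTildeRep k e),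
        Module.End.one_apply, sub_eq_zero]
      exact congrArg (fun x => tildeIndMk σ (x ⊗ₜ v)) (lTildeRep_base (LTilde.base e)).symm
    have hz' : of k M a ⊗ₜ v ∈ LinearMap.ker (freeCover σ) := h0 a (by rwa [hae])
    rw [h0 m h, map_zero, sub_zero]
    have hdecomp : of k M m ⊗ₜ[k] v = of k M m • (of k M 1 ⊗ₜ v - of k M e.1 ⊗ₜ v) +
        of k M (m * e.1) • (of k M a ⊗ₜ v) := by
      rw [smul_sub, hsmul, hsmul, hsmul, mul_one, ha, sub_add_cancel]
    rw [hdecomp]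
    exact Submodule.add_mem _ (Submodule.subset_span ⟨m, hm, _, hz, rfl⟩)
      (Submodule.subset_span ⟨_, mul_mem_nonDivisors_right hm _, _, hz', rfl⟩)

/-- The kernel `Z` of the projection `kM ⊗ V → k L̃_e ⊗_{k G_e} V` meets `I(f)(kM ⊗ V)` in
`I(f) Z`. -/
lemma mem_span_of_mem_ker_freeCover [NeZero (Nat.card (MaxSubgroup e) : k)] {f : Idem M}
    {z : MonoidAlgebra k M ⊗[k] V} (hz : z ∈ LinearMap.ker (freeCover σ))
    (hz' : z ∈ Submodule.span k
      {y | ∃ m ∈ nonDivisors f, ∃ c : MonoidAlgebra k M ⊗[k] V, y = of k M m • c}) :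
    z ∈ Submodule.span k
      {y | ∃ m ∈ nonDivisors f, ∃ c ∈ LinearMap.ker (freeCover σ), y = of k M m • c} := by
  suffices h : z - freeSection σ (freeCover σ z) ∈ Submodule.span k
      {y | ∃ m ∈ nonDivisors f, ∃ c ∈ LinearMap.ker (freeCover σ), y = of k M m • c} by
    rwa [LinearMap.mem_ker.1 hz, map_zero, sub_zero] at h
  clear hz
  have hadd : ∀ x y : MonoidAlgebra k M ⊗[k] V,
      x + y - freeSection σ (freeCover σ (x + y)) =
        (x - freeSection σ (freeCover σ x)) + (y - freeSection σ (freeCover σ y)) :=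
    fun x y => by rw [map_add, map_add, add_sub_add_comm]
  have hsmul : ∀ (c : k) (x : MonoidAlgebra k M ⊗[k] V),
      c • x - freeSection σ (freeCover σ (c • x)) =
        c • (x - freeSection σ (freeCover σ x)) := fun c x => by
    rw [smul_sub, ← map_smul]
    exact congrArg (fun p => c • x - freeSection σ p)
      (((freeCover σ).restrictScalars k).map_smul c x)
  induction hz' using Submodule.span_induction with
  | mem z hz =>
    obtain ⟨m, hm, c, rfl⟩ := hz
    induction c using TensorProduct.induction_on with
    | zero => rw [smul_zero, map_zero, map_zero, sub_zero]; exact Submodule.zero_mem _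
    | add x y hx hy => rw [smul_add, hadd]; exact Submodule.add_mem _ hx hy
    | tmul a v =>
      rw [TensorProduct.smul_tmul', smul_eq_mul]
      induction a using MonoidAlgebra.induction_on with
      | of n =>
        rw [← map_mul]
        exact sub_freeSection_mem σ (mul_mem_nonDivisors_right hm n) v
      | add a b ha hb =>
        rw [mul_add, TensorProduct.add_tmul, hadd]
        exact Submodule.add_mem _ ha hb
      | smul c a ha =>
        rw [mul_smul_comm, ← TensorProduct.smul_tmul', hsmul]
        exact Submodule.smul_mem _ c ha
  | zero => rw [map_zero, map_zero, sub_zero]; exact Submodule.zero_mem _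
  | add x y _ _ hx hy => rw [hadd]; exact Submodule.add_mem _ hx hy
  | smul c x _ hx => rw [hsmul]; exact Submodule.smul_mem _ c hx

variable {σ} in
/-- A linear map from `k L̃_e ⊗_{k G_e} V` to a simple module vanishes on the kernel of the
projection onto `Coind_{G_e}(V)`, which comes from `rad(k L̃_e) ⊗ V`. -/
lemma apply_eq_zero_of_tildeToCoind_eq_zero [NeZero (Nat.card (MaxSubgroup e) : k)]
    {S : Type*} [AddCommGroup S] [Module (MonoidAlgebra k M) S]
    [Module k S] [IsScalarTower k (MonoidAlgebra k M) S] [IsSimpleModule (MonoidAlgebra k M) S]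
    (β : RepModule (tildeIndRep σ) →ₗ[MonoidAlgebra k M] S) {p : RepModule (tildeIndRep σ)}
    (hp : tildeToCoind σ p = 0) : β p = 0 := by
  rw [← tildeIndMk_tildeSection σ p]
  have ht := tildeSection_mem σ hp
  generalize tildeSection σ p = t at ht
  induction ht using Submodule.span_induction with
  | mem t ht =>
    obtain ⟨x, hx, v, rfl⟩ := ht
    exact apply_eq_zero_of_mem_radical (β ∘ₗ tmulRight σ v) hx
  | zero => rw [map_zero, map_zero]
  | add x y _ _ hx hy => rw [map_add, map_add, hx, hy, add_zero]
  | smul c x _ hx =>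
    rw [map_smul]
    refine ((β.restrictScalars k).map_smul c _).trans ?_
    rw [LinearMap.restrictScalars_apply, hx, smul_zero]

end Vanishing

/-! ### `Ext¹` between coinduced modules -/

section ExtCoind

variable {k : Type u} [Field k] {M : Type v} [Monoid M] [Finite M] [RightFountain M] {e f : Idem M}
  {V : Type (max u v)} [AddCommGroup V] [Module k V] (σ : Representation k (MaxSubgroup e) V)
  {W : Type (max u v)} [AddCommGroup W] [Module k W] (τ : Representation k (MaxSubgroup f) W)

/-- `Ext¹(Coind_{G_e}(V), Coind_{G_f}(W))` is isomorphic to the space of the linear maps from the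
kernel of `k L̃_e ⊗_{k G_e} V → Coind_{G_e}(V)` to `Coind_{G_f}(W)`. -/
lemma nonempty_ker_hom_equiv_arrowSpace [NeZero (Nat.card (MaxSubgroup e) : k)]
    [NeZero (Nat.card (MaxSubgroup f) : k)] [Nontrivial V]
    [IsSimpleModule (MonoidAlgebra k M) (RepModule (coindRep σ))]
    [IsSimpleModule (MonoidAlgebra k M) (RepModule (coindRep τ))] :
    Nonempty ((LinearMap.ker (tildeToCoind σ) →ₗ[MonoidAlgebra k M] RepModule (coindRep τ)) ≃ₗ[k]
      ArrowSpace (MonoidAlgebra k M) (RepModule (coindRep σ)) (RepModule (coindRep τ))) := by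
  have : Subsingleton (ArrowSpace (MonoidAlgebra k M) (RepModule (tildeIndRep σ))
      (RepModule (coindRep τ))) :=
    subsingleton_arrowSpace (freeCover σ) (freeCover_surjective σ) fun α =>
      exists_extend_to_coind _ (fun _ hz hz' => mem_span_of_mem_ker_freeCover σ hz hz') α
  exact ⟨LinearEquiv.ofBijective _ (connectingHom_bijective k (tildeToCoind σ)
    (tildeToCoind_surjective σ) fun β _ hp => apply_eq_zero_of_tildeToCoind_eq_zero β hp)⟩

end ExtCoind

/-! ### Maps from `f rad(k L̃_e) / f I(f) rad(k L̃_e)` to `W ⊗ D(V)` -/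

section ArrowHoms

variable {k : Type*} [Field k] {M : Type*} [Monoid M] [Finite M] [RightFountain M] {e f : Idem M}
  {V : Type*} [AddCommGroup V] [Module k V] (σ : Representation k (MaxSubgroup e) V)
  {W : Type*} [AddCommGroup W] [Module k W] (τ : Representation k (MaxSubgroup f) W)

variable (k e f) in
/-- The map from `rad(k L̃_e)` to `f rad(k L̃_e) / f I(f) rad(k L̃_e)` that sends `x` to the class
of `fx`. -/
noncomputable def arrowMk : radical (lTildeRep k e) →ₗ[k] RepModule (arrowRep k f e) :=
  (RepModule.equiv (arrowRep k f e)).symm.toLinearMap ∘ₗ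
    ((fIRad k f e).submoduleOf (fRad k f e)).mkQ ∘ₗ
    (lTildeRep k e f.1).restrict fun _ hx => Submodule.mem_map_of_mem hx

lemma arrowMk_surjective : Function.Surjective (arrowMk k e f) := by
  intro q
  obtain ⟨⟨_, x, hx, rfl⟩, hq⟩ := Submodule.Quotient.mk_surjective _ (RepModule.equiv _ q)
  exact ⟨⟨x, hx⟩, hq⟩

lemma arrowMk_of_mem_nonDivisors {m : M} (hm : m ∈ nonDivisors f) (x : radical (lTildeRep k e)) :
    arrowMk k e f (radicalLeft m x) = 0 :=
  (Submodule.Quotient.mk_eq_zero _).2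
    ⟨_, Submodule.subset_span ⟨m, hm, x.1, x.2, rfl⟩, rfl⟩

lemma of_smul_arrowMk (g : MaxSubgroup f) (h : MaxSubgroup e) (x : radical (lTildeRep k e)) :
    of k _ (g, h) • arrowMk k e f x = arrowMk k e f (radicalLeft g.toM (radicalRight h⁻¹ x)) := by
  rw [RepModule.of_smul]
  refine congrArg (fun y => (RepModule.equiv (arrowRep k f e)).symm (Submodule.Quotient.mk y))
    (Subtype.ext ?_)
  exact biAct_lTildeRep k (g, h) x.1

/-- An element of `rad(k L̃_e)` with class zero is killed by all `γ` in the space `radicalHoms`. -/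
lemma apply_eq_zero_of_arrowMk_eq_zero {σ : Representation k (MaxSubgroup e) V}
    {τ : Representation k (MaxSubgroup f) W} {γ : radical (lTildeRep k e) →ₗ[k] V →ₗ[k] W}
    (hγ : γ ∈ radicalHoms σ τ) {x : radical (lTildeRep k e)} (hx : arrowMk k e f x = 0) :
    γ x = 0 := by
  obtain ⟨h1, h2, h3⟩ := hγ
  have hf : ∀ x, γ (radicalLeft f.1 x) = γ x := fun x => by
    have := h2 1 x
    rwa [MaxSubgroup.toM_one, map_one, Module.End.one_eq_id, LinearMap.id_comp] at this
  obtain ⟨y, hy, hyx⟩ := (Submodule.Quotient.mk_eq_zero _).1 hx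
  have key : ∀ y ∈ setSmul (lTildeRep k e) (nonDivisors f) (radical (lTildeRep k e)),
      ∃ z : radical (lTildeRep k e), z.1 = y ∧ γ z = 0 := by
    intro y hy
    induction hy using Submodule.span_induction with
    | mem y hy =>
      obtain ⟨m, hm, u, hu, rfl⟩ := hy
      exact ⟨radicalLeft m ⟨u, hu⟩, rfl, h1 m hm _⟩
    | zero => exact ⟨0, rfl, map_zero γ⟩
    | add x y _ _ hx hy =>
      obtain ⟨x, rfl, hx⟩ := hx
      obtain ⟨y, rfl, hy⟩ := hy
      exact ⟨x + y, rfl, by rw [map_add, hx, hy, add_zero]⟩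
    | smul c x _ hx =>
      obtain ⟨x, rfl, hx⟩ := hx
      exact ⟨c • x, rfl, by rw [map_smul, hx, smul_zero]⟩
  obtain ⟨z, rfl, hz⟩ := key y hy
  have hzx : radicalLeft f.1 z = radicalLeft f.1 x := Subtype.ext hyx
  rw [← hf x, ← hzx, hf z, hz]

variable [Module.Finite k V]

lemma compr₂_arrowMk_mem (T : RepModule (arrowRep k f e) →ₗ[MonoidAlgebra k
      (MaxSubgroup f × MaxSubgroup e)] RepModule (outerTensorDual τ σ)) :
    (tensorDualEquiv k W V).toLinearMap ∘ₗ (RepModule.equiv (outerTensorDual τ σ)).toLinearMap ∘ₗ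
      T.restrictScalars k ∘ₗ arrowMk k e f ∈ radicalHoms σ τ := by
  have key : ∀ (g : MaxSubgroup f) (h : MaxSubgroup e) (x : radical (lTildeRep k e)),
      tensorDualEquiv k W V (RepModule.equiv (outerTensorDual τ σ)
        (T (arrowMk k e f (radicalLeft g.toM (radicalRight h⁻¹ x))))) =
      τ g ∘ₗ tensorDualEquiv k W V (RepModule.equiv (outerTensorDual τ σ)
        (T (arrowMk k e f x))) ∘ₗ σ h⁻¹ := fun g h x => by
    rw [← of_smul_arrowMk, map_smul, RepModule.of_smul, LinearEquiv.apply_symm_apply,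
      tensorDualEquiv_outerTensorDual]
  have hone : ∀ x : radical (lTildeRep k e), radicalRight (1 : MaxSubgroup e) x = x := fun x =>
    Subtype.ext (LinearMap.congr_fun (lTildeRight_one k) x.1)
  have hf : ∀ x : radical (lTildeRep k e), arrowMk k e f (radicalLeft f.1 x) = arrowMk k e f x :=
    fun x => congrArg (fun y => (RepModule.equiv (arrowRep k f e)).symm (Submodule.Quotient.mk y))
      (Subtype.ext ((lTildeRep_lTildeRep k f.1 f.1 x.1).trans (by rw [f.2]; rfl)))
  refine ⟨fun m hm x => ?_, fun g x => ?_, fun h x => ?_⟩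
  · simp only [LinearMap.comp_apply, arrowMk_of_mem_nonDivisors hm, map_zero]
  · have := key g 1 x
    rw [inv_one, hone, map_one σ, Module.End.one_eq_id, LinearMap.comp_id] at this
    exact this
  · have := key 1 h⁻¹ x
    rw [inv_inv, MaxSubgroup.toM_one, hf, map_one τ, Module.End.one_eq_id,
      LinearMap.id_comp] at this
    exact this

/-- A `k[G_f × G_e]`-linear map `T` to `W ⊗ D(V) = Hom(V, W)` determines `γ(x) = T(fx)`. -/
noncomputable def arrowHomToRadicalHoms :
    (RepModule (arrowRep k f e) →ₗ[MonoidAlgebra k (MaxSubgroup f × MaxSubgroup e)]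
      RepModule (outerTensorDual τ σ)) →ₗ[k] radicalHoms σ τ where
  toFun T := ⟨_, compr₂_arrowMk_mem σ τ T⟩
  map_add' S T := Subtype.ext (LinearMap.ext fun x =>
    map_add (tensorDualEquiv k W V) (RepModule.equiv (outerTensorDual τ σ) (S (arrowMk k e f x)))
      (RepModule.equiv (outerTensorDual τ σ) (T (arrowMk k e f x))))
  map_smul' c T := Subtype.ext (LinearMap.ext fun x =>
    map_smul (tensorDualEquiv k W V) c
      (RepModule.equiv (outerTensorDual τ σ) (T (arrowMk k e f x))))

lemma arrowHomToRadicalHoms_apply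
    (T : RepModule (arrowRep k f e) →ₗ[MonoidAlgebra k (MaxSubgroup f × MaxSubgroup e)]
      RepModule (outerTensorDual τ σ)) (x : radical (lTildeRep k e)) :
    (arrowHomToRadicalHoms σ τ T).1 x =
      tensorDualEquiv k W V (RepModule.equiv (outerTensorDual τ σ) (T (arrowMk k e f x))) := rfl

lemma arrowHomToRadicalHoms_bijective : Function.Bijective (arrowHomToRadicalHoms σ τ) := by
  constructor
  · refine fun S T hST => LinearMap.ext fun q => ?_
    obtain ⟨x, rfl⟩ := arrowMk_surjective q
    have h := LinearMap.congr_fun (congrArg Subtype.val hST) x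
    rw [arrowHomToRadicalHoms_apply, arrowHomToRadicalHoms_apply] at h
    exact (RepModule.equiv (outerTensorDual τ σ)).injective ((tensorDualEquiv k W V).injective h)
  · rintro ⟨γ, hγ⟩
    obtain ⟨δ, hδ⟩ := exists_comp_eq_of_ker_le (arrowMk k e f) γ
      fun x hx => apply_eq_zero_of_arrowMk_eq_zero hγ hx
    refine ⟨homOfCommute ((RepModule.equiv (outerTensorDual τ σ)).symm.toLinearMap ∘ₗ
      (tensorDualEquiv k W V).symm.toLinearMap ∘ₗ δ) ?_, Subtype.ext (LinearMap.ext fun x => ?_)⟩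
    · rintro ⟨g, h⟩ q
      obtain ⟨x, rfl⟩ := arrowMk_surjective q
      rw [of_smul_arrowMk, RepModule.of_smul]
      simp only [LinearMap.comp_apply, LinearEquiv.coe_coe, LinearEquiv.apply_symm_apply]
      refine congrArg _ ((tensorDualEquiv k W V).injective ?_)
      rw [tensorDualEquiv_outerTensorDual, LinearEquiv.apply_symm_apply,
        LinearEquiv.apply_symm_apply, hδ, hδ, hγ.2.1, hγ.2.2]
    · rw [arrowHomToRadicalHoms_apply, homOfCommute_apply]
      simp only [LinearMap.comp_apply, LinearEquiv.coe_coe, LinearEquiv.apply_symm_apply, hδ]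

end ArrowHoms

/-! ### The number of arrows -/

section Arrows

lemma cast_card_ne_zero {k : Type*} [Field k] {n : ℕ} (h : ¬ ringChar k ∣ n) : (n : k) ≠ 0 :=
  fun h0 => h ((ringChar.spec k n).1 h0)

variable {k : Type u} [Field k] {M : Type v} [Monoid M] [Finite M] [RightFountain M] {e f : Idem M}

instance : Module.Finite k (TildeModule k e) := Module.Finite.of_basis (tildeBasis k e)

/-- `Ext¹(Coind_{G_e}(V), Coind_{G_f}(W))` is isomorphic to the space of the `k[G_f × G_e]`-linear
maps from `f rad(k L̃_e) / f I(f) rad(k L̃_e)` to `W ⊗ D(V)`. -/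
lemma nonempty_arrowHom_equiv_arrowSpace [NeZero (Nat.card (MaxSubgroup e) : k)]
    [NeZero (Nat.card (MaxSubgroup f) : k)]
    (hsimple : ∀ (a : Idem M) (V : Type (max u v)) [AddCommGroup V] [Module k V]
      (σ : Representation k (MaxSubgroup a) V), σ.IsIrreducible →
        IsSimpleModule (MonoidAlgebra k M) (RepModule (coindRep σ)))
    {V : Type (max u v)} [AddCommGroup V] [Module k V] {σ : Representation k (MaxSubgroup e) V}
    (hσ : σ.IsIrreducible)
    {W : Type (max u v)} [AddCommGroup W] [Module k W] {τ : Representation k (MaxSubgroup f) W}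
    (hτ : τ.IsIrreducible) :
    Nonempty ((RepModule (arrowRep k f e) →ₗ[MonoidAlgebra k (MaxSubgroup f × MaxSubgroup e)]
      RepModule (outerTensorDual τ σ)) ≃ₗ[k]
      ArrowSpace (MonoidAlgebra k M) (RepModule (coindRep σ)) (RepModule (coindRep τ))) := by
  have := hsimple e V σ hσ
  have := hsimple f W τ hτ
  have := nontrivial_of_isIrreducible hσ
  have := finite_of_isIrreducible hσ
  have hrad : ∀ x ∈ radical (lTildeRep k e), ∀ r : RClass e,
      groupPart k (lTildeRep k e r.1 x) = 0 :=
    fun x hx r => groupPart_eq_zero_of_mem_radical (hsimple e) hx r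
  obtain ⟨E⟩ := nonempty_ker_hom_equiv_arrowSpace σ τ
  exact ⟨(LinearEquiv.ofBijective _ (arrowHomToRadicalHoms_bijective σ τ)).trans
    ((LinearEquiv.ofBijective (kerHomToRadicalHoms σ τ hrad) ⟨kerHomToRadicalHoms_injective hrad,
      kerHomToRadicalHoms_surjective hrad⟩).symm.trans E)⟩

end Arrows

end FountainMonoid

theorem theoremt {k : Type u} [Field k] {M : Type v} [Monoid M] [Finite M] [RightFountain M]
    -- the characteristic divides the order of no maximal subgroup
    (hchar : ∀ a : Idem M, ¬ ringChar k ∣ Nat.card (MaxSubgroup a))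
    -- `k` is a splitting field for each maximal subgroup
    (hsplit : ∀ a : Idem M, IsSplitAlgebra k (MonoidAlgebra k (MaxSubgroup a)))
    -- one of the three equivalent conditions holds
    {n : ℕ} (ε : Fin n → Idem M) (hε : IsRegularRepresentatives ε)
    (hcond :
      (∀ i, SandwichRightInvertible k (ε i)) ∨
      (∀ (i : Fin n) (U : Type (max u v)) [AddCommGroup U] [Module k U]
        (π : Representation k (MaxSubgroup (ε i)) U), π.IsIrreducible →
          IsSimpleModule (MonoidAlgebra k M) (RepModule (coindRep π))) ∨
      (∀ (i : Fin n) (U : Type (max u v)) [AddCommGroup U] [Module k U]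
        (π : Representation k (MaxSubgroup (ε i)) U), π.IsIrreducible →
          IsProjectiveCover (MonoidAlgebra k M) (RepModule (tildeIndRep π)) (sharp π)))
    (e f : Idem M)
    (W : Type (max u v)) [AddCommGroup W] [Module k W]
    (τ : Representation k (MaxSubgroup f) W) (hτ : τ.IsIrreducible)
    (V : Type (max u v)) [AddCommGroup V] [Module k V]
    (σ : Representation k (MaxSubgroup e) V) (hσ : σ.IsIrreducible) :
    -- the two coinduced modules are vertices of the quiver, with finitely many arrows
    IsSimpleModule (MonoidAlgebra k M) (RepModule (coindRep σ)) ∧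
    IsSimpleModule (MonoidAlgebra k M) (RepModule (coindRep τ)) ∧
    Module.Finite k (ArrowSpace (MonoidAlgebra k M)
      (RepModule (coindRep σ)) (RepModule (coindRep τ))) ∧
    -- the number of arrows is the multiplicity
    IsConstituentMultiplicity (MonoidAlgebra k (MaxSubgroup f × MaxSubgroup e))
      (RepModule (arrowRep k f e)) (RepModule (outerTensorDual τ σ))
      (quiverArrows k (MonoidAlgebra k M)
        (RepModule (coindRep σ)) (RepModule (coindRep τ))) := by
  have hne : ∀ a : Idem M, NeZero (Nat.card (MaxSubgroup a) : k) :=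
    fun a => ⟨cast_card_ne_zero (hchar a)⟩
  have hsimple := fun (a : Idem M) (U : Type (max u v)) [AddCommGroup U] [Module k U]
    (π : Representation k (MaxSubgroup a) U) (hπ : π.IsIrreducible) =>
      isSimpleModule_coind hε hcond a U π hπ
  have := finite_of_isIrreducible hσ
  have := finite_of_isIrreducible hτ
  have := nontrivial_of_isIrreducible hσ
  have := nontrivial_of_isIrreducible hτ
  have hσ' := asAlgebraHom_surjective hσ
    fun _ hT => exists_smul_of_commute_of_isSplit (hsplit e) hσ hT
  have hτ' := asAlgebraHom_surjective hτ
    fun _ hT => exists_smul_of_commute_of_isSplit (hsplit f) hτ hT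
  have hX : IsSimpleModule (MonoidAlgebra k (MaxSubgroup f × MaxSubgroup e))
      (RepModule (outerTensorDual τ σ)) :=
    isIrreducible_iff.1 (outerTensorDual_isIrreducible hτ' hσ')
  have hprod : NeZero (Nat.card (MaxSubgroup f × MaxSubgroup e) : k) := ⟨by
    rw [Nat.card_prod, Nat.cast_mul]
    exact mul_ne_zero (NeZero.ne _) (NeZero.ne _)⟩
  obtain ⟨E⟩ := nonempty_arrowHom_equiv_arrowSpace hsimple hσ hτ
  have hfin : Module.Finite k (RepModule (arrowRep k f e) →ₗ[MonoidAlgebra k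
      (MaxSubgroup f × MaxSubgroup e)] RepModule (outerTensorDual τ σ)) := finite_hom
  refine ⟨hsimple e V σ hσ, hsimple f W τ hτ, Module.Finite.equiv E, ?_⟩
  rw [quiverArrows, ← E.finrank_eq]
  refine isConstituentMultiplicity_finrank_hom fun T => ?_
  refine outerTensorDual_exists_smul hτ' hσ' (T := T.restrictScalars k) fun p u => ?_
  have := T.map_smul (MonoidAlgebra.of k _ p)
    ((RepModule.equiv (outerTensorDual τ σ)).symm u)
  rw [RepModule.of_smul, RepModule.of_smul, LinearEquiv.apply_symm_apply] at this
  exact this
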